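/- Notation. For $\beta\in\{1,2,4\}$, an interval $I$, a weight $w$ on $I$ and an integer $n\ge 1$, let $\langle\cdot\rangle$ denote the average with respect to the probability density on $I^n$ proportional to $\prod_{j}w(x_j)\prod_{i<j}|x_j-x_i|^{\beta}$. * $\langle\mathcal T^{(\beta,\delta)}_{k,n,m}\rangle$ is the average of $\sum_{j=1}^n T_j^k$ for $I=[0,1]$ and $w(T)=T^{\frac{\beta}{2}(m-n+1)-1}(1-T)^{\delta/2}$ (moments of the transmission eigenvalues). * $M^{(\beta)}_{\mathrm L_b}(k,n)$ is the average of $\sum_{j=1}^n x_j^k$ for $I=[0,\infty)$ and $w(x)=x^{\frac{\beta}{2}(b+1)-1}e^{-\beta x/2}$. * $\langle\mathcal D^{(\beta)}_{k,n}\rangle$ is the average of $\frac1n\sum_{j=1}^n\gamma_j^{-k}$ for $I=[0,\infty)$ and $w(\gamma)=\gamma^{n\beta/2}e^{-\beta n\gamma/2}$ (moments of the proper delay times $\tau_j=\gamma_j^{-1}$). Write $(x)_{(k)}=\Gamma(x+k)/\Gamma(x)$ for integers $k$ of any sign, $1/\Gamma=0$ at the poles of $\Gamma$, and $\binom{-k}{j}=(-1)^j\binom{k+j-1}{j}$.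 When $2n,2m$ are positive integers with $n$ a half-integer, $\langle\mathcal T^{(4,\delta)}_{k,n,m}\rangle$ and $M^{(4)}_{\mathrm L_b}(k,n)$ are defined by the expressions $$\langle\mathcal T^{(4,\delta)}_{k,n,m}\rangle=\tfrac12\langle\mathcal T^{(2,\delta-2)}_{k,2n,2m}\rangle-\sum_{j=1}^{\min(\lfloor n\rfloor,\lfloor k/2\rfloor)}\ \sum_{i=0}^{\min(k-2j,2n-2j)}\binom ki\binom k{i+2j}\mathcal S^{\delta}_{i,j}(k,m,n),$$ $$\begin{aligned}\mathcal S^\delta_{i,j}(k,m,n)&=2^{4j-3}\frac{(\frac\delta2+2n-i-2j)_{(i)}\,(2m)_{(k-i-2j+1)}\,(\frac\delta2+2m-1)_{(k-i-2j+1)}}{(\frac\delta4+n+\frac12)_{(-j)}\,(m)_{(1-j)}\,(\frac\delta4+m-\frac12)_{(1-j)}\,(2n-2j+1)_{(-i)}\,(n+1)_{(-j)}}\\&\quad\times\frac{(\frac\delta2+2m+2n-4j)(\frac\delta2+2m+2n-2i-4j+k)}{(\frac\delta2+2m+2n-i-2j)_{(1+k)}\,(\frac\delta2+2m+2n-i-4j)_{(1+k)}},\end{aligned}$$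 $$M^{(4)}_{\mathrm L_b}(k,n)=2^{-k-1}M^{(2)}_{\mathrm L_{2b}}(k,2n)-\sum_{j=1}^{\lfloor n\rfloor}\sum_{i=0}^{2n-2j}\binom ki\binom k{i+2j}\frac{(2b+2n)_{(k-i-2j+1)}\,(2n-i-2j+1)_{(i)}}{2^{k-2j+2}\,(n+1)_{(-j)}\,(b+n)_{(1-j)}}.$$ Theorem. Let $n\ge 2$ be an even integer and $k\ge1$ an integer. (1) Let $m\ge n$ be an integer and $\delta>-2$ a real number. Then $\langle\mathcal T^{(1,\delta)}_{k,n,m}\rangle$ is well defined (the density is normalisable and the average converges absolutely) and $$\langle\mathcal T^{(1,\delta)}_{k,n,m}\rangle=2\bigl\langle\mathcal T^{(4,2\delta+4)}_{k,(n-1)/2,(m-1)/2}\bigr\rangle+\sum_{j=0}^{\min(n/2-1,k)}\binom{2k}{2j}I^{(1,\delta)}_j(k,m,n)+\phi^{\mathrm J}_{k,n},$$ where $$I^{(1,\delta)}_j(k,m,n)=4^k\frac{(\delta+m+n-4j+2k)\,(\frac12(\delta+m+1))_{(k-j)}\,(\frac12m)_{(k-j)}}{(\delta+m+n-2j)_{(2k+1)}\,(\frac12(\delta+n+2))_{(-j)}\,(\frac12(1+n))_{(-j)}},$$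 $$\begin{aligned}\phi^{\mathrm J}_{k,n}&=\sum_{j=1}^k\frac{2^{\delta+2}\,\Gamma(\frac12(\delta+m-n+2j+1))\,\Gamma(\frac12(\delta+m+2))}{\Gamma(\delta+1+m+j+k)\,\Gamma(j+k+1-n)\,\Gamma(\frac12(m-n+1+2j))}\\&\quad\times\frac{\Gamma(\frac12(\delta+n+2))\,\Gamma(m-n+k+j)\,\Gamma(j+k)}{\Gamma(\frac m2)\,\Gamma(\frac\delta2+1)\,\Gamma(\frac n2)},\end{aligned}$$ and $\phi^{\mathrm J}_{k,n}=0$ whenever $n>2k$. (2) If $k<\frac n2+1$, then $\langle\mathcal D^{(1)}_{k,n}\rangle$ is well defined in the same sense and $$\langle\mathcal D^{(1)}_{k,n}\rangle=n^{k-1}2^{1-k}M^{(4)}_{\mathrm L_{(n+1)/2}}\bigl(-k,\tfrac{n-1}2\bigr)+\Bigl(\frac n2\Bigr)^{k-1}\sum_{j=0}^{n/2-1}\binom{2k+2j-1}{2j}\frac{(n+\frac12)_{(-j-k)}}{2\,(\frac12(1+n))_{(-j)}}+n^{k-1}\phi^{\mathrm L}_{-k,n},$$ where $$\phi^{\mathrm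 L}_{-k,n}=\frac{\Gamma(n)}{\Gamma(n/2)\Gamma(2n)}\sum_{j=0}^{k-1}\frac{\Gamma(k+j+n)\,\Gamma(1+n-k-j)}{\Gamma(\frac n2+1-j)\,\Gamma(k+j+1)}\,2^j.$$ -/

import Mathlib

open MeasureTheory

noncomputable section

namespace BallisticCavity

/-- The (unnormalised) joint density `∏ⱼ w(xⱼ) · ∏_{i<j} |xⱼ - xᵢ|^β` of `n` eigenvalues. -/
def jointDensity (β : ℕ) (w : ℝ → ℝ) (n : ℕ) (x : Fin n → ℝ) : ℝ :=
  (∏ j, w (x j)) * ∏ i, ∏ j ∈ Finset.Ioi i, |x j - x i| ^ β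

/-- The cube `I × ⋯ × I` (`n` factors). -/
def cube (I : Set ℝ) (n : ℕ) : Set (Fin n → ℝ) := Set.univ.pi fun _ => I

/-- The normalisation constant of the joint density on `Iⁿ`. -/
def normalization (β : ℕ) (w : ℝ → ℝ) (I : Set ℝ) (n : ℕ) : ℝ :=
  ∫ x in cube I n, jointDensity β w n x

/-- The average of the linear statistic `∑ⱼ f(xⱼ)` with respect to the normalised joint density
on `Iⁿ`. -/
def average (β : ℕ) (w : ℝ → ℝ) (I : Set ℝ) (n : ℕ) (f : ℝ → ℝ) : ℝ :=
  (∫ x in cube I n, (∑ j, f (x j)) * jointDensity β w n x) / normalization β w I n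

/-- The joint density is integrable with positive total mass, so that it can be normalised to a
probability density, and `∑ⱼ f(xⱼ)` is integrable with respect to it. -/
def AverageExists (β : ℕ) (w : ℝ → ℝ) (I : Set ℝ) (n : ℕ) (f : ℝ → ℝ) : Prop :=
  IntegrableOn (jointDensity β w n) (cube I n) ∧ 0 < normalization β w I n ∧
    IntegrableOn (fun x => (∑ j, f (x j)) * jointDensity β w n x) (cube I n)

/-- The one-particle weight `T^α (1 - T)^(δ/2)`, `α = (β/2)(m - n + 1) - 1`, of the transmission
eigenvalues of a cavity in the symmetry class `(β, δ)` whose leads support `m` and `n` channels. -/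
def transmissionWeight (β : ℕ) (δ : ℝ) (n m : ℕ) (T : ℝ) : ℝ :=
  T ^ ((β : ℝ) / 2 * ((m : ℝ) - n + 1) - 1) * (1 - T) ^ (δ / 2)

/-- The `k`-th moment `⟨𝒯^{(β,δ)}_{k,n,m}⟩` of the `n` transmission eigenvalues `T₁, …, Tₙ ∈ [0,1]`. -/
def transmissionMoment (β : ℕ) (δ : ℝ) (k n m : ℕ) : ℝ :=
  average β (transmissionWeight β δ n m) (Set.Icc 0 1) n fun T => T ^ k

/-- The weight `x^((β/2)(b+1)-1) e^(-βx/2)` of the Laguerre ensemble. -/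
def laguerreWeight (β : ℕ) (b x : ℝ) : ℝ :=
  x ^ ((β : ℝ) / 2 * (b + 1) - 1) * Real.exp (-(β : ℝ) * x / 2)

/-- The moment `M^{(β)}_{L_b}(k, n)` of the Laguerre ensemble, where `k` may be negative. -/
def laguerreMoment (β : ℕ) (b : ℝ) (k : ℤ) (n : ℕ) : ℝ :=
  average β (laguerreWeight β b) (Set.Ici 0) n fun x => x ^ k

/-- The one-particle weight `γ^(nβ/2) e^(-β τ_H γ/2)` of the inverse proper delay times
`γⱼ = τⱼ⁻¹`, where the Heisenberg time is `τ_H = n`. -/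
def delayWeight (β n : ℕ) (γ : ℝ) : ℝ :=
  γ ^ ((n : ℝ) * β / 2) * Real.exp (-(β : ℝ) * n * γ / 2)

/-- The `k`-th moment `⟨𝒟^{(β)}_{k,n}⟩ = (1/n) ⟨∑ⱼ τⱼ^k⟩` of the density of the proper delay
times. -/
def delayMoment (β k n : ℕ) : ℝ :=
  1 / (n : ℝ) * average β (delayWeight β n) (Set.Ici 0) n fun γ => (γ⁻¹) ^ k

/-- The Pochhammer symbol `(x)_{(k)} = Γ(x + k) / Γ(x)`, for an integer `k` of any sign. -/
def poch (x : ℝ) (k : ℤ) : ℝ := Real.Gamma (x + k) / Real.Gamma x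

/-- The coefficient `𝒮^δ_{i,j}(k, m, n)` of the symplectic transmission moments. -/
def symplecticCoeff (δ : ℝ) (i j k : ℕ) (m n : ℝ) : ℝ :=
  (2 : ℝ) ^ (4 * (j : ℤ) - 3) *
      (poch (δ / 2 + 2 * n - i - 2 * j) i * poch (2 * m) ((k : ℤ) - i - 2 * j + 1) *
        poch (δ / 2 + 2 * m - 1) ((k : ℤ) - i - 2 * j + 1)) /
      (poch (δ / 4 + n + 1 / 2) (-(j : ℤ)) * poch m (1 - (j : ℤ)) *
        poch (δ / 4 + m - 1 / 2) (1 - (j : ℤ)) * poch (2 * n - 2 * j + 1) (-(i : ℤ)) *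
        poch (n + 1) (-(j : ℤ))) *
    ((δ / 2 + 2 * m + 2 * n - 4 * j) * (δ / 2 + 2 * m + 2 * n - 2 * i - 4 * j + k) /
      (poch (δ / 2 + 2 * m + 2 * n - i - 2 * j) (1 + (k : ℤ)) *
        poch (δ / 2 + 2 * m + 2 * n - i - 4 * j) (1 + (k : ℤ))))

/-- The quantity `⟨𝒯^{(4,δ)}_{k,n,m}⟩` for integer or half-integer `n = N/2`, `m = M/2`:
`(1/2) ⟨𝒯^{(2,δ-2)}_{k,2n,2m}⟩` minus
`∑_{j=1}^{min(⌊n⌋,⌊k/2⌋)} ∑_{i=0}^{min(k-2j,2n-2j)} C(k,i) C(k,i+2j) 𝒮^δ_{i,j}(k,m,n)`.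
The arguments are the doubled numbers `N = 2n`, `M = 2m`. -/
def halfSymplecticTransmission (δ : ℝ) (k N M : ℕ) : ℝ :=
  1 / 2 * transmissionMoment 2 (δ - 2) k N M -
    ∑ j ∈ Finset.Icc 1 (min (N / 2) (k / 2)), ∑ i ∈ Finset.Icc 0 (min (k - 2 * j) (N - 2 * j)),
      (k.choose i : ℝ) * (k.choose (i + 2 * j) : ℝ) *
        symplecticCoeff δ i j k ((M : ℝ) / 2) ((N : ℝ) / 2)

/-- The quantity `M^{(4)}_{L_b}(k, n)` for integer or half-integer `n = N/2` and integer `k` of any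
sign: `2^{-k-1} M^{(2)}_{L_{2b}}(k, 2n)` minus the double sum over `1 ≤ j ≤ ⌊n⌋`, `0 ≤ i ≤ 2n - 2j` of
`C(k,i) C(k,i+2j) (2b+2n)_{(k-i-2j+1)} (2n-i-2j+1)_{(i)} / (2^{k-2j+2} (n+1)_{(-j)} (b+n)_{(1-j)})`,
the binomial coefficients being the generalised ones. The last argument is the doubled number
`N = 2n`. -/
def halfSymplecticLaguerre (b : ℝ) (k : ℤ) (N : ℕ) : ℝ :=
  (2 : ℝ) ^ (-k - 1) * laguerreMoment 2 (2 * b) k N -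
    ∑ j ∈ Finset.Icc 1 (N / 2), ∑ i ∈ Finset.Icc 0 (N - 2 * j),
      ((Ring.choose k i : ℤ) : ℝ) * ((Ring.choose k (i + 2 * j) : ℤ) : ℝ) *
        (poch (2 * b + N) (k - i - 2 * j + 1) * poch ((N : ℝ) - i - 2 * j + 1) i /
          ((2 : ℝ) ^ (k - 2 * (j : ℤ) + 2) * poch ((N : ℝ) / 2 + 1) (-(j : ℤ)) *
            poch (b + (N : ℝ) / 2) (1 - (j : ℤ))))

/-- The coefficient `I_j^{(1,δ)}(k, m, n)`. -/
def orthogonalCoeff (δ : ℝ) (j k m n : ℕ) : ℝ :=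
  (4 : ℝ) ^ k *
    ((δ + m + n - 4 * j + 2 * k) * poch ((δ + m + 1) / 2) ((k : ℤ) - j) *
        poch ((m : ℝ) / 2) ((k : ℤ) - j) /
      (poch (δ + m + n - 2 * j) (2 * (k : ℤ) + 1) * poch ((δ + n + 2) / 2) (-(j : ℤ)) *
        poch ((1 + (n : ℝ)) / 2) (-(j : ℤ))))

/-- The correction term `φ^J_{k,n}`. Its factor `1/Γ(j+k+1-n)` is read as `0` where `j+k+1-n` is
a non-positive integer, in agreement with `Real.Gamma = 0` at the poles. -/
def phiJ (δ : ℝ) (k n m : ℕ) : ℝ :=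
  ∑ j ∈ Finset.Icc 1 k,
    ((2 : ℝ) ^ (δ + 2) * Real.Gamma ((δ + m - n + 2 * j + 1) / 2) * Real.Gamma ((δ + m + 2) / 2) /
        (Real.Gamma (δ + 1 + m + j + k) * Real.Gamma ((j : ℝ) + k + 1 - n) *
          Real.Gamma (((m : ℝ) - n + 1 + 2 * j) / 2)) *
      (Real.Gamma ((δ + n + 2) / 2) * Real.Gamma ((m : ℝ) - n + k + j) *
          Real.Gamma ((j : ℝ) + k) /
        (Real.Gamma ((m : ℝ) / 2) * Real.Gamma (δ / 2 + 1) * Real.Gamma ((n : ℝ) / 2))))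

/-- The correction term `φ^L_{-k,n}`. -/
def phiL (k n : ℕ) : ℝ :=
  Real.Gamma n / (Real.Gamma ((n : ℝ) / 2) * Real.Gamma (2 * (n : ℝ))) *
    ∑ j ∈ Finset.range k,
      Real.Gamma ((k : ℝ) + j + n) * Real.Gamma (1 + (n : ℝ) - k - j) /
        (Real.Gamma ((n : ℝ) / 2 + 1 - j) * Real.Gamma ((k : ℝ) + j + 1)) * (2 : ℝ) ^ j

end BallisticCavity

end

/-! ### Unitary ensembles: integrals of squared determinants. -/

namespace ClassicalEnsemble

/-! For `β = 1` the joint density is `|Δ(x)| ∏ w(xⱼ)`. Integrating the variables in pairs (de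
Bruijn) turns the normalisation into a Pfaffian of the skew form `⟨f, g⟩ = ∬ sgn(y - x) f(x) w(x)
g(y) w(y)`, and inserting a linear statistic produces the logarithmic derivative of this Pfaffian.
With monic polynomials that are skew-orthogonal in pairs, the average is therefore a sum over pairs
(`integral_orderSign_mul_det`, `average_one_eq`). For `β = 2` the analogous computation gives a sum
over orthogonal polynomials (`average_two_eq`).

The two cases are linked by the Pearson equation. If `(σ w)' = (τ / 2) w` and `σ w` vanishes at the
ends, then the operator `D g = σ g' + (τ / 2) g` satisfies `(g σ w)' = (D g) w`, so that `⟨f, D g⟩ =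
-2 ∫ f g σ w²`. Let `P_l` be the monic orthogonal polynomials of the unitary weight `σ w²`. In this
basis `D` is tridiagonal with zero diagonal, whence the `P_{2i}` together with the `D P_{2i}` are
skew-orthogonal. The sum over pairs telescopes (`sum_form_eq`) to the unitary sum over `l < n - 1`
plus one boundary term.

The boundary term obeys a first-order recursion (`boundary_form_eq`). Its solution consists of the
cross moments of `P_{n-1}` with the lower odd `P_{2i+1}`, and of the pairing of `f P_{n-1}` with
`1`. The cross moments are evaluated by connection coefficients between weights that differ by a
power of `x`; they form the double sum of the symplectic expression at `(n - 1) / 2`. In the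
remaining pairing, `1` is a multiple of `x ^ k` modulo the image of `D` (`one_eq_rho`). The multiple
of `x ^ k` leads to a skew form for the weight multiplied (for negative moments: divided) by `x ^ k`
and gives the single sum; the image of `D` gives the correction `φ` (`form_X_pow_mul_pol_one`,
`form_pol_X_pow`).

Jacobi and Laguerre weights are treated together, with `σ = x (1 - e x)` and `τ = a + 1 - d x`:
Jacobi is `e = 1`, `d = a + b + 2`, and Laguerre is `e = 0` with `d` the exponential rate. The
polynomial theory is purely algebraic, for the moment functional `mom e a d`. What remains is the
term by term identification of Gamma factors, where the duplication formula converts full into half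
arguments. -/

open Polynomial in
/-- The squared Vandermonde determinant in terms of monic polynomials. -/
lemma jointDensity_two_eq (w : ℝ → ℝ) (N : ℕ) (P : ℕ → ℝ[X]) (hm : ∀ i, (P i).Monic)
    (hd : ∀ i, (P i).natDegree = i) (x : Fin N → ℝ) :
    BallisticCavity.jointDensity 2 w N x =
      (∏ j, w (x j)) * (Matrix.det (Matrix.of fun i j : Fin N => (P i).eval (x j))) ^ 2 := by
  have h := Matrix.det_eval_matrixOfPolynomials_eq_det_vandermonde x (fun i : Fin N => P i)
    (fun i => hd i) (fun i => hm i)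
  have h2 : (Matrix.of fun i j : Fin N => (P i).eval (x j)).det = (Matrix.vandermonde x).det := by
    rw [h, ← Matrix.det_transpose]; rfl
  rw [h2, Matrix.det_vandermonde, BallisticCavity.jointDensity]
  simp only [sq_abs, Finset.prod_pow]

section SquaredDeterminant

variable {μ : Measure ℝ} [SigmaFinite μ] {N : ℕ} (φ : Fin N → ℝ → ℝ) (w : ℝ → ℝ)

/-- After the expansion every term separates into functions of one variable, so Fubini applies. The
factors `g j` let a single variable carry the statistic. -/
lemma sq_det_expand (g : Fin N → ℝ → ℝ) (x : Fin N → ℝ) :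
    (∏ j, g j (x j)) * ((∏ j, w (x j)) * (Matrix.det (Matrix.of fun i j => φ i (x j))) ^ 2) =
      ∑ σ : Equiv.Perm (Fin N), ∑ τ : Equiv.Perm (Fin N),
        ((Equiv.Perm.sign σ : ℤ) : ℝ) * ((Equiv.Perm.sign τ : ℤ) : ℝ) *
          ∏ j, (g j (x j) * (φ (σ j) (x j) * φ (τ j) (x j) * w (x j))) := by
  rw [Matrix.det_apply', sq, Finset.sum_mul_sum, Finset.mul_sum, Finset.mul_sum]
  refine Finset.sum_congr rfl fun σ _ => ?_
  rw [Finset.mul_sum, Finset.mul_sum]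
  refine Finset.sum_congr rfl fun τ _ => ?_
  simp only [Finset.prod_mul_distrib, Matrix.of_apply]
  ring

lemma integrable_sq_det (g : Fin N → ℝ → ℝ)
    (hint : ∀ l i j, Integrable (fun x => g l x * (φ i x * φ j x * w x)) μ) :
    Integrable (fun x : Fin N → ℝ => (∏ j, g j (x j)) *
      ((∏ j, w (x j)) * (Matrix.det (Matrix.of fun i j => φ i (x j))) ^ 2))
      (Measure.pi fun _ => μ) := by
  simp_rw [sq_det_expand]
  refine integrable_finsetSum _ fun σ _ => integrable_finsetSum _ fun τ _ => ?_
  exact (Integrable.fintype_prod (f := fun j y => g j y * (φ (σ j) y * φ (τ j) y * w y))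
    fun j => hint _ _ _).const_mul _

lemma integral_sq_det (g : Fin N → ℝ → ℝ)
    (hint : ∀ l i j, Integrable (fun x => g l x * (φ i x * φ j x * w x)) μ) :
    ∫ x : Fin N → ℝ, (∏ j, g j (x j)) *
      ((∏ j, w (x j)) * (Matrix.det (Matrix.of fun i j => φ i (x j))) ^ 2)
      ∂(Measure.pi fun _ => μ) =
    ∑ σ : Equiv.Perm (Fin N), ∑ τ : Equiv.Perm (Fin N),
        ((Equiv.Perm.sign σ : ℤ) : ℝ) * ((Equiv.Perm.sign τ : ℤ) : ℝ) *
          ∏ j, ∫ y, g j y * (φ (σ j) y * φ (τ j) y * w y) ∂μ := by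
  simp_rw [sq_det_expand]
  have hI : ∀ σ τ : Equiv.Perm (Fin N), Integrable (fun x : Fin N → ℝ =>
      ((Equiv.Perm.sign σ : ℤ) : ℝ) * ((Equiv.Perm.sign τ : ℤ) : ℝ) *
          ∏ j, (g j (x j) * (φ (σ j) (x j) * φ (τ j) (x j) * w (x j))))
      (Measure.pi fun _ => μ) := fun σ τ =>
    (Integrable.fintype_prod (f := fun j y => g j y * (φ (σ j) y * φ (τ j) y * w y))
      fun j => hint _ _ _).const_mul _
  rw [integral_finsetSum _ fun σ _ => integrable_finsetSum _ fun τ _ => hI σ τ]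
  refine Finset.sum_congr rfl fun σ _ => ?_
  rw [integral_finsetSum _ fun τ _ => hI σ τ]
  refine Finset.sum_congr rfl fun τ _ => ?_
  rw [integral_const_mul]
  rw [integral_fintype_prod_eq_prod (fun j y => g j y * (φ (σ j) y * φ (τ j) y * w y))]

/-- Two distinct permutations therefore differ at some index other than the one carrying the
statistic, and orthogonality at that index kills the corresponding term. -/
lemma perm_eq_of_forall_ne {ι : Type*} [DecidableEq ι] {σ τ : Equiv.Perm ι} (l : ι)
    (h : ∀ j, j ≠ l → σ j = τ j) : σ = τ := by
  ext j
  by_cases hj : j = l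
  · subst hj
    by_contra hne
    have h1 : σ.symm (τ j) ≠ j := fun h' => hne (by
      rw [Equiv.symm_apply_eq] at h'; exact h'.symm)
    have h2 := h _ h1
    rw [Equiv.apply_symm_apply] at h2
    exact h1 (τ.injective h2).symm
  · exact h j hj

/-- Normalisation and averages of linear statistics for a squared determinant of orthogonal
functions. -/
theorem integral_sq_det_orthogonal (f : ℝ → ℝ) (h : Fin N → ℝ)
    (hint : ∀ i j, Integrable (fun x => φ i x * φ j x * w x) μ)
    (hintf : ∀ i j, Integrable (fun x => f x * (φ i x * φ j x * w x)) μ)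
    (horth : ∀ i j, i ≠ j → ∫ x, φ i x * φ j x * w x ∂μ = 0)
    (hh : ∀ i, ∫ x, φ i x * φ i x * w x ∂μ = h i) (h0 : ∀ i, h i ≠ 0) :
    (∫ x : Fin N → ℝ, (∏ j, w (x j)) * (Matrix.det (Matrix.of fun i j => φ i (x j))) ^ 2
      ∂(Measure.pi fun _ => μ) = (N.factorial : ℝ) * ∏ i, h i) ∧
    (∫ x : Fin N → ℝ, (∑ l, f (x l)) *
        ((∏ j, w (x j)) * (Matrix.det (Matrix.of fun i j => φ i (x j))) ^ 2)
      ∂(Measure.pi fun _ => μ) = ((N.factorial : ℝ) * ∏ i, h i) *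
        ∑ i, (∫ x, f x * (φ i x * φ i x * w x) ∂μ) / h i) := by
  have hsign : ∀ σ : Equiv.Perm (Fin N),
      ((Equiv.Perm.sign σ : ℤ) : ℝ) * ((Equiv.Perm.sign σ : ℤ) : ℝ) = 1 := by
    intro σ
    rcases Int.units_eq_one_or (Equiv.Perm.sign σ) with h | h <;> simp [h]
  constructor
  · have := integral_sq_det (μ := μ) φ w (fun _ _ => 1) (by simpa using fun _ => hint)
    simp only [Finset.prod_const_one, one_mul] at this
    rw [this]
    have hz : ∀ σ : Equiv.Perm (Fin N), (∑ τ : Equiv.Perm (Fin N),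
        ((Equiv.Perm.sign σ : ℤ) : ℝ) * ((Equiv.Perm.sign τ : ℤ) : ℝ) *
          ∏ j, ∫ y, (φ (σ j) y * φ (τ j) y * w y) ∂μ) = ∏ i, h i := by
      intro σ
      rw [Finset.sum_eq_single σ]
      · rw [hsign, one_mul]
        simp_rw [hh]
        exact Equiv.prod_comp σ h
      · intro τ _ hτ
        obtain ⟨j, hj⟩ : ∃ j, σ j ≠ τ j := by
          by_contra! hc
          exact hτ (Equiv.ext fun j => (hc j).symm)
        rw [Finset.prod_eq_zero (Finset.mem_univ j) (horth _ _ hj), mul_zero]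
      · simp
    simp_rw [hz]
    simp [Fintype.card_perm]
  · let g : Fin N → Fin N → ℝ → ℝ := fun l j => if j = l then f else fun _ => 1
    have hg : ∀ l (x : Fin N → ℝ), ∏ j, g l j (x j) = f (x l) := by
      intro l x
      rw [Finset.prod_eq_single l]
      · simp [g]
      · intro j _ hj; simp [g, hj]
      · simp
    have hgi : ∀ l l' i j, Integrable (fun x => g l l' x * (φ i x * φ j x * w x)) μ := by
      intro l l' i j
      by_cases hl : l' = l
      · simpa [g, hl] using hintf i j
      · simpa [g, hl] using hint i j
    simp_rw [Finset.sum_mul, ← hg]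
    rw [integral_finsetSum _ fun l _ => integrable_sq_det φ w (g l) (hgi l)]
    simp_rw [integral_sq_det φ w (g _) (hgi _)]
    have hz : ∀ l, ∀ σ : Equiv.Perm (Fin N), (∑ τ : Equiv.Perm (Fin N),
        ((Equiv.Perm.sign σ : ℤ) : ℝ) * ((Equiv.Perm.sign τ : ℤ) : ℝ) *
          ∏ j, ∫ y, g l j y * (φ (σ j) y * φ (τ j) y * w y) ∂μ) = (∏ i, h i) *
            ((∫ x, f x * (φ (σ l) x * φ (σ l) x * w x) ∂μ) / h (σ l)) := by
      intro l σ
      rw [Finset.sum_eq_single σ]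
      · rw [hsign, one_mul, ← Equiv.prod_comp σ h, ← Finset.mul_prod_erase _ _ (Finset.mem_univ l),
          ← Finset.mul_prod_erase Finset.univ (fun i => h (σ i)) (Finset.mem_univ l)]
        have : ∀ j ∈ Finset.univ.erase l,
            ∫ y, g l j y * (φ (σ j) y * φ (σ j) y * w y) ∂μ = h (σ j) := by
          intro j hj
          simp [g, Finset.ne_of_mem_erase hj, hh]
        rw [Finset.prod_congr rfl this]
        simp only [g, if_true]
        field_simp [h0 (σ l)]
      · intro τ _ hτ
        obtain ⟨j, hjl, hj⟩ : ∃ j, j ≠ l ∧ σ j ≠ τ j := by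
          by_contra! hc
          exact hτ (perm_eq_of_forall_ne l fun j hj => (hc j hj).symm)
        rw [Finset.prod_eq_zero (Finset.mem_univ j), mul_zero]
        simp [g, hjl, horth _ _ hj]
      · simp
    simp_rw [hz]
    rw [Finset.sum_comm]
    have : ∀ σ : Equiv.Perm (Fin N), ∑ l, (∏ i, h i) *
            ((∫ x, f x * (φ (σ l) x * φ (σ l) x * w x) ∂μ) / h (σ l)) = (∏ i, h i) *
          ∑ i, (∫ x, f x * (φ i x * φ i x * w x) ∂μ) / h i := by
      intro σ
      rw [← Finset.mul_sum]
      congr 1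
      exact Equiv.sum_comp σ (fun i => (∫ x, f x * (φ i x * φ i x * w x) ∂μ) / h i)
    simp_rw [this]
    simp [Fintype.card_perm]
    ring

end SquaredDeterminant

lemma volume_restrict_cube (I : Set ℝ) (n : ℕ) :
    (volume : Measure (Fin n → ℝ)).restrict (BallisticCavity.cube I n) =
      Measure.pi fun _ => volume.restrict I := by
  rw [BallisticCavity.cube, volume_pi, Measure.restrict_pi_pi]

open Polynomial in
/-- The average of a linear statistic in a unitary ensemble, in terms of orthogonal polynomials. -/
theorem average_two_eq (w f : ℝ → ℝ) (I : Set ℝ) (N : ℕ) (P : ℕ → ℝ[X]) (hm : ∀ i, (P i).Monic)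
    (hd : ∀ i, (P i).natDegree = i) (h : ℕ → ℝ) (h0 : ∀ i, h i ≠ 0)
    (hint : ∀ p : ℝ[X], IntegrableOn (fun x => p.eval x * w x) I)
    (hintf : ∀ p : ℝ[X], IntegrableOn (fun x => f x * (p.eval x * w x)) I)
    (horth : ∀ i j, i ≠ j → ∫ x in I, (P i * P j).eval x * w x = 0)
    (hh : ∀ i, ∫ x in I, (P i * P i).eval x * w x = h i) :
    BallisticCavity.average 2 w I N f =
      ∑ l ∈ Finset.range N, (∫ x in I, f x * ((P l * P l).eval x * w x)) / h l := by
  have key := integral_sq_det_orthogonal (μ := volume.restrict I)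
    (fun (i : Fin N) x => (P i).eval x) w f (fun i => h i)
    (fun i j => by simpa [IntegrableOn] using hint (P i * P j))
    (fun i j => by simpa [IntegrableOn] using hintf (P i * P j))
    (fun i j hij => by simpa using horth i j (fun h => hij (Fin.ext h)))
    (fun i => by simpa using hh i) (fun i => h0 i)
  rw [BallisticCavity.average, BallisticCavity.normalization]
  simp_rw [jointDensity_two_eq w N P hm hd, volume_restrict_cube]
  rw [key.1, key.2, mul_div_assoc, mul_comm, div_mul_cancel₀, Finset.sum_range]
  · simp
  · exact mul_ne_zero (by positivity) (Finset.prod_ne_zero_iff.2 fun i _ => h0 i)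

end ClassicalEnsemble

/-! ### Pfaffian combinatorics: permutations that preserve pairs. -/

namespace ClassicalEnsemble

section Matching

variable {α : Type*}

/-- A permutation of `α ⊕ α` that maps every pair `{inl i, inr i}` to such a pair. -/
def PreservesPairs (τ : Equiv.Perm (α ⊕ α)) : Prop :=
  ∀ i, τ (Sum.inr i) = (τ (Sum.inl i)).swap

/-- The pair to which a permutation maps `inl i`. -/
def pairIndex (τ : Equiv.Perm (α ⊕ α)) (i : α) : α := Sum.elim id id (τ (Sum.inl i))

lemma eq_or_eq_swap_of_elim_eq {s t : α ⊕ α} (h : Sum.elim id id s = Sum.elim id id t) :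
    s = t ∨ s = t.swap := by
  rcases s with s | s <;> rcases t with t | t <;> simp_all

lemma swap_ne_self (s : α ⊕ α) : s.swap ≠ s := by
  rcases s with s | s <;> simp

lemma PreservesPairs.injective {τ : Equiv.Perm (α ⊕ α)} (h : PreservesPairs τ) :
    Function.Injective (pairIndex τ) := by
  intro i j hij
  rcases eq_or_eq_swap_of_elim_eq hij with h' | h'
  · exact Sum.inl_injective (τ.injective h')
  · rw [← h j] at h'
    exact absurd (τ.injective h') (by simp)

/-- All other pairs already occupy whole pairs, so the partner of `τ (inl i₀)` can only be `τ (inr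
i₀)`. Hence a permutation that breaks a pair breaks at least two, and a product stays zero when one
factor is removed. -/
lemma preservesPairs_of_forall_ne {τ : Equiv.Perm (α ⊕ α)} (i₀ : α)
    (h : ∀ i, i ≠ i₀ → τ (Sum.inr i) = (τ (Sum.inl i)).swap) : PreservesPairs τ := by
  intro i
  by_cases hi : i = i₀
  swap
  · exact h i hi
  subst hi
  obtain ⟨z, hz⟩ := τ.surjective (τ (Sum.inl i)).swap
  rcases z with z | z
  · by_cases hzi : z = i
    · subst hzi
      exact absurd hz.symm (swap_ne_self _)
    · have := h z hzi
      rw [hz, Sum.swap_swap] at this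
      exact absurd (τ.injective this) (by simp)
  · by_cases hzi : z = i
    · subst hzi; exact hz
    · have := h z hzi
      rw [hz] at this
      have := congrArg Sum.swap this
      simp only [Sum.swap_swap] at this
      exact absurd (Sum.inl_injective (τ.injective this)).symm hzi

variable [Fintype α] [DecidableEq α] {q d : α ⊕ α → α ⊕ α → ℝ}

/-- Induction on the number of flipped pairs. Without flips `τ` acts as `π ⊕ π`, whose sign is a
square. Undoing one flip changes the sign of `τ` and, by antisymmetry, the sign of one factor. -/
lemma sign_mul_prod_of_preservesPairs (hanti : ∀ s t, q t s = -q s t)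
    {τ : Equiv.Perm (α ⊕ α)} (h : PreservesPairs τ) :
    ((Equiv.Perm.sign τ : ℤ) : ℝ) * ∏ i, q (τ (Sum.inl i)) (τ (Sum.inr i)) =
      ∏ i, q (Sum.inl i) (Sum.inr i) := by
  induction hN : (Finset.univ.filter fun i => (τ (Sum.inl i)).isRight = true).card
    generalizing τ with
  | zero =>
    rw [Finset.card_eq_zero, Finset.filter_eq_empty_iff] at hN
    have hl : ∀ i, τ (Sum.inl i) = Sum.inl (pairIndex τ i) := by
      intro i
      have := hN (Finset.mem_univ i)
      rw [pairIndex]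
      generalize τ (Sum.inl i) = z at this
      rcases z with z | z <;> simp_all
    have hr : ∀ i, τ (Sum.inr i) = Sum.inr (pairIndex τ i) := by
      intro i; rw [h i, hl]; simp
    let π : Equiv.Perm α := Equiv.ofBijective _ (Finite.injective_iff_bijective.1 h.injective)
    have hτ : τ = Equiv.Perm.sumCongr π π := by
      ext x
      rcases x with x | x
      · rw [hl]; rfl
      · rw [hr]; rfl
    have hs : ((Equiv.Perm.sign τ : ℤ) : ℝ) = 1 := by
      rw [hτ, Equiv.Perm.sign_sumCongr]
      rcases Int.units_eq_one_or (Equiv.Perm.sign π) with h | h <;> simp [h]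
    rw [hs, one_mul]
    simp_rw [hl, hr]
    exact Equiv.prod_comp π fun i => q (Sum.inl i) (Sum.inr i)
  | succ m ih =>
    obtain ⟨i₀, hi₀⟩ : (Finset.univ.filter fun i => (τ (Sum.inl i)).isRight = true).Nonempty := by
      rw [← Finset.card_pos, hN]; omega
    have hi₀' := (Finset.mem_filter.1 hi₀).2
    let ρ : Equiv.Perm (α ⊕ α) := τ * Equiv.swap (Sum.inl i₀) (Sum.inr i₀)
    have hρl : ρ (Sum.inl i₀) = τ (Sum.inr i₀) := by simp [ρ]
    have hρr : ρ (Sum.inr i₀) = τ (Sum.inl i₀) := by simp [ρ]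
    have hρl' : ∀ i, i ≠ i₀ → ρ (Sum.inl i) = τ (Sum.inl i) := by
      intro i hi
      simp [ρ, Equiv.swap_apply_of_ne_of_ne, hi]
    have hρr' : ∀ i, i ≠ i₀ → ρ (Sum.inr i) = τ (Sum.inr i) := by
      intro i hi
      simp [ρ, Equiv.swap_apply_of_ne_of_ne, hi]
    have hρ : PreservesPairs ρ := by
      intro i
      by_cases hi : i = i₀
      · subst hi; rw [hρl, hρr, h i, Sum.swap_swap]
      · rw [hρl' i hi, hρr' i hi, h i]
    have hcard : (Finset.univ.filter fun i => (ρ (Sum.inl i)).isRight = true).card = m := by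
      have : (Finset.univ.filter fun i => (ρ (Sum.inl i)).isRight = true) =
          (Finset.univ.filter fun i => (τ (Sum.inl i)).isRight = true).erase i₀ := by
        ext i
        simp only [Finset.mem_filter, Finset.mem_univ, true_and, Finset.mem_erase]
        by_cases hi : i = i₀
        · subst hi
          rw [hρl, h i]
          generalize τ (Sum.inl i) = z at hi₀'
          rcases z with z | z
          · simp at hi₀'
          · simp
        · rw [hρl' i hi]; exact ⟨fun h => ⟨hi, h⟩, fun h => h.2⟩
      rw [this, Finset.card_erase_of_mem hi₀, hN, Nat.add_sub_cancel]
    rw [← ih hρ hcard]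
    have hs : ((Equiv.Perm.sign ρ : ℤ) : ℝ) = -((Equiv.Perm.sign τ : ℤ) : ℝ) := by
      simp [ρ, Equiv.Perm.sign_mul]
    rw [hs, ← Finset.mul_prod_erase _ _ (Finset.mem_univ i₀),
      ← Finset.mul_prod_erase Finset.univ (fun i => q (ρ (Sum.inl i)) (ρ (Sum.inr i)))
        (Finset.mem_univ i₀), hρl, hρr, hanti (τ (Sum.inl i₀)) (τ (Sum.inr i₀))]
    have he : ∏ i ∈ Finset.univ.erase i₀, q (ρ (Sum.inl i)) (ρ (Sum.inr i)) =
        ∏ i ∈ Finset.univ.erase i₀, q (τ (Sum.inl i)) (τ (Sum.inr i)) :=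
      Finset.prod_congr rfl fun i hi => by
        rw [hρl' i (Finset.ne_of_mem_erase hi), hρr' i (Finset.ne_of_mem_erase hi)]
    rw [he]
    ring

/-- Up to a nonzero constant this sum is the Pfaffian of `q`. All pair-preserving permutations
contribute the same value and the others contribute zero, so nothing cancels. -/
lemma sum_sign_mul_prod_ne_zero (hanti : ∀ s t, q t s = -q s t)
    (hzero : ∀ s t, t ≠ s.swap → q s t = 0) (hr : ∀ i, q (Sum.inl i) (Sum.inr i) ≠ 0) :
    ∑ τ : Equiv.Perm (α ⊕ α), ((Equiv.Perm.sign τ : ℤ) : ℝ) *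
      ∏ i, q (τ (Sum.inl i)) (τ (Sum.inr i)) ≠ 0 := by
  classical
  have h1 : ∀ τ : Equiv.Perm (α ⊕ α), ((Equiv.Perm.sign τ : ℤ) : ℝ) *
      ∏ i, q (τ (Sum.inl i)) (τ (Sum.inr i)) =
      if PreservesPairs τ then ∏ i, q (Sum.inl i) (Sum.inr i) else 0 := by
    intro τ
    split_ifs with h
    · exact sign_mul_prod_of_preservesPairs hanti h
    · rw [PreservesPairs] at h
      push Not at h
      obtain ⟨i, hi⟩ := h
      rw [Finset.prod_eq_zero (Finset.mem_univ i) (hzero _ _ hi), mul_zero]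
  simp_rw [h1]
  rw [← Finset.sum_filter, Finset.sum_const, nsmul_eq_mul]
  refine mul_ne_zero ?_ (Finset.prod_ne_zero_iff.2 fun i _ => hr i)
  rw [Nat.cast_ne_zero, Finset.card_ne_zero]
  exact ⟨1, Finset.mem_filter.2 ⟨Finset.mem_univ _, fun i => rfl⟩⟩

/-- The logarithmic derivative of the Pfaffian in the direction `d`. As `q` pairs each index only
with its partner, the other entries of `d` do not contribute. -/
lemma sum_sign_mul_derivation (hanti : ∀ s t, q t s = -q s t) (hd : ∀ s t, d t s = -d s t)
    (hzero : ∀ s t, t ≠ s.swap → q s t = 0) (hr : ∀ i, q (Sum.inl i) (Sum.inr i) ≠ 0) :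
    ∑ i₀, ∑ τ : Equiv.Perm (α ⊕ α), ((Equiv.Perm.sign τ : ℤ) : ℝ) *
      (d (τ (Sum.inl i₀)) (τ (Sum.inr i₀)) *
        ∏ i ∈ Finset.univ.erase i₀, q (τ (Sum.inl i)) (τ (Sum.inr i))) =
    (∑ τ : Equiv.Perm (α ⊕ α), ((Equiv.Perm.sign τ : ℤ) : ℝ) *
      ∏ i, q (τ (Sum.inl i)) (τ (Sum.inr i))) *
      ∑ i, d (Sum.inl i) (Sum.inr i) / q (Sum.inl i) (Sum.inr i) := by
  rw [Finset.sum_comm, Finset.sum_mul]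
  refine Finset.sum_congr rfl fun τ _ => ?_
  by_cases h : PreservesPairs τ
  · have h2 : ∀ i, d (τ (Sum.inl i)) (τ (Sum.inr i)) =
        q (τ (Sum.inl i)) (τ (Sum.inr i)) * (d (Sum.inl (pairIndex τ i)) (Sum.inr (pairIndex τ i)) /
          q (Sum.inl (pairIndex τ i)) (Sum.inr (pairIndex τ i))) := by
      intro i
      rw [h i, pairIndex]
      generalize τ (Sum.inl i) = z
      rcases z with z | z
      · have := hr z
        simp only [Sum.swap_inl, Sum.elim_inl, id]
        field_simp
      · have := hr z
        simp only [Sum.swap_inr, Sum.elim_inr, id]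
        rw [hanti (Sum.inl z), hd (Sum.inl z)]
        field_simp
    simp_rw [h2]
    rw [← Finset.mul_sum, mul_assoc]
    congr 1
    have hπ := Finite.injective_iff_bijective.1 h.injective
    rw [← hπ.sum_comp (fun i => d (Sum.inl i) (Sum.inr i) / q (Sum.inl i) (Sum.inr i)),
      Finset.mul_sum]
    refine Finset.sum_congr rfl fun i _ => ?_
    rw [← Finset.mul_prod_erase _ _ (Finset.mem_univ i)]
    ring
  · have hz : ∏ i, q (τ (Sum.inl i)) (τ (Sum.inr i)) = 0 := by
      rw [PreservesPairs] at h
      push Not at h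
      obtain ⟨i, hi⟩ := h
      exact Finset.prod_eq_zero (Finset.mem_univ i) (hzero _ _ hi)
    rw [hz]
    simp only [mul_zero, zero_mul]
    refine Finset.sum_eq_zero fun i₀ _ => ?_
    have : ∃ i, i ≠ i₀ ∧ τ (Sum.inr i) ≠ (τ (Sum.inl i)).swap := by
      by_contra! hc
      exact h (preservesPairs_of_forall_ne i₀ hc)
    obtain ⟨i, hi, hi'⟩ := this
    rw [Finset.prod_eq_zero (Finset.mem_erase.2 ⟨hi, Finset.mem_univ i⟩) (hzero _ _ hi')]
    simp

end Matching

/-! ### The sign of the Vandermonde determinant as an antisymmetrised product of pair signs. -/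

section Sign

/-- The sign function with values in `ℝ`. -/
noncomputable def sgn (x : ℝ) : ℝ := ((SignType.sign x : SignType) : ℝ)

lemma sgn_neg (x : ℝ) : sgn (-x) = -sgn x := by
  simp [sgn, Left.sign_neg]

lemma sgn_mul (x y : ℝ) : sgn (x * y) = sgn x * sgn y := by
  simp [sgn, sign_mul]

lemma sgn_mul_self (x : ℝ) : sgn x * x = |x| := by
  simp [sgn]

lemma sgn_of_pos {x : ℝ} (h : 0 < x) : sgn x = 1 := by simp [sgn, sign_pos h]

lemma sgn_of_neg {x : ℝ} (h : x < 0) : sgn x = -1 := by simp [sgn, sign_neg h]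

lemma sgn_zero : sgn 0 = 0 := by simp [sgn]

lemma abs_sgn_le (x : ℝ) : |sgn x| ≤ 1 := by
  rcases lt_trichotomy x 0 with h | h | h
  · simp [sgn_of_neg h]
  · simp [h, sgn_zero]
  · simp [sgn_of_pos h]

lemma measurable_sgn : Measurable sgn := by
  have : sgn = fun x => if 0 < x then 1 else if x < 0 then -1 else 0 := by
    ext x
    rcases lt_trichotomy x 0 with h | h | h
    · simp [sgn_of_neg h, h, h.le]
    · simp [h, sgn_zero]
    · simp [sgn_of_pos h, h]
  rw [this]
  exact Measurable.ite measurableSet_Ioi measurable_const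
    (Measurable.ite measurableSet_Iio measurable_const measurable_const)

lemma sgn_units (u : ℤˣ) : sgn ((u : ℤ) : ℝ) = ((u : ℤ) : ℝ) := by
  rcases Int.units_eq_one_or u with h | h
  · simp [h, sgn_of_pos]
  · simp [h, sgn_of_neg]

lemma sign_mul_sign {ι : Type*} [Fintype ι] [DecidableEq ι] (σ : Equiv.Perm ι) :
    ((Equiv.Perm.sign σ : ℤ) : ℝ) * ((Equiv.Perm.sign σ : ℤ) : ℝ) = 1 := by
  rcases Int.units_eq_one_or (Equiv.Perm.sign σ) with h | h <;> simp [h]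

variable {p n : ℕ} (e : Fin p ⊕ Fin p ≃ Fin n)

/-- The sign of the Vandermonde determinant. -/
noncomputable def orderSign (x : Fin n → ℝ) : ℝ := sgn (Matrix.vandermonde x).det

/-- The antisymmetrisation of `∏ i, sgn (x (e (inr i)) - x (e (inl i)))`. -/
noncomputable def pairSign (x : Fin n → ℝ) : ℝ :=
  ∑ σ : Equiv.Perm (Fin n), ((Equiv.Perm.sign σ : ℤ) : ℝ) *
    ∏ i, sgn (x (σ (e (Sum.inr i))) - x (σ (e (Sum.inl i))))

lemma orderSign_comp (x : Fin n → ℝ) (τ : Equiv.Perm (Fin n)) :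
    orderSign (x ∘ τ) = ((Equiv.Perm.sign τ : ℤ) : ℝ) * orderSign x := by
  have : Matrix.vandermonde (x ∘ τ) = (Matrix.vandermonde x).submatrix τ id := by
    ext i j; simp [Matrix.vandermonde]
  rw [orderSign, this, Matrix.det_permute, sgn_mul, sgn_units, orderSign]

lemma pairSign_comp (x : Fin n → ℝ) (τ : Equiv.Perm (Fin n)) :
    pairSign e (x ∘ τ) = ((Equiv.Perm.sign τ : ℤ) : ℝ) * pairSign e x := by
  rw [pairSign, pairSign, Finset.mul_sum]
  refine Fintype.sum_equiv (Equiv.mulLeft τ) _ _ fun σ => ?_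
  simp only [Equiv.coe_mulLeft, Equiv.Perm.sign_mul, Function.comp_apply, Equiv.Perm.mul_apply]
  push_cast
  rw [← mul_assoc, ← mul_assoc, sign_mul_sign, one_mul]

lemma sgn_sub_of_strictMono {x : Fin n → ℝ} (hx : StrictMono x) (a b : Fin n) :
    sgn (x a - x b) = sgn (((a : ℕ) : ℝ) - ((b : ℕ) : ℝ)) := by
  rcases lt_trichotomy a b with h | h | h
  · rw [sgn_of_neg (sub_neg.2 (hx h)), sgn_of_neg]
    exact sub_neg.2 (by exact_mod_cast h)
  · simp [h]
  · rw [sgn_of_pos (sub_pos.2 (hx h)), sgn_of_pos]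
    exact sub_pos.2 (by exact_mod_cast h)

lemma orderSign_of_strictMono {x : Fin n → ℝ} (hx : StrictMono x) : orderSign x = 1 := by
  rw [orderSign, Matrix.det_vandermonde, sgn_of_pos]
  exact Finset.prod_pos fun i _ => Finset.prod_pos fun j hj => sub_pos.2 (hx (Finset.mem_Ioi.1 hj))

/-- On injective tuples the antisymmetrised product of signs is a multiple of the sign of the
Vandermonde determinant. -/
lemma exists_pairSign_eq : ∃ C : ℝ, ∀ x : Fin n → ℝ, Function.Injective x →
    pairSign e x = C * orderSign x := by
  -- Both functions are alternating, so it suffices to compare them on increasing tuples. There the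
  -- pair signs depend only on the order of the indices, and `C` is the value at `x i = i`. That `C`
  -- is nonzero is seen later from the integrals.
  refine ⟨pairSign e (fun i => ((i : ℕ) : ℝ)), fun x hx => ?_⟩
  have hm : StrictMono (x ∘ Tuple.sort x) :=
    (Tuple.monotone_sort x).strictMono_of_injective (hx.comp (Tuple.sort x).injective)
  have h1 : pairSign e (x ∘ Tuple.sort x) = pairSign e (fun i => ((i : ℕ) : ℝ)) := by
    rw [pairSign, pairSign]
    simp_rw [sgn_sub_of_strictMono hm]
  have h2 := orderSign_of_strictMono hm
  rw [pairSign_comp] at h1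
  rw [orderSign_comp] at h2
  rw [← h1, mul_assoc, mul_comm, mul_assoc]
  rw [mul_comm] at h2
  rw [h2, mul_one]

end Sign

end ClassicalEnsemble

/-! ### De Bruijn's integration in pairs of variables. -/

namespace ClassicalEnsemble

section DeBruijn

/-- The skew-symmetric form `∫∫ sgn (y - x) u(x) v(y) dμ(x) dμ(y)`. -/
noncomputable def skewPair (μ : Measure ℝ) (u v : ℝ → ℝ) : ℝ :=
  ∫ z, sgn (z.2 - z.1) * (u z.1 * v z.2) ∂(μ.prod μ)

variable {μ : Measure ℝ} [SigmaFinite μ] {p n : ℕ} (e : Fin p ⊕ Fin p ≃ Fin n)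

lemma measurable_pairProd (a b : Fin p → Fin n) :
    Measurable fun x : Fin n → ℝ => ∏ i, sgn (x (a i) - x (b i)) :=
  Finset.measurable_prod _ fun _ _ =>
    measurable_sgn.comp ((measurable_pi_apply _).sub (measurable_pi_apply _))

lemma abs_pairProd_le (a b : Fin p → Fin n) (x : Fin n → ℝ) :
    ‖∏ i, sgn (x (a i) - x (b i))‖ ≤ 1 := by
  rw [norm_prod]
  exact Finset.prod_le_one (fun _ _ => norm_nonneg _) fun i _ => abs_sgn_le _

lemma integrable_pairProd_mul {a b : Fin p → Fin n} {g : (Fin n → ℝ) → ℝ}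
    {ν : Measure (Fin n → ℝ)} (hg : Integrable g ν) :
    Integrable (fun x : Fin n → ℝ => (∏ i, sgn (x (a i) - x (b i))) * g x) ν :=
  hg.bdd_mul (measurable_pairProd a b).aestronglyMeasurable
    (Filter.Eventually.of_forall (abs_pairProd_le a b))

/-- Transport along `e` groups the variables into pairs. The integrand is a product of functions of
one pair each, so the integral factorises into double integrals. -/
lemma integral_pairProd_mul_prod (u : Fin n → ℝ → ℝ) :
    ∫ x : Fin n → ℝ, (∏ i, sgn (x (e (Sum.inr i)) - x (e (Sum.inl i)))) * ∏ j, u j (x j)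
      ∂(Measure.pi fun _ => μ) =
    ∏ i, skewPair μ (u (e (Sum.inl i))) (u (e (Sum.inr i))) := by
  have h1 := (measurePreserving_piCongrLeft (α := fun _ : Fin n => ℝ) (fun _ => μ) e).integral_comp'
    (fun x : Fin n → ℝ => (∏ i, sgn (x (e (Sum.inr i)) - x (e (Sum.inl i)))) * ∏ j, u j (x j))
  rw [← h1]
  have h2 := (measurePreserving_sumPiEquivProdPi_symm (X := fun _ : Fin p ⊕ Fin p => ℝ)
    (fun _ => μ)).integral_comp'
    (fun x => (∏ i, sgn (MeasurableEquiv.piCongrLeft (fun _ : Fin n => ℝ) e x (e (Sum.inr i)) -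
      MeasurableEquiv.piCongrLeft (fun _ : Fin n => ℝ) e x (e (Sum.inl i)))) *
      ∏ j, u j (MeasurableEquiv.piCongrLeft (fun _ : Fin n => ℝ) e x j))
  rw [← h2]
  have h3 := (measurePreserving_arrowProdEquivProdArrow ℝ ℝ (Fin p)
    (fun _ => μ) (fun _ => μ)).integral_comp'
    (fun y => (∏ i, sgn (y.2 i - y.1 i)) *
      ∏ i, (u (e (Sum.inl i)) (y.1 i) * u (e (Sum.inr i)) (y.2 i)))
  calc _ = ∫ y : (Fin p → ℝ) × (Fin p → ℝ), (∏ i, sgn (y.2 i - y.1 i)) *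
      ∏ i, (u (e (Sum.inl i)) (y.1 i) * u (e (Sum.inr i)) (y.2 i))
        ∂((Measure.pi fun _ => μ).prod (Measure.pi fun _ => μ)) := by
        refine integral_congr_ae (Filter.Eventually.of_forall fun y => ?_)
        simp only [MeasurableEquiv.coe_piCongrLeft, Equiv.piCongrLeft_apply_apply]
        rw [← Equiv.prod_comp e, Fintype.prod_sum_type, ← Finset.prod_mul_distrib]
        simp only [Equiv.piCongrLeft_apply_apply]
        rfl
    _ = _ := by
        rw [← h3]
        simp_rw [← Finset.prod_mul_distrib]
        exact integral_fintype_prod_eq_prod (E := fun _ : Fin p => ℝ × ℝ) (μ := fun _ => μ.prod μ)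
          (fun i z => sgn (z.2 - z.1) * (u (e (Sum.inl i)) z.1 * u (e (Sum.inr i)) z.2))

lemma skewPair_antisymm (u v : ℝ → ℝ) : skewPair μ v u = -skewPair μ u v := by
  rw [skewPair, ← integral_prod_swap, skewPair, ← integral_neg]
  refine integral_congr_ae (Filter.Eventually.of_forall fun z => ?_)
  simp only [Prod.fst_swap, Prod.snd_swap]
  rw [← neg_sub, sgn_neg]
  ring

/-- Determinant with rows `ψ i` and points `x j`, multiplied by functions `g j` of the points. -/
lemma prod_mul_det_eq (ψ g : Fin n → ℝ → ℝ) (x : Fin n → ℝ) :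
    (∏ j, g j (x j)) * (Matrix.of fun i j => ψ i (x j)).det =
      ∑ τ : Equiv.Perm (Fin n), ((Equiv.Perm.sign τ : ℤ) : ℝ) *
        ∏ j, (g j (x j) * ψ (τ j) (x j)) := by
  rw [Matrix.det_apply', Finset.mul_sum]
  refine Finset.sum_congr rfl fun τ _ => ?_
  simp only [Finset.prod_mul_distrib, Matrix.of_apply]
  ring

lemma integrable_prod_mul_det (ψ g : Fin n → ℝ → ℝ)
    (hint : ∀ i j, Integrable (fun x => g j x * ψ i x) μ) :
    Integrable (fun x : Fin n → ℝ => (∏ j, g j (x j)) * (Matrix.of fun i j => ψ i (x j)).det)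
      (Measure.pi fun _ => μ) := by
  simp_rw [prod_mul_det_eq]
  exact integrable_finsetSum _ fun τ _ =>
    (Integrable.fintype_prod (f := fun j y => g j y * ψ (τ j) y) fun j => hint _ _).const_mul _

lemma integral_pairProd_mul_det (ψ g : Fin n → ℝ → ℝ)
    (hint : ∀ i j, Integrable (fun x => g j x * ψ i x) μ) :
    ∫ x : Fin n → ℝ, (∏ i, sgn (x (e (Sum.inr i)) - x (e (Sum.inl i)))) *
        ((∏ j, g j (x j)) * (Matrix.of fun i j => ψ i (x j)).det) ∂(Measure.pi fun _ => μ) =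
      ∑ τ : Equiv.Perm (Fin n), ((Equiv.Perm.sign τ : ℤ) : ℝ) *
        ∏ i, skewPair μ (fun y => g (e (Sum.inl i)) y * ψ (τ (e (Sum.inl i))) y)
          (fun y => g (e (Sum.inr i)) y * ψ (τ (e (Sum.inr i))) y) := by
  simp_rw [prod_mul_det_eq, Finset.mul_sum]
  rw [integral_finsetSum]
  · refine Finset.sum_congr rfl fun τ _ => ?_
    simp_rw [mul_left_comm _ ((Equiv.Perm.sign τ : ℤ) : ℝ)]
    rw [integral_const_mul, integral_pairProd_mul_prod e fun j y => g j y * ψ (τ j) y]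
  · intro τ _
    exact integrable_pairProd_mul ((Integrable.fintype_prod (f := fun j y => g j y * ψ (τ j) y)
      fun j => hint _ _).const_mul _)

lemma det_comp_perm (ψ : Fin n → ℝ → ℝ) (x : Fin n → ℝ) (σ : Equiv.Perm (Fin n)) :
    (Matrix.of fun i j => ψ i (x (σ j))).det =
      ((Equiv.Perm.sign σ : ℤ) : ℝ) * (Matrix.of fun i j => ψ i (x j)).det := by
  rw [← Matrix.det_permute']; rfl

/-- The determinant is alternating and `G` is symmetric, so relabelling the variables makes the `n!`
summands of `pairSign` contribute equally. -/
lemma integral_pairSign_mul_det (ψ : Fin n → ℝ → ℝ) (G : (Fin n → ℝ) → ℝ)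
    (hG : ∀ x (σ : Equiv.Perm (Fin n)), G (x ∘ σ) = G x)
    (hint : Integrable (fun x : Fin n → ℝ => G x * (Matrix.of fun i j => ψ i (x j)).det)
      (Measure.pi fun _ => μ)) :
    ∫ x : Fin n → ℝ, pairSign e x * (G x * (Matrix.of fun i j => ψ i (x j)).det)
      ∂(Measure.pi fun _ => μ) =
    (n.factorial : ℝ) * ∫ x : Fin n → ℝ, (∏ i, sgn (x (e (Sum.inr i)) - x (e (Sum.inl i)))) *
      (G x * (Matrix.of fun i j => ψ i (x j)).det) ∂(Measure.pi fun _ => μ) := by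
  simp_rw [pairSign, Finset.sum_mul]
  rw [integral_finsetSum]
  · have : ∀ σ : Equiv.Perm (Fin n), ∫ x : Fin n → ℝ, ((Equiv.Perm.sign σ : ℤ) : ℝ) *
        (∏ i, sgn (x (σ (e (Sum.inr i))) - x (σ (e (Sum.inl i))))) *
        (G x * (Matrix.of fun i j => ψ i (x j)).det) ∂(Measure.pi fun _ => μ) =
        ∫ x : Fin n → ℝ, (∏ i, sgn (x (e (Sum.inr i)) - x (e (Sum.inl i)))) *
      (G x * (Matrix.of fun i j => ψ i (x j)).det) ∂(Measure.pi fun _ => μ) := by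
      intro σ
      rw [← (measurePreserving_piCongrLeft (α := fun _ : Fin n => ℝ) (fun _ => μ) σ).integral_comp']
      refine integral_congr_ae (Filter.Eventually.of_forall fun x => ?_)
      simp only [MeasurableEquiv.coe_piCongrLeft, Equiv.piCongrLeft_apply_apply]
      have h1 := det_comp_perm ψ (Equiv.piCongrLeft (fun _ : Fin n => ℝ) σ x) σ
      have h2 := hG (Equiv.piCongrLeft (fun _ : Fin n => ℝ) σ x) σ
      have h3 : (Equiv.piCongrLeft (fun _ : Fin n => ℝ) σ x) ∘ σ = x := by
        ext i; simp only [Function.comp_apply, Equiv.piCongrLeft_apply_apply]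
      simp only [Equiv.piCongrLeft_apply_apply] at h1
      rw [h3] at h2
      rw [h1, h2]
      ring
    simp_rw [this]
    simp [Fintype.card_perm]
  · intro σ _
    simp_rw [mul_assoc]
    exact (integrable_pairProd_mul hint).const_mul _

lemma det_eq_zero_of_not_injective (ψ : Fin n → ℝ → ℝ) {x : Fin n → ℝ}
    (hx : ¬ Function.Injective x) : (Matrix.of fun i j => ψ i (x j)).det = 0 := by
  simp only [Function.Injective] at hx
  push Not at hx
  obtain ⟨a, b, hab, hne⟩ := hx
  exact Matrix.det_zero_of_column_eq hne fun i => by simp [hab]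

lemma measurable_orderSign : Measurable (orderSign : (Fin n → ℝ) → ℝ) := by
  refine measurable_sgn.comp (Continuous.measurable ?_)
  refine Continuous.matrix_det (continuous_matrix fun i j => ?_)
  simp only [Matrix.vandermonde_apply]
  fun_prop

lemma integrable_orderSign_mul {g : (Fin n → ℝ) → ℝ} {ν : Measure (Fin n → ℝ)}
    (hg : Integrable g ν) : Integrable (fun x : Fin n → ℝ => orderSign x * g x) ν :=
  hg.bdd_mul measurable_orderSign.aestronglyMeasurable
    (Filter.Eventually.of_forall fun _ => abs_sgn_le _)

/-- Normalisation and averages of linear statistics for the absolute value of a determinant of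
functions that are skew-orthogonal in pairs. -/
theorem integral_orderSign_mul_det (ψ : Fin n → ℝ → ℝ) (f : ℝ → ℝ)
    (hint : ∀ i, Integrable (ψ i) μ) (hintf : ∀ i, Integrable (fun x => f x * ψ i x) μ)
    (hzero : ∀ s t, t ≠ s.swap → skewPair μ (ψ (e s)) (ψ (e t)) = 0)
    (hr : ∀ i, skewPair μ (ψ (e (Sum.inl i))) (ψ (e (Sum.inr i))) ≠ 0) :
    (∫ x : Fin n → ℝ, orderSign x * (Matrix.of fun i j => ψ i (x j)).det
      ∂(Measure.pi fun _ => μ) ≠ 0) ∧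
    ∫ x : Fin n → ℝ, orderSign x * ((∑ l, f (x l)) * (Matrix.of fun i j => ψ i (x j)).det)
      ∂(Measure.pi fun _ => μ) =
    (∫ x : Fin n → ℝ, orderSign x * (Matrix.of fun i j => ψ i (x j)).det
      ∂(Measure.pi fun _ => μ)) *
      ∑ i, (skewPair μ (fun y => f y * ψ (e (Sum.inl i)) y) (ψ (e (Sum.inr i))) +
        skewPair μ (ψ (e (Sum.inl i))) (fun y => f y * ψ (e (Sum.inr i)) y)) /
        skewPair μ (ψ (e (Sum.inl i))) (ψ (e (Sum.inr i))) := by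
  obtain ⟨C, hC⟩ := exists_pairSign_eq e
  let D : (Fin n → ℝ) → ℝ := fun x => (Matrix.of fun i j => ψ i (x j)).det
  -- The two signs are proportional on injective tuples only; on all other tuples the determinant
  -- has two equal columns.
  have hCD : ∀ x (G : ℝ), pairSign e x * (G * D x) = C * (orderSign x * (G * D x)) := by
    intro x G
    by_cases hx : Function.Injective x
    · rw [hC x hx]; ring
    · simp [D, det_eq_zero_of_not_injective ψ hx]
  let q : Fin p ⊕ Fin p → Fin p ⊕ Fin p → ℝ := fun s t => skewPair μ (ψ (e s)) (ψ (e t))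
  let d : Fin p ⊕ Fin p → Fin p ⊕ Fin p → ℝ := fun s t =>
    skewPair μ (fun y => f y * ψ (e s) y) (ψ (e t)) +
      skewPair μ (ψ (e s)) (fun y => f y * ψ (e t) y)
  have hq : ∀ s t, q t s = -q s t := fun s t => skewPair_antisymm _ _
  have hd : ∀ s t, d t s = -d s t := by
    intro s t
    simp only [d]
    rw [skewPair_antisymm (ψ (e s)), skewPair_antisymm (fun y => f y * ψ (e s) y)]
    ring
  have hreindex : ∀ F : Equiv.Perm (Fin n) → ℝ, ∑ τ, F τ =
      ∑ τ : Equiv.Perm (Fin p ⊕ Fin p), F (e.permCongr τ) :=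
    fun F => (Equiv.sum_comp e.permCongr F).symm
  have hD1 : Integrable D (Measure.pi fun _ => μ) := by
    simpa using integrable_prod_mul_det ψ (fun _ _ => 1) (by simpa using fun i _ => hint i)
  let g : Fin n → Fin n → ℝ → ℝ := fun l j => if j = l then f else fun _ => 1
  have hg : ∀ l (x : Fin n → ℝ), ∏ j, g l j (x j) = f (x l) := by
    intro l x
    rw [Finset.prod_eq_single l]
    · simp [g]
    · intro j _ hj; simp [g, hj]
    · simp
  have hgi : ∀ l i j, Integrable (fun x => g l j x * ψ i x) μ := by
    intro l i j
    by_cases hl : j = l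
    · simpa [g, hl] using hintf i
    · simpa [g, hl] using hint i
  have hD2 : ∀ l, Integrable (fun x : Fin n → ℝ => f (x l) * D x) (Measure.pi fun _ => μ) := by
    intro l
    simp_rw [← hg l]
    exact integrable_prod_mul_det ψ (g l) (hgi l)
  have hD3 : Integrable (fun x : Fin n → ℝ => (∑ l, f (x l)) * D x) (Measure.pi fun _ => μ) := by
    simp_rw [Finset.sum_mul]
    exact integrable_finsetSum _ fun l _ => hD2 l
  have h1 : C * ∫ x, orderSign x * D x ∂(Measure.pi fun _ => μ) =
      (n.factorial : ℝ) * ∑ τ : Equiv.Perm (Fin p ⊕ Fin p), ((Equiv.Perm.sign τ : ℤ) : ℝ) *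
        ∏ i, q (τ (Sum.inl i)) (τ (Sum.inr i)) := by
    have hp := integral_pairSign_mul_det (μ := μ) e ψ (fun _ => 1) (fun _ _ => rfl)
      (by simpa using hD1)
    have hp2 := integral_pairProd_mul_det (μ := μ) e ψ (fun _ _ => 1)
      (by simpa using fun i _ => hint i)
    have hp3 : ∀ x, pairSign e x * (1 * D x) = C * (orderSign x * D x) := fun x => by
      rw [hCD]; ring
    simp only [D] at hp3
    simp_rw [hp3, integral_const_mul] at hp
    simp only [Finset.prod_const_one] at hp2
    rw [hp, hp2, hreindex]
    simp [q, Equiv.Perm.sign_permCongr, Equiv.permCongr_apply]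
  have h2 : C * ∫ x, orderSign x * ((∑ l, f (x l)) * D x) ∂(Measure.pi fun _ => μ) =
      (n.factorial : ℝ) * ∑ i₀, ∑ τ : Equiv.Perm (Fin p ⊕ Fin p),
      ((Equiv.Perm.sign τ : ℤ) : ℝ) * (d (τ (Sum.inl i₀)) (τ (Sum.inr i₀)) *
        ∏ i ∈ Finset.univ.erase i₀, q (τ (Sum.inl i)) (τ (Sum.inr i))) := by
    have hp := integral_pairSign_mul_det (μ := μ) e ψ (fun x => ∑ l, f (x l))
      (fun x σ => Equiv.sum_comp σ fun l => f (x l)) hD3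
    have hp3 : ∀ x, pairSign e x * ((∑ l, f (x l)) * D x) =
      C * (orderSign x * ((∑ l, f (x l)) * D x)) := fun x => hCD _ _
    simp only [D] at hp3
    simp_rw [hp3, integral_const_mul] at hp
    rw [hp]
    congr 1
    simp_rw [Finset.sum_mul, Finset.mul_sum]
    -- The contributions of `f` at the two members of the pair `i₀` add up to the entry `d` in the
    -- place of `q`.
    rw [integral_finsetSum _ fun l _ => integrable_pairProd_mul (hD2 l), ← Equiv.sum_comp e,
      Fintype.sum_sum_type, ← Finset.sum_add_distrib]
    refine Finset.sum_congr rfl fun i₀ _ => ?_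
    simp_rw [← hg]
    rw [integral_pairProd_mul_det e ψ _ (hgi _), integral_pairProd_mul_det e ψ _ (hgi _),
      ← Finset.sum_add_distrib, hreindex]
    refine Finset.sum_congr rfl fun τ _ => ?_
    rw [← mul_add, Equiv.Perm.sign_permCongr]
    congr 1
    have hne : ∀ i ∈ Finset.univ.erase i₀, ∀ s : Fin p ⊕ Fin p, (s = Sum.inl i₀ ∨ s = Sum.inr i₀) →
        skewPair μ (fun y => g (e s) (e (Sum.inl i)) y * ψ ((e.permCongr τ) (e (Sum.inl i))) y)
          (fun y => g (e s) (e (Sum.inr i)) y * ψ ((e.permCongr τ) (e (Sum.inr i))) y) =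
        q (τ (Sum.inl i)) (τ (Sum.inr i)) := by
      intro i hi s hs
      have hi' := Finset.ne_of_mem_erase hi
      rcases hs with rfl | rfl <;>
      simp [g, hi', q, Equiv.permCongr_apply]
    rw [← Finset.mul_prod_erase _ _ (Finset.mem_univ i₀),
      ← Finset.mul_prod_erase Finset.univ (fun i => skewPair μ
        (fun y => g (e (Sum.inr i₀)) (e (Sum.inl i)) y * ψ ((e.permCongr τ) (e (Sum.inl i))) y)
          (fun y => g (e (Sum.inr i₀)) (e (Sum.inr i)) y * ψ ((e.permCongr τ) (e (Sum.inr i))) y))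
          (Finset.mem_univ i₀),
      Finset.prod_congr rfl fun i hi => hne i hi _ (Or.inl rfl),
      Finset.prod_congr rfl fun i hi => hne i hi _ (Or.inr rfl), ← add_mul]
    congr 1
    simp [g, d, Equiv.permCongr_apply]
  have hΨ := sum_sign_mul_prod_ne_zero hq hzero hr
  rw [sum_sign_mul_derivation hq hd hzero hr, ← mul_assoc, ← h1, mul_assoc] at h2
  have hn : (n.factorial : ℝ) ≠ 0 := by positivity
  -- `C = 0` would make the Pfaffian sum vanish, contrary to `hΨ`.
  have hC0 : C ≠ 0 := by
    rintro rfl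
    rw [zero_mul] at h1
    exact mul_ne_zero hn hΨ h1.symm
  refine ⟨fun h0 => ?_, mul_left_cancel₀ hC0 h2⟩
  simp only [D] at h1
  rw [h0, mul_zero] at h1
  exact mul_ne_zero hn hΨ h1.symm

end DeBruijn

end ClassicalEnsemble

/-! ### Averages in orthogonal ensembles by skew-orthogonal polynomials. -/

namespace ClassicalEnsemble

section OrthogonalEnsemble

/-- The enumeration of `Fin (2 * p)` by even numbers on the left and odd numbers on the right. -/
noncomputable def evenOddEquiv (p : ℕ) : Fin p ⊕ Fin p ≃ Fin (2 * p) :=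
  Equiv.ofBijective
    (Sum.elim (fun i => ⟨2 * i, by omega⟩) (fun i => ⟨2 * i + 1, by omega⟩)) <| by
    rw [Fintype.bijective_iff_injective_and_card]
    constructor
    · rintro (i | i) (j | j) h <;>
      simp only [Sum.elim_inl, Sum.elim_inr, Fin.mk.injEq] at h
      · congr 1; ext; omega
      · omega
      · omega
      · congr 1; ext; omega
    · simp [two_mul]

open Polynomial

/-- `|Δ| = sgn(Δ) Δ`. The second factor is rewritten with arbitrary monic polynomials and absorbs
the weights into its columns, while the sign stays in terms of the points. -/
lemma jointDensity_one_eq (w : ℝ → ℝ) (n : ℕ) (R : ℕ → ℝ[X]) (hm : ∀ i, (R i).Monic)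
    (hd : ∀ i, (R i).natDegree = i) (x : Fin n → ℝ) :
    BallisticCavity.jointDensity 1 w n x =
      orderSign x * (Matrix.of fun i j : Fin n => (R i).eval (x j) * w (x j)).det := by
  have h := Matrix.det_eval_matrixOfPolynomials_eq_det_vandermonde x (fun i : Fin n => R i)
    (fun i => hd i) (fun i => hm i)
  have h2 : (Matrix.of fun i j : Fin n => (R i).eval (x j)).det = (Matrix.vandermonde x).det := by
    rw [h, ← Matrix.det_transpose]; rfl
  have h3 : (Matrix.of fun i j : Fin n => (R i).eval (x j) * w (x j)).det =
      (∏ j, w (x j)) * (Matrix.vandermonde x).det := by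
    rw [← h2, ← Matrix.det_mul_row]
    congr 1
    ext i j
    simp [mul_comm]
  rw [h3, mul_left_comm, orderSign, sgn_mul_self, Matrix.det_vandermonde,
    BallisticCavity.jointDensity]
  simp only [pow_one, Finset.abs_prod]

/-- Existence and value of the average of a linear statistic in an orthogonal ensemble with an
even number of eigenvalues, in terms of skew-orthogonal polynomials. -/
theorem average_one_eq (w f : ℝ → ℝ) {I : Set ℝ} (hI : MeasurableSet I) (p : ℕ) (R : ℕ → ℝ[X])
    (hm : ∀ i, (R i).Monic) (hd : ∀ i, (R i).natDegree = i) (hw : ∀ x ∈ I, 0 ≤ w x)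
    (hint : ∀ q : ℝ[X], IntegrableOn (fun x => q.eval x * w x) I)
    (hintf : ∀ q : ℝ[X], IntegrableOn (fun x => f x * (q.eval x * w x)) I)
    (h00 : ∀ i j, skewPair (volume.restrict I) (fun x => (R (2 * i)).eval x * w x)
      (fun x => (R (2 * j)).eval x * w x) = 0)
    (h11 : ∀ i j, skewPair (volume.restrict I) (fun x => (R (2 * i + 1)).eval x * w x)
      (fun x => (R (2 * j + 1)).eval x * w x) = 0)
    (h01 : ∀ i j, i ≠ j → skewPair (volume.restrict I) (fun x => (R (2 * i)).eval x * w x)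
      (fun x => (R (2 * j + 1)).eval x * w x) = 0)
    (hr : ∀ i, skewPair (volume.restrict I) (fun x => (R (2 * i)).eval x * w x)
      (fun x => (R (2 * i + 1)).eval x * w x) ≠ 0) :
    BallisticCavity.AverageExists 1 w I (2 * p) f ∧
    BallisticCavity.average 1 w I (2 * p) f = ∑ i ∈ Finset.range p,
      (skewPair (volume.restrict I) (fun x => f x * ((R (2 * i)).eval x * w x))
        (fun x => (R (2 * i + 1)).eval x * w x) +
      skewPair (volume.restrict I) (fun x => (R (2 * i)).eval x * w x)
        (fun x => f x * ((R (2 * i + 1)).eval x * w x))) /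
      skewPair (volume.restrict I) (fun x => (R (2 * i)).eval x * w x)
        (fun x => (R (2 * i + 1)).eval x * w x) := by
  let ψ : Fin (2 * p) → ℝ → ℝ := fun i x => (R i).eval x * w x
  have hψ : ∀ i, Integrable (ψ i) (volume.restrict I) := fun i => hint (R i)
  have hψf : ∀ i, Integrable (fun x => f x * ψ i x) (volume.restrict I) := fun i => hintf (R i)
  have key := integral_orderSign_mul_det (μ := volume.restrict I) (evenOddEquiv p) ψ f
    hψ hψf (by
      rintro (i | i) (j | j) hij
      · exact h00 _ _
      · refine h01 _ _ fun h => hij ?_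
        rw [Fin.ext h]; rfl
      · have h := h01 j i fun h => hij (by rw [Fin.ext h]; rfl)
        rw [skewPair_antisymm]
        exact neg_eq_zero.2 h
      · exact h11 _ _) (fun i => hr i)
  have hdens : BallisticCavity.jointDensity 1 w (2 * p) = fun x =>
      orderSign x * (Matrix.of fun i j => ψ i (x j)).det :=
    funext fun x => jointDensity_one_eq w (2 * p) R hm hd x
  have hint1 : Integrable (fun x : Fin (2 * p) → ℝ => (Matrix.of fun i j => ψ i (x j)).det)
      (Measure.pi fun _ => volume.restrict I) := by
    simpa using integrable_prod_mul_det (μ := volume.restrict I) ψ (fun _ _ => 1)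
      (by simpa using fun i _ => hψ i)
  have hint2 : Integrable (fun x : Fin (2 * p) → ℝ => (∑ l, f (x l)) *
      (Matrix.of fun i j => ψ i (x j)).det) (Measure.pi fun _ => volume.restrict I) := by
    simp_rw [Finset.sum_mul]
    refine integrable_finsetSum _ fun l _ => ?_
    let g : Fin (2 * p) → ℝ → ℝ := fun j => if j = l then f else fun _ => 1
    have hg : ∀ (x : Fin (2 * p) → ℝ), ∏ j, g j (x j) = f (x l) := by
      intro x
      rw [Finset.prod_eq_single l]
      · simp [g]
      · intro j _ hj; simp [g, hj]
      · simp
    simp_rw [← hg]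
    refine integrable_prod_mul_det (μ := volume.restrict I) ψ g fun i j => ?_
    by_cases hl : j = l
    · simpa [g, hl] using hψf i
    · simpa [g, hl] using hψ i
  have hcomm : ∀ x : Fin (2 * p) → ℝ, (∑ l, f (x l)) *
      (orderSign x * (Matrix.of fun i j => ψ i (x j)).det) =
      orderSign x * ((∑ l, f (x l)) * (Matrix.of fun i j => ψ i (x j)).det) := fun x => by ring
  have hnorm : BallisticCavity.normalization 1 w I (2 * p) =
      ∫ x : Fin (2 * p) → ℝ, orderSign x * (Matrix.of fun i j => ψ i (x j)).det
        ∂(Measure.pi fun _ => volume.restrict I) := by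
    rw [BallisticCavity.normalization, volume_restrict_cube, hdens]
  refine ⟨⟨?_, ?_, ?_⟩, ?_⟩
  · rw [IntegrableOn, volume_restrict_cube, hdens]
    exact integrable_orderSign_mul hint1
  -- Positivity combines nonnegativity of the density with the nonvanishing of the Pfaffian.
  · refine lt_of_le_of_ne ?_ (hnorm ▸ key.1.symm)
    rw [BallisticCavity.normalization]
    refine setIntegral_nonneg (MeasurableSet.univ_pi fun _ => hI) fun x hx => ?_
    rw [BallisticCavity.jointDensity]
    exact mul_nonneg (Finset.prod_nonneg fun j _ => hw _ (hx j (Set.mem_univ _)))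
      (Finset.prod_nonneg fun i _ => Finset.prod_nonneg fun j _ => by positivity)
  · rw [IntegrableOn, volume_restrict_cube, hdens]
    simp_rw [hcomm]
    exact integrable_orderSign_mul hint2
  · rw [BallisticCavity.average, hnorm, volume_restrict_cube, hdens]
    simp_rw [hcomm]
    rw [key.2, mul_comm, mul_div_assoc, div_self key.1, mul_one, Finset.sum_range]
    rfl

end OrthogonalEnsemble

end ClassicalEnsemble

/-! ### Orthogonal polynomials of a Pearson moment functional. -/

namespace ClassicalEnsemble

section OrthogonalPolynomials

open Polynomial Finset

/-- Moments `∏ t < i, (a + 1 + t) / (d + e t)` of the normalised weight with Pearson equation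
`(x (1 - e x) w)' = (a + 1 - d x) w`. -/
noncomputable def mu (e a d : ℝ) (i : ℕ) : ℝ := ∏ t ∈ range i, (a + 1 + t) / (d + e * t)

/-- The moment functional of the normalised weight. -/
noncomputable def mom (e a d : ℝ) : ℝ[X] →ₗ[ℝ] ℝ :=
  Polynomial.lsum fun i => mu e a d i • LinearMap.id

/-- The quadratic coefficient of the Pearson equation. -/
noncomputable def sig (e : ℝ) : ℝ[X] := X * (1 - C e * X)

/-- The linear coefficient of the Pearson equation. -/
noncomputable def tau (a d : ℝ) : ℝ[X] := C (a + 1) - C d * X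

/-- Admissible parameters. -/
structure Adm (e a d : ℝ) : Prop where
  e_nonneg : 0 ≤ e
  a_gt : -1 < a
  d_pos : 0 < d
  b_pos : 0 < d - e * (a + 1)

/-- The monic orthogonal polynomials, by the Rodrigues recursion. -/
noncomputable def pol (e : ℝ) : ℕ → ℝ → ℝ → ℝ[X]
  | 0, _, _ => 1
  | N + 1, a, d => C (-(1 / (d + e * N))) *
      (sig e * derivative (pol e N (a + 1) (d + 2 * e)) + tau a d * pol e N (a + 1) (d + 2 * e))

/-- The first-order operator `g ↦ σ g' + κ τ g`. -/
noncomputable def opr (e a d κ : ℝ) (g : ℝ[X]) : ℝ[X] :=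
  sig e * derivative g + C κ * (tau a d * g)

/-- The constant relating the weight times `σ` to the weight with shifted parameters. -/
noncomputable def lam (e a d : ℝ) : ℝ := (a + 1) * (d - e * (a + 1)) / (d * (d + e))

/-- The squared norms of the monic orthogonal polynomials. -/
noncomputable def hn (e : ℝ) : ℕ → ℝ → ℝ → ℝ
  | 0, _, _ => 1
  | N + 1, a, d => (N + 1) * lam e a d / (d + e * N) * hn e N (a + 1) (d + 2 * e)

/-- The integral of an orthogonal polynomial against the weight shifted by `x ^ s`. -/
noncomputable def d0 (e : ℝ) : ℕ → ℝ → ℝ → ℝ → ℝ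
  | 0, _, _, _ => 1
  | N + 1, a, d, s => s / (d + e * N) * ((d - e * (a + 1)) / (d + e * s)) *
      d0 e N (a + 1) (d + 2 * e) (s - 1)

/-- The connection coefficients between weights differing by `x ^ s`. -/
noncomputable def conn (e : ℝ) (N M : ℕ) (a d s : ℝ) : ℝ :=
  N.choose M * d0 e (N - M) (a + M) (d + 2 * e * M) s

variable {e a d s : ℝ}

lemma Adm.den_pos (h : Adm e a d) (i : ℕ) : 0 < d + e * i :=
  add_pos_of_pos_of_nonneg h.d_pos (mul_nonneg h.e_nonneg (Nat.cast_nonneg i))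

/-- These are the parameters after multiplying the weight by `σ`. In the same way `shift` belongs to
multiplication by `x` and `shift_b` to multiplication by `1 - e x`. -/
lemma Adm.up (h : Adm e a d) : Adm e (a + 1) (d + 2 * e) :=
  ⟨h.e_nonneg, by linarith [h.a_gt], by linarith [h.d_pos, h.e_nonneg],
    by nlinarith [h.b_pos, h.e_nonneg]⟩

lemma Adm.shift (h : Adm e a d) : Adm e (a + 1) (d + e) :=
  ⟨h.e_nonneg, by linarith [h.a_gt], by linarith [h.d_pos, h.e_nonneg],
    by nlinarith [h.b_pos, h.e_nonneg]⟩

lemma Adm.shift_nat (h : Adm e a d) (k : ℕ) : Adm e (a + k) (d + e * k) := by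
  have : (0 : ℝ) ≤ k := Nat.cast_nonneg k
  exact ⟨h.e_nonneg, by linarith [h.a_gt], h.den_pos k, by nlinarith [h.b_pos, h.e_nonneg]⟩

lemma Adm.shift_b (h : Adm e a d) : Adm e a (d + e) :=
  ⟨h.e_nonneg, h.a_gt, by linarith [h.d_pos, h.e_nonneg], by linarith [h.b_pos, h.e_nonneg]⟩

lemma mu_zero : mu e a d 0 = 1 := by simp [mu]

lemma mu_succ (i : ℕ) : mu e a d (i + 1) = mu e a d i * ((a + 1 + i) / (d + e * i)) := by
  rw [mu, prod_range_succ, ← mu]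

lemma mu_succ' (i : ℕ) : mu e a d (i + 1) = (a + 1) / d * mu e (a + 1) (d + e) i := by
  rw [mu, prod_range_succ', mul_comm, mu]
  congr 1
  · simp
  · refine prod_congr rfl fun t _ => ?_
    push_cast
    congr 1 <;> ring

lemma mu_pos (h : Adm e a d) (i : ℕ) : 0 < mu e a d i :=
  prod_pos fun t _ => div_pos (by have : (0 : ℝ) ≤ t := Nat.cast_nonneg t
                                  linarith [h.a_gt]) (h.den_pos t)

lemma mu_shift_b (h : Adm e a d) (i : ℕ) : mu e a (d + e) i * (d + e * i) = mu e a d i * d := by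
  induction i with
  | zero => simp [mu_zero]
  | succ i ih =>
    have h1 := (h.den_pos i).ne'
    have h2 := (h.den_pos (i + 1)).ne'
    push_cast at h2
    have h3 : d + e + e * i ≠ 0 := by convert h2 using 1; ring
    rw [mu_succ, mu_succ]
    push_cast
    field_simp
    linear_combination (a + 1 + i) * (d + e * (i + 1)) * ih

lemma mom_monomial (i : ℕ) (c : ℝ) : mom e a d (monomial i c) = mu e a d i * c := by
  simp [mom, Polynomial.lsum_apply, sum_monomial_index]

lemma mom_one : mom e a d 1 = 1 := by
  rw [← monomial_zero_one, mom_monomial, mu_zero, one_mul]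

lemma mom_C_mul (c : ℝ) (f : ℝ[X]) : mom e a d (C c * f) = c * mom e a d f := by
  rw [← smul_eq_C_mul, map_smul, smul_eq_mul]

lemma mom_C (c : ℝ) : mom e a d (C c) = c := by
  rw [← mul_one (C c), mom_C_mul, mom_one, mul_one]

lemma mom_X_mul (f : ℝ[X]) : mom e a d (X * f) = (a + 1) / d * mom e (a + 1) (d + e) f := by
  induction f using Polynomial.induction_on' with
  | add p q hp hq => rw [mul_add, map_add, map_add, hp, hq, mul_add]
  | monomial i c => rw [X_mul_monomial, mom_monomial, mom_monomial, mu_succ', mul_assoc]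

lemma mom_X_pow_mul (k : ℕ) (f : ℝ[X]) :
    mom e a d (X ^ k * f) = mu e a d k * mom e (a + k) (d + e * k) f := by
  induction k generalizing a d with
  | zero => simp [mu_zero]
  | succ k ih =>
    rw [pow_succ', mul_assoc, mom_X_mul, ih, mu_succ', mul_assoc]
    congr 4 <;> push_cast <;> ring

lemma mom_one_sub_mul (h : Adm e a d) (f : ℝ[X]) :
    mom e a d ((1 - C e * X) * f) = (d - e * (a + 1)) / d * mom e a (d + e) f := by
  induction f using Polynomial.induction_on' with
  | add p q hp hq => rw [mul_add, map_add, map_add, hp, hq]; ring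
  | monomial i c =>
    have h1 := (h.den_pos i).ne'
    have h2 := h.d_pos.ne'
    rw [sub_mul, one_mul, mul_assoc, X_mul_monomial, map_sub, mom_C_mul, mom_monomial,
      mom_monomial, mom_monomial, mu_succ]
    have h3 : mu e a (d + e) i = mu e a d i * d / (d + e * i) := by
      rw [eq_div_iff h1, mu_shift_b h]
    rw [h3]
    field_simp
    ring

lemma mom_sig_mul (h : Adm e a d) (f : ℝ[X]) :
    mom e a d (sig e * f) = lam e a d * mom e (a + 1) (d + 2 * e) f := by
  rw [sig, mul_assoc, mom_X_mul, mom_one_sub_mul h.shift, lam, ← mul_assoc]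
  have h1 := h.d_pos.ne'
  have h2 := h.shift.d_pos.ne'
  congr 1
  · field_simp; ring
  · congr 2; ring

/-- Formally the integral of `(σ f W)'`, where `W` is the weight. On monomials it is exactly the
recursion that defines `mu`. -/
lemma mom_stokes (h : Adm e a d) (f : ℝ[X]) :
    mom e a d (sig e * derivative f + tau a d * f) = 0 := by
  induction f using Polynomial.induction_on' with
  | add p q hp hq =>
    have : sig e * derivative (p + q) + tau a d * (p + q) =
      (sig e * derivative p + tau a d * p) + (sig e * derivative q + tau a d * q) := by
      rw [derivative_add]; ring
    rw [this, map_add, hp, hq, add_zero]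
  | monomial i c =>
    have h1 := (h.den_pos i).ne'
    have h2 : sig e * derivative (monomial i c) + tau a d * monomial i c =
        monomial i ((i + a + 1) * c) - monomial (i + 1) ((e * i + d) * c) := by
      have hX : X * derivative (monomial i c) = monomial i (i * c) := by
        cases i with
        | zero => simp
        | succ i => rw [derivative_monomial, X_mul_monomial]; simp [mul_comm]
      rw [sig, tau]
      have : X * (1 - C e * X) * derivative (monomial i c) =
        X * derivative (monomial i c) - C e * (X * (X * derivative (monomial i c))) := by ring
      rw [this, hX, X_mul_monomial, sub_mul, mul_assoc, X_mul_monomial]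
      simp only [C_mul_monomial]
      have h4 : monomial i (((i : ℝ) + a + 1) * c) =
        monomial i (i * c) + monomial i ((a + 1) * c) := by
        rw [← map_add]; congr 1; ring
      have h5 : monomial (i + 1) ((e * i + d) * c) =
        monomial (i + 1) (e * (i * c)) + monomial (i + 1) (d * c) := by
        rw [← map_add]; congr 1; ring
      rw [h4, h5]
      ring
    rw [h2, map_sub, mom_monomial, mom_monomial, mu_succ, add_comm (e * (i : ℝ)) d,
      mul_assoc (mu e a d i), div_mul_eq_mul_div, mul_left_comm (a + 1 + (i : ℝ)),
      mul_div_cancel_left₀ _ h1]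
    ring

lemma sig_eq : sig e = X - C e * (X * X) := by rw [sig]; ring

lemma coeff_X_mul_derivative (g : ℝ[X]) (N : ℕ) :
    (X * derivative g).coeff N = N * g.coeff N := by
  cases N with
  | zero => simp
  | succ N => rw [coeff_X_mul, coeff_derivative]; push_cast; ring

/-- For `g` of degree `N` the top factor `-(e * N + κ * d)` explains two normalisations: `κ = 1` is
the constant in `pol`, `κ = 1 / 2` is `lead`. -/
lemma coeff_opr (κ : ℝ) (g : ℝ[X]) (N : ℕ) : (opr e a d κ g).coeff (N + 1) =
    (N + 1 + κ * (a + 1)) * g.coeff (N + 1) - (e * N + κ * d) * g.coeff N := by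
  have : opr e a d κ g = X * derivative g - C e * (X * (X * derivative g)) +
      C κ * (C (a + 1) * g - C d * (X * g)) := by
    rw [opr, sig, tau]; ring
  rw [this]
  simp only [coeff_add, coeff_sub, coeff_C_mul, coeff_X_mul_derivative, coeff_X_mul,
    coeff_derivative]
  ring

lemma natDegree_opr_le (κ : ℝ) {g : ℝ[X]} {N : ℕ} (hg : g.natDegree ≤ N) :
    (opr e a d κ g).natDegree ≤ N + 1 := by
  rw [natDegree_le_iff_coeff_eq_zero] at hg ⊢
  intro m hm
  obtain ⟨m, rfl⟩ : ∃ m', m = m' + 1 := ⟨m - 1, by omega⟩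
  rw [coeff_opr, hg _ (by omega), hg _ (by omega)]
  ring

lemma pol_succ (N : ℕ) : pol e (N + 1) a d =
    C (-(1 / (d + e * N))) * opr e a d 1 (pol e N (a + 1) (d + 2 * e)) := by
  rw [pol, opr, C_1, one_mul]

lemma pol_natDegree_le_and_coeff (N : ℕ) (h : Adm e a d) :
    (pol e N a d).natDegree ≤ N ∧ (pol e N a d).coeff N = 1 := by
  induction N generalizing a d with
  | zero => simp [pol]
  | succ N ih =>
    obtain ⟨h1, h2⟩ := ih h.up
    have h3 := (h.den_pos N).ne'
    rw [pol_succ]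
    refine ⟨(natDegree_C_mul_le _ _).trans (natDegree_opr_le 1 h1), ?_⟩
    rw [coeff_C_mul, coeff_opr, h2, coeff_eq_zero_of_natDegree_lt (by omega)]
    field_simp
    ring

lemma pol_monic (h : Adm e a d) (N : ℕ) : (pol e N a d).Monic :=
  monic_of_natDegree_le_of_coeff_eq_one N (pol_natDegree_le_and_coeff N h).1
    (pol_natDegree_le_and_coeff N h).2

lemma natDegree_pol (h : Adm e a d) (N : ℕ) : (pol e N a d).natDegree = N :=
  natDegree_eq_of_le_of_coeff_ne_zero (pol_natDegree_le_and_coeff N h).1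
    (by rw [(pol_natDegree_le_and_coeff N h).2]; exact one_ne_zero)

lemma coeff_pol_self (h : Adm e a d) (N : ℕ) : (pol e N a d).coeff N = 1 :=
  (pol_natDegree_le_and_coeff N h).2

lemma tau_up : tau (a + 1) (d + 2 * e) = tau a d + derivative (sig e) := by
  rw [sig_eq, tau, tau]
  simp only [derivative_sub, derivative_X, derivative_mul, derivative_C, map_add, map_mul, C_1]
  rw [show (C 2 : ℝ[X]) = 2 from rfl]
  ring

/-- The differential equation and the derivative formula. -/
lemma pol_ode_and_derivative (N : ℕ) (h : Adm e a d) :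
    sig e * derivative (derivative (pol e N a d)) + tau a d * derivative (pol e N a d) =
      C (-(N * (d + e * ((N : ℝ) - 1)))) * pol e N a d ∧
    derivative (pol e N a d) = C (N : ℝ) * pol e (N - 1) (a + 1) (d + 2 * e) := by
  induction N generalizing a d with
  | zero => simp [pol]
  | succ N ih =>
    have h3 := (h.den_pos N).ne'
    obtain ⟨h1, -⟩ := ih h.up
    have hd : derivative (pol e (N + 1) a d) =
        C ((N : ℝ) + 1) * pol e N (a + 1) (d + 2 * e) := by
      set P := pol e N (a + 1) (d + 2 * e) with hP
      rw [pol, ← hP, derivative_C_mul]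
      -- Since `τ + σ'` is the `τ` of the shifted parameters, differentiating the Rodrigues
      -- recursion yields the second-order operator of `P`. The differential equation of `P` gives
      -- the derivative formula, and the recursion then gives the next differential equation.
      have h2 : derivative (sig e * derivative P + tau a d * P) =
          (sig e * derivative (derivative P) + tau (a + 1) (d + 2 * e) * derivative P) +
            derivative (tau a d) * P := by
        rw [tau_up]
        simp only [derivative_add, derivative_mul]
        ring
      have h4 : derivative (tau a d) = -C d := by simp [tau]
      rw [h2, h1, h4, neg_mul, ← sub_eq_add_neg, ← sub_mul, ← C_sub, ← mul_assoc, ← C_mul]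
      congr 2
      field_simp
      ring
    constructor
    · have h4 : sig e * derivative (derivative (pol e (N + 1) a d)) +
        tau a d * derivative (pol e (N + 1) a d) = C ((N : ℝ) + 1) *
          (sig e * derivative (pol e N (a + 1) (d + 2 * e)) +
            tau a d * pol e N (a + 1) (d + 2 * e)) := by
        rw [hd, derivative_C_mul]; ring
      rw [h4, pol, ← mul_assoc, ← C_mul]
      congr 2
      rw [show ((N + 1 : ℕ) : ℝ) - 1 = N by push_cast; ring]
      push_cast
      have h3' : d + N * e ≠ 0 := by rwa [mul_comm]
      field_simp
    · rw [hd]; simp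

lemma derivative_pol (h : Adm e a d) (N : ℕ) : derivative (pol e (N + 1) a d) =
    C ((N : ℝ) + 1) * pol e N (a + 1) (d + 2 * e) := by
  have := (pol_ode_and_derivative (N + 1) h).2
  simpa using this

/-- Integration by parts against an orthogonal polynomial. -/
lemma mom_mul_pol_succ (h : Adm e a d) (f : ℝ[X]) (N : ℕ) :
    mom e a d (f * pol e (N + 1) a d) = lam e a d / (d + e * N) *
      mom e (a + 1) (d + 2 * e) (derivative f * pol e N (a + 1) (d + 2 * e)) := by
  set P := pol e N (a + 1) (d + 2 * e) with hP
  have h1 := mom_stokes h (f * P)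
  have h2 : sig e * derivative (f * P) + tau a d * (f * P) =
      sig e * (derivative f * P) + f * (sig e * derivative P + tau a d * P) := by
    rw [derivative_mul]; ring
  rw [h2, map_add, mom_sig_mul h] at h1
  rw [pol, ← hP, mul_left_comm, mom_C_mul]
  linear_combination (-(1 / (d + e * N))) * h1

/-- Each integration by parts differentiates `f` and lowers the degree of the orthogonal polynomial.
After `N` steps only the leading coefficient of `f` survives, and `hn` collects the constants. -/
lemma mom_mul_pol (h : Adm e a d) {f : ℝ[X]} {N : ℕ} (hf : f.natDegree ≤ N) :
    mom e a d (f * pol e N a d) = f.coeff N * hn e N a d := by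
  induction N generalizing a d f with
  | zero =>
    rw [eq_C_of_natDegree_le_zero hf, pol, hn, mom_C_mul, mom_one]; simp
  | succ N ih =>
    have h1 : (derivative f).natDegree ≤ N :=
      (natDegree_derivative_le f).trans (by omega)
    rw [mom_mul_pol_succ h, ih h.up h1, coeff_derivative, hn]
    ring

lemma mom_mul_pol_of_lt (h : Adm e a d) {f : ℝ[X]} {N : ℕ} (hf : f.natDegree < N) :
    mom e a d (f * pol e N a d) = 0 := by
  rw [mom_mul_pol h hf.le, coeff_eq_zero_of_natDegree_lt hf, zero_mul]

lemma hn_pos (h : Adm e a d) (N : ℕ) : 0 < hn e N a d := by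
  induction N generalizing a d with
  | zero => simp [hn]
  | succ N ih =>
    rw [hn]
    have h1 := h.den_pos N
    have h2 := ih h.up
    have h3 : 0 < lam e a d := by
      have := h.shift.d_pos
      exact div_pos (mul_pos (by linarith [h.a_gt]) h.b_pos) (mul_pos h.d_pos this)
    positivity

lemma mom_pol_mul_self (h : Adm e a d) (N : ℕ) :
    mom e a d (pol e N a d * pol e N a d) = hn e N a d := by
  rw [mom_mul_pol h (natDegree_pol h N).le, coeff_pol_self h, one_mul]

lemma mom_pol_mul_pol_of_ne (h : Adm e a d) {N M : ℕ} (hNM : N ≠ M) :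
    mom e a d (pol e N a d * pol e M a d) = 0 := by
  rcases lt_or_gt_of_ne hNM with h1 | h1
  · exact mom_mul_pol_of_lt h (by rwa [natDegree_pol h])
  · rw [mul_comm]; exact mom_mul_pol_of_lt h (by rwa [natDegree_pol h])

/-- Expansion of a polynomial in orthogonal polynomials. -/
lemma eq_sum_pol (h : Adm e a d) {q : ℝ[X]} {N : ℕ} (hq : q.natDegree ≤ N) :
    q = ∑ M ∈ range (N + 1), C (mom e a d (q * pol e M a d) / hn e M a d) * pol e M a d := by
  induction N generalizing q with
  | zero =>
    rw [eq_C_of_natDegree_le_zero hq, zero_add, sum_range_one, pol, hn, mul_one, mul_one, div_one,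
      mom_C]
  | succ N ih =>
    have h0 := (hn_pos h (N + 1)).ne'
    let r := q - C (q.coeff (N + 1)) * pol e (N + 1) a d
    have hr : r.natDegree ≤ N := by
      rw [natDegree_le_iff_coeff_eq_zero] at hq ⊢
      intro m hm
      simp only [r, coeff_sub, coeff_C_mul]
      rcases eq_or_lt_of_le (Nat.succ_le_of_lt hm) with h1 | h1
      · rw [← h1, Nat.succ_eq_add_one, coeff_pol_self h]; ring
      · rw [hq m h1, coeff_eq_zero_of_natDegree_lt (p := pol e (N + 1) a d)
          (by rw [natDegree_pol h]; exact h1)]; ring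
    have h1 : q = r + C (q.coeff (N + 1)) * pol e (N + 1) a d := by simp [r]
    rw [sum_range_succ, mom_mul_pol h hq, mul_div_cancel_right₀ _ h0]
    nth_rewrite 1 [h1]
    congr 1
    rw [ih hr]
    refine sum_congr rfl fun M hM => ?_
    congr 3
    rw [h1, add_mul, map_add, mul_assoc, mom_C_mul,
      mom_pol_mul_pol_of_ne h (by have := mem_range.1 hM; omega), mul_zero, add_zero]

/-- In the Rodrigues formula, replacing `τ` by its shifted version gives a term that integrates to
zero. The difference is `s (1 - e x)`, and the factor `1 - e x` turns the problem into the one of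
degree `N` with `s - 1` relative to the raised parameters. -/
lemma mom_pol_shift (h : Adm e a d) (h' : Adm e (a + s) (d + e * s)) (N : ℕ) :
    mom e (a + s) (d + e * s) (pol e N a d) = d0 e N a d s := by
  induction N generalizing a d s with
  | zero => rw [pol, d0, mom_one]
  | succ N ih =>
    set P := pol e N (a + 1) (d + 2 * e) with hP
    have h1 := mom_stokes h' P
    have h2 : sig e * derivative P + tau a d * P =
        (sig e * derivative P + tau (a + s) (d + e * s) * P) - C s * ((1 - C e * X) * P) := by
      simp only [tau, map_add, map_mul]; ring
    have h3 := (h.den_pos N).ne'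
    have h4 := h'.d_pos.ne'
    have h5 : Adm e (a + 1 + (s - 1)) (d + 2 * e + e * (s - 1)) := by
      convert h'.shift_b using 1 <;> ring
    have h6 := ih h.up h5
    rw [show a + 1 + (s - 1) = a + s by ring,
      show d + 2 * e + e * (s - 1) = d + e * s + e by ring] at h6
    rw [pol, ← hP, h2, mom_C_mul, map_sub, h1, mom_C_mul, mom_one_sub_mul h', h6, d0]
    field_simp
    ring

/-- Integration by parts lowers both degrees and raises `a` and `d` with `s` fixed, until the second
factor is constant. -/
lemma mom_pol_mul_pol_shift (h : Adm e a d) (h' : Adm e (a + s) (d + e * s)) {N M : ℕ}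
    (hMN : M ≤ N) : mom e (a + s) (d + e * s) (pol e N a d * pol e M (a + s) (d + e * s)) =
      conn e N M a d s * hn e M (a + s) (d + e * s) := by
  induction M generalizing N a d with
  | zero => rw [pol, hn, mul_one, mom_pol_shift h h', conn]; simp
  | succ M ih =>
    obtain ⟨N, rfl⟩ : ∃ N', N = N' + 1 := ⟨N - 1, by omega⟩
    have h1 : Adm e (a + 1 + s) (d + 2 * e + e * s) := by
      convert h'.up using 1 <;> ring
    have h2 := ih h.up h1 (N := N) (by omega)
    rw [show a + 1 + s = a + s + 1 by ring,
      show d + 2 * e + e * s = d + e * s + 2 * e by ring] at h2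
    rw [mom_mul_pol_succ h', derivative_pol h, mul_assoc, mom_C_mul, h2, hn]
    have h3 : ((N : ℝ) + 1) * conn e N M (a + 1) (d + 2 * e) s =
        (M + 1) * conn e (N + 1) (M + 1) a d s := by
      rw [conn, conn, ← mul_assoc, ← mul_assoc]
      congr 1
      · have := Nat.add_one_mul_choose_eq N M
        have h4 : ((N : ℝ) + 1) * N.choose M = (N + 1).choose (M + 1) * (M + 1) := by
          exact_mod_cast this
        rw [h4, mul_comm]
      · rw [Nat.add_sub_add_right]
        congr 1 <;> push_cast <;> ring
    linear_combination (lam e (a + s) (d + e * s) / (d + e * s + e * M) *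
      hn e M (a + s + 1) (d + e * s + 2 * e)) * h3

/-- The connection formula. -/
lemma pol_eq_sum_conn (h : Adm e a d) (h' : Adm e (a + s) (d + e * s)) (N : ℕ) :
    pol e N a d = ∑ M ∈ range (N + 1), C (conn e N M a d s) * pol e M (a + s) (d + e * s) := by
  rw [eq_sum_pol h' (natDegree_pol h N).le]
  refine sum_congr rfl fun M hM => ?_
  rw [mom_pol_mul_pol_shift h h' (by have := mem_range.1 hM; omega),
    mul_div_cancel_right₀ _ (hn_pos h' M).ne']

lemma mom_pol_mul_pol (h : Adm e a d) (h' : Adm e (a + s) (d + e * s)) {N M : ℕ} (hMN : M ≤ N) :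
    mom e (a + s) (d + e * s) (pol e M a d * pol e N a d) =
      ∑ q ∈ range (M + 1), conn e M q a d s * conn e N q a d s * hn e q (a + s) (d + e * s) := by
  rw [pol_eq_sum_conn h h' M, sum_mul, map_sum]
  refine sum_congr rfl fun q hq => ?_
  rw [mul_assoc, mom_C_mul, mul_comm (pol e q _ _),
    mom_pol_mul_pol_shift h h' (by have := mem_range.1 hq; omega)]
  ring

/-- Leading coefficient of `opr` with `κ = 1 / 2` on polynomials of degree `l`. -/
noncomputable def lead (e d : ℝ) (l : ℕ) : ℝ := -(e * l + d / 2)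

lemma lead_neg (h : Adm e a d) (l : ℕ) : lead e d l < 0 := by
  have := mul_nonneg h.e_nonneg (Nat.cast_nonneg (α := ℝ) l)
  rw [lead]
  linarith [h.d_pos]

/-- The value `κ = 1 / 2` divides the `τ` term of the Stokes identity for `f * g` evenly between the
factors; this is why the operator is antisymmetric. -/
lemma mom_opr_mul (h : Adm e a d) (f g : ℝ[X]) :
    mom e a d (opr e a d (1 / 2) f * g) = -mom e a d (f * opr e a d (1 / 2) g) := by
  rw [eq_neg_iff_add_eq_zero, ← map_add]
  have : opr e a d (1 / 2) f * g + f * opr e a d (1 / 2) g =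
      sig e * derivative (f * g) + tau a d * (f * g) := by
    have h2 : (C (1 / 2 : ℝ) : ℝ[X]) + C (1 / 2) = 1 := by rw [← C_add, ← C_1]; norm_num
    rw [opr, opr, derivative_mul]
    linear_combination (tau a d * f * g) * h2
  rw [this, mom_stokes h]

lemma coeff_opr_pol (h : Adm e a d) (l : ℕ) :
    (opr e a d (1 / 2) (pol e l a d)).coeff (l + 1) = lead e d l := by
  rw [coeff_opr, coeff_pol_self h, coeff_eq_zero_of_natDegree_lt (by rw [natDegree_pol h]; omega),
    lead]
  ring

lemma opr_pol_zero (h : Adm e a d) :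
    opr e a d (1 / 2) (pol e 0 a d) = C (lead e d 0) * pol e 1 a d := by
  have hd := h.d_pos.ne'
  simp only [pol, opr, lead]
  simp only [derivative_one, mul_zero, mul_one, zero_add, Nat.cast_zero, add_zero, ← mul_assoc,
    ← C_mul]
  congr 2
  field_simp

/-- The operator raises degrees by at most one. By antisymmetry it lowers them by at most one, has
no diagonal part, and its lower coefficients are determined by the upper ones. -/
lemma opr_pol_succ (h : Adm e a d) (l : ℕ) : opr e a d (1 / 2) (pol e (l + 1) a d) =
    C (lead e d (l + 1)) * pol e (l + 2) a d +
      C (-(lead e d l * hn e (l + 1) a d / hn e l a d)) * pol e l a d := by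
  rw [eq_sum_pol h (natDegree_opr_le (1 / 2) (natDegree_pol h (l + 1)).le), sum_range_succ,
    sum_range_succ, sum_range_succ]
  have hanti := mom_opr_mul h (pol e (l + 1) a d)
  have h1 : mom e a d (opr e a d (1 / 2) (pol e (l + 1) a d) * pol e (l + 1) a d) = 0 := by
    have := hanti (pol e (l + 1) a d)
    rw [mul_comm (pol e (l + 1) a d)] at this
    linarith
  have h2 : mom e a d (opr e a d (1 / 2) (pol e (l + 1) a d) * pol e (l + 2) a d) =
      lead e d (l + 1) * hn e (l + 2) a d := by
    rw [mom_mul_pol h (natDegree_opr_le _ (natDegree_pol h _).le), coeff_opr_pol h]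
  have h3 : mom e a d (opr e a d (1 / 2) (pol e (l + 1) a d) * pol e l a d) =
      -(lead e d l * hn e (l + 1) a d) := by
    rw [hanti, mul_comm, mom_mul_pol h (natDegree_opr_le _ (natDegree_pol h _).le),
      coeff_opr_pol h]
  have h4 : ∀ M ∈ range l, C (mom e a d (opr e a d (1 / 2) (pol e (l + 1) a d) * pol e M a d) /
      hn e M a d) * pol e M a d = 0 := by
    intro M hM
    rw [hanti, mul_comm (pol e (l + 1) a d), mom_mul_pol_of_lt h, neg_zero, zero_div, C_0, zero_mul]
    have := natDegree_opr_le (e := e) (a := a) (d := d) (1 / 2) (natDegree_pol h M).le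
    have := mem_range.1 hM
    omega
  rw [sum_eq_zero h4, h1, h2, h3, mul_div_cancel_right₀ _ (hn_pos h _).ne', neg_div]
  simp
  ring

end OrthogonalPolynomials

end ClassicalEnsemble

/-! ### Skew-orthogonality and reduction of the pair sum to orthogonal polynomials. -/

namespace ClassicalEnsemble

section SkewForms

open Polynomial Finset

variable {e a d z : ℝ}

/-- A bilinear form for which the operator `opr e a d (1 / 2)` inverts the moment functional:
`B f (n g) = -2 z F (f g)`. -/
def InvertedBy (e a d z : ℝ) (F : ℝ[X] →ₗ[ℝ] ℝ) (B : ℝ[X] →ₗ[ℝ] ℝ[X] →ₗ[ℝ] ℝ) : Prop :=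
  ∀ f g, B f (opr e a d (1 / 2) g) = -2 * z * F (f * g)

/-- The monic skew-orthogonal polynomials. -/
noncomputable def skewPol (e a d : ℝ) (i : ℕ) : ℝ[X] :=
  if Even i then pol e i a d else C (1 / lead e d (i - 1)) * opr e a d (1 / 2) (pol e (i - 1) a d)

lemma skewPol_even (i : ℕ) : skewPol e a d (2 * i) = pol e (2 * i) a d := by
  simp [skewPol]

lemma skewPol_odd (i : ℕ) : skewPol e a d (2 * i + 1) =
    C (1 / lead e d (2 * i)) * opr e a d (1 / 2) (pol e (2 * i) a d) := by
  simp [skewPol]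

lemma skewPol_natDegree_le_and_coeff (h : Adm e a d) (i : ℕ) :
    (skewPol e a d i).natDegree ≤ i ∧ (skewPol e a d i).coeff i = 1 := by
  rcases Nat.even_or_odd' i with ⟨j, rfl | rfl⟩
  · rw [skewPol_even]; exact pol_natDegree_le_and_coeff _ h
  · rw [skewPol_odd]
    refine ⟨(natDegree_C_mul_le _ _).trans (natDegree_opr_le _ (natDegree_pol h _).le), ?_⟩
    rw [coeff_C_mul, coeff_opr_pol h, one_div, inv_mul_cancel₀ (lead_neg h _).ne]

lemma skewPol_monic (h : Adm e a d) (i : ℕ) : (skewPol e a d i).Monic :=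
  monic_of_natDegree_le_of_coeff_eq_one i (skewPol_natDegree_le_and_coeff h i).1
    (skewPol_natDegree_le_and_coeff h i).2

lemma natDegree_skewPol (h : Adm e a d) (i : ℕ) : (skewPol e a d i).natDegree = i :=
  natDegree_eq_of_le_of_coeff_ne_zero (skewPol_natDegree_le_and_coeff h i).1
    (by rw [(skewPol_natDegree_le_and_coeff h i).2]; exact one_ne_zero)

variable {B : ℝ[X] →ₗ[ℝ] ℝ[X] →ₗ[ℝ] ℝ}

lemma map_C_mul {V : Type*} [AddCommGroup V] [Module ℝ V] (T : ℝ[X] →ₗ[ℝ] V) (c : ℝ) (f : ℝ[X]) :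
    T (C c * f) = c • T f := by
  rw [← smul_eq_C_mul, map_smul]

lemma form_opr_pol_succ {T : ℝ[X] →ₗ[ℝ] ℝ} (h : Adm e a d) (l : ℕ) :
    T (opr e a d (1 / 2) (pol e (l + 1) a d)) = lead e d (l + 1) * T (pol e (l + 2) a d) -
      lead e d l * hn e (l + 1) a d / hn e l a d * T (pol e l a d) := by
  rw [opr_pol_succ h, map_add, map_C_mul, map_C_mul, smul_eq_mul, smul_eq_mul]
  ring

/-- Applied to `P_{2j+1}`, the inversion relation links `P_{2j}` to `P_{2j+2}` with right side zero
by orthogonality. Vanishing thus propagates from `B 1 1 = 0`. -/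
lemma form_even_even (h : Adm e a d) (hz : ∀ f g, B g f = -B f g)
    (hB : InvertedBy e a d z (mom e a d) B) (i j : ℕ) :
    B (pol e (2 * i) a d) (pol e (2 * j) a d) = 0 := by
  have step : ∀ i j : ℕ, B (pol e (2 * i) a d) (pol e (2 * j) a d) = 0 →
      B (pol e (2 * i) a d) (pol e (2 * (j + 1)) a d) = 0 := by
    intro i j hij
    have h1 := hB (pol e (2 * i) a d) (pol e (2 * j + 1) a d)
    rw [mom_pol_mul_pol_of_ne h (by omega), form_opr_pol_succ h, hij] at h1
    have h2 : B (pol e (2 * i) a d) (pol e (2 * j + 2) a d) = 0 := by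
      simpa [(lead_neg h _).ne] using h1
    exact h2
  have base : ∀ i : ℕ, B (pol e (2 * i) a d) (pol e (2 * 0) a d) = 0 := by
    intro i
    rw [hz]
    induction i with
    | zero => rw [neg_eq_zero]; linarith [hz (pol e (2 * 0) a d) (pol e (2 * 0) a d)]
    | succ i ih => rw [neg_eq_zero] at ih ⊢; exact step _ _ ih
  induction j with
  | zero => exact base i
  | succ j ih => exact step _ _ ih

lemma form_even_opr (h : Adm e a d) (hB : InvertedBy e a d z (mom e a d) B) (i j : ℕ) :
    B (pol e (2 * i) a d) (opr e a d (1 / 2) (pol e (2 * j) a d)) =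
      if i = j then -2 * z * hn e (2 * i) a d else 0 := by
  rw [hB]
  split_ifs with hij
  · rw [hij, mom_pol_mul_self h]
  · rw [mom_pol_mul_pol_of_ne h (by omega), mul_zero]

/-- The image of an even-indexed polynomial has only odd-indexed components. -/
lemma mom_opr_even (h : Adm e a d) (i j : ℕ) :
    mom e a d (opr e a d (1 / 2) (pol e (2 * i) a d) * pol e (2 * j) a d) = 0 := by
  cases i with
  | zero =>
    rw [mul_zero, opr_pol_zero h, mul_assoc, mom_C_mul, mom_pol_mul_pol_of_ne h (by omega),
      mul_zero]
  | succ i =>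
    rw [show 2 * (i + 1) = 2 * i + 1 + 1 by ring, opr_pol_succ h, add_mul, map_add, mul_assoc,
      mul_assoc, mom_C_mul, mom_C_mul, mom_pol_mul_pol_of_ne h (by omega),
      mom_pol_mul_pol_of_ne h (by omega)]
    ring

lemma form_opr_opr (h : Adm e a d) (hB : InvertedBy e a d z (mom e a d) B) (i j : ℕ) :
    B (opr e a d (1 / 2) (pol e (2 * i) a d)) (opr e a d (1 / 2) (pol e (2 * j) a d)) = 0 := by
  rw [hB, mom_opr_even h, mul_zero]

/-- The sum over skew-orthogonal polynomials in terms of orthogonal polynomials. -/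
lemma sum_form_eq {T : ℝ[X] →ₗ[ℝ] ℝ[X] →ₗ[ℝ] ℝ} {F : ℝ[X] →ₗ[ℝ] ℝ} (h : Adm e a d) (hz : z ≠ 0)
    (hT : InvertedBy e a d z F T) (p : ℕ) :
    ∑ i ∈ range (p + 1),
      (T (pol e (2 * i) a d) (opr e a d (1 / 2) (pol e (2 * i) a d)) -
        T (opr e a d (1 / 2) (pol e (2 * i) a d)) (pol e (2 * i) a d)) /
        (-2 * z * hn e (2 * i) a d) =
    ∑ l ∈ range (2 * p + 1), F (pol e l a d * pol e l a d) / hn e l a d +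
      lead e d (2 * p) / (2 * z * hn e (2 * p) a d) *
        T (pol e (2 * p + 1) a d) (pol e (2 * p) a d) := by
  have hh : ∀ l, hn e l a d ≠ 0 := fun l => (hn_pos h l).ne'
  -- From `p` to `p + 1` the boundary term moves up by two degrees. The inversion relation for
  -- `P_{2p+1}` and `P_{2p+2}` converts the change into the two new diagonal terms of the unitary
  -- sum; no antisymmetry of `T` is involved.
  induction p with
  | zero =>
    have h0 := hh 0
    simp only [zero_add, sum_range_one, mul_zero, hT _ _]
    rw [opr_pol_zero h, map_C_mul, LinearMap.smul_apply, smul_eq_mul]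
    field_simp
    ring
  | succ p ih =>
    rw [sum_range_succ, ih, show 2 * (p + 1) + 1 = 2 * p + 1 + 1 + 1 by ring,
      sum_range_succ _ (2 * p + 1 + 1), sum_range_succ _ (2 * p + 1), show 2 * (p + 1) = 2 * p + 2 by ring]
    have h1 := hT (pol e (2 * p + 2) a d) (pol e (2 * p + 2) a d)
    have h2 := hT (pol e (2 * p + 1) a d) (pol e (2 * p + 1) a d)
    rw [form_opr_pol_succ h] at h2
    have h3 : T (opr e a d (1 / 2) (pol e (2 * p + 2) a d)) (pol e (2 * p + 2) a d) =
        lead e d (2 * p + 2) * T (pol e (2 * p + 3) a d) (pol e (2 * p + 2) a d) -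
        lead e d (2 * p + 1) * hn e (2 * p + 2) a d / hn e (2 * p + 1) a d *
          T (pol e (2 * p + 1) a d) (pol e (2 * p + 2) a d) :=
      form_opr_pol_succ (T := T.flip (pol e (2 * p + 2) a d)) h (2 * p + 1)
    rw [h1, h3]
    have e0 := hh (2 * p)
    have e1 := hh (2 * p + 1)
    have e2 := hh (2 * p + 2)
    have h4 : lead e d (2 * p + 1) * T (pol e (2 * p + 1) a d) (pol e (2 * p + 2) a d) =
      -2 * z * F (pol e (2 * p + 1) a d * pol e (2 * p + 1) a d) +
        lead e d (2 * p) * hn e (2 * p + 1) a d / hn e (2 * p) a d *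
          T (pol e (2 * p + 1) a d) (pol e (2 * p) a d) := by linarith
    have h5 : lead e d (2 * p + 1) * hn e (2 * p + 2) a d / hn e (2 * p + 1) a d *
          T (pol e (2 * p + 1) a d) (pol e (2 * p + 2) a d) =
        hn e (2 * p + 2) a d / hn e (2 * p + 1) a d * (lead e d (2 * p + 1) *
          T (pol e (2 * p + 1) a d) (pol e (2 * p + 2) a d)) := by ring
    rw [h5, h4]
    field_simp
    ring

/-- The value `B 1 P_{2i+1}` of a normalised inverted form. -/
noncomputable def oddVal (e a d : ℝ) (i : ℕ) : ℝ :=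
  -(2 / lead e d 0) * ∏ q ∈ range i, (lead e d (2 * q + 1) * hn e (2 * q + 2) a d /
    (lead e d (2 * q + 2) * hn e (2 * q + 1) a d))

lemma oddVal_zero : oddVal e a d 0 = -(2 / lead e d 0) := by simp [oddVal]

lemma oddVal_succ (i : ℕ) : oddVal e a d (i + 1) = oddVal e a d i *
    (lead e d (2 * i + 1) * hn e (2 * i + 2) a d /
      (lead e d (2 * i + 2) * hn e (2 * i + 1) a d)) := by
  rw [oddVal, prod_range_succ, ← mul_assoc, ← oddVal]

lemma oddVal_pos (h : Adm e a d) (i : ℕ) : 0 < oddVal e a d i := by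
  induction i with
  | zero =>
    rw [oddVal_zero, ← div_neg]
    exact div_pos two_pos (neg_pos.2 (lead_neg h 0))
  | succ i ih =>
    rw [oddVal_succ]
    refine mul_pos ih ?_
    rw [mul_div_mul_comm]
    exact mul_pos (div_pos_of_neg_of_neg (lead_neg h _) (lead_neg h _))
      (div_pos (hn_pos h _) (hn_pos h _))

/-- Pairing `1` with the image of `P_{2i+2}` gives zero, because that polynomial has mean zero. This
is a two-term recursion, solved by `oddVal`. -/
lemma form_one_odd (h : Adm e a d) (hB : InvertedBy e a d z (mom e a d) B) (i : ℕ) :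
    B 1 (pol e (2 * i + 1) a d) = z * oddVal e a d i := by
  induction i with
  | zero =>
    have h1 := hB 1 (pol e 0 a d)
    rw [opr_pol_zero h, map_C_mul, smul_eq_mul, one_mul, pol, mom_one] at h1
    have h2 := (lead_neg h 0).ne
    rw [oddVal_zero, mul_zero, zero_add]
    field_simp
    linarith
  | succ i ih =>
    have h1 := hB 1 (pol e (2 * i + 2) a d)
    have h2 : mom e a d (pol e (2 * i + 2) a d) = 0 := by
      have := mom_pol_mul_pol_of_ne h (N := 0) (M := 2 * i + 2) (by omega)
      rwa [pol, one_mul] at this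
    rw [form_opr_pol_succ h, one_mul, h2, ih, mul_zero] at h1
    have h3 := (lead_neg h (2 * i + 2)).ne
    have h4 := (hn_pos h (2 * i + 1)).ne'
    rw [oddVal_succ, show 2 * (i + 1) + 1 = 2 * i + 1 + 2 by ring]
    have h5 : B 1 (pol e (2 * i + 1 + 2) a d) = lead e d (2 * i + 1) * hn e (2 * i + 2) a d /
      hn e (2 * i + 1) a d * (z * oddVal e a d i) / lead e d (2 * i + 2) := by
      rw [eq_div_iff h3]; linarith
    rw [h5]
    field_simp

lemma form_one_even (h : Adm e a d) (hz : ∀ f g, B g f = -B f g)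
    (hB : InvertedBy e a d z (mom e a d) B) (i : ℕ) : B 1 (pol e (2 * i) a d) = 0 :=
  form_even_even h hz hB 0 i

/-- Expansion of the boundary term of `sum_form_eq`. -/
lemma boundary_form_eq {T : ℝ[X] →ₗ[ℝ] ℝ} {F : ℝ[X] →ₗ[ℝ] ℝ} {g : ℝ[X]} (h : Adm e a d)
    (hz : z ≠ 0) (hT : ∀ f, T (opr e a d (1 / 2) f) = -2 * z * F (g * f)) (p : ℕ) :
    lead e d (2 * p) / (2 * z * hn e (2 * p) a d) * T (pol e (2 * p) a d) =
      (-∑ i ∈ range p, oddVal e a d i / hn e (2 * i + 1) a d * F (g * pol e (2 * i + 1) a d) -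
        T 1 / z) / oddVal e a d p := by
  have hh : ∀ l, hn e l a d ≠ 0 := fun l => (hn_pos h l).ne'
  have hl : ∀ l, lead e d l ≠ 0 := fun l => (lead_neg h l).ne
  have ho : ∀ i, oddVal e a d i ≠ 0 := fun i => (oddVal_pos h i).ne'
  -- `oddVal` is the integrating factor: after multiplication by it, the recursion for the boundary
  -- term becomes a telescoping sum.
  rw [eq_div_iff (ho p)]
  induction p with
  | zero =>
    have h1 := hh 0
    have h2 := hl 0
    simp only [mul_zero, oddVal_zero, range_zero, sum_empty, neg_zero, zero_sub, pol]
    rw [show hn e 0 a d = 1 from rfl]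
    field_simp
  | succ p ih =>
    rw [sum_range_succ, neg_add, add_sub_right_comm, ← ih, oddVal_succ,
      show 2 * (p + 1) = 2 * p + 2 by ring]
    have h1 := hT (pol e (2 * p + 1) a d)
    rw [form_opr_pol_succ h] at h1
    have h2 : lead e d (2 * p + 1) * T (pol e (2 * p + 2) a d) =
      -2 * z * F (g * pol e (2 * p + 1) a d) + lead e d (2 * p) * hn e (2 * p + 1) a d /
        hn e (2 * p) a d * T (pol e (2 * p) a d) := by linarith
    have e0 := hh (2 * p)
    have e1 := hh (2 * p + 1)
    have e2 := hh (2 * p + 2)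
    have l2 := hl (2 * p + 2)
    have h3 : lead e d (2 * p + 2) / (2 * z * hn e (2 * p + 2) a d) * T (pol e (2 * p + 2) a d) *
        (oddVal e a d p * (lead e d (2 * p + 1) * hn e (2 * p + 2) a d /
          (lead e d (2 * p + 2) * hn e (2 * p + 1) a d))) =
        (lead e d (2 * p + 1) * T (pol e (2 * p + 2) a d)) * oddVal e a d p /
          (2 * z * hn e (2 * p + 1) a d) := by
      field_simp
    rw [h3, h2]
    field_simp
    ring

/-- Replacing `w` by `x ^ k w` multiplies `σ w²` by `x ^ (2k)`, which accounts for the shift by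
`2k`. So a form remains an inverted form after both arguments are multiplied by `x ^ k`. -/
lemma opr_X_pow_mul (k : ℕ) (g : ℝ[X]) :
    opr e a d (1 / 2) (X ^ k * g) = X ^ k * opr e (a + 2 * k) (d + e * (2 * k)) (1 / 2) g := by
  have hk : sig e * derivative (X ^ k : ℝ[X]) = X ^ k * (C (k : ℝ) * (1 - C e * X)) := by
    cases k with
    | zero => simp
    | succ k => rw [derivative_X_pow, sig]; push_cast; simp; ring
  have h2 : (C (1 / 2 : ℝ) : ℝ[X]) * C 2 = 1 := by rw [← C_mul, ← C_1]; norm_num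
  have hk' : (C (k : ℝ) : ℝ[X]) = k := by simp
  rw [opr, opr, derivative_mul, mul_add, ← mul_assoc, hk, tau, tau]
  simp only [map_add, map_mul]
  linear_combination -(X ^ k * g * C (k : ℝ) * (1 - C e * X)) * h2

/-- The constants `∏ t < i, (d + 2 e t) / (a + 1 + 2 t)`. -/
noncomputable def rho (e a d : ℝ) (i : ℕ) : ℝ := ∏ t ∈ range i, (d + 2 * e * t) / (a + 1 + 2 * t)

lemma rho_succ (i : ℕ) : rho e a d (i + 1) =
    rho e a d i * ((d + 2 * e * i) / (a + 1 + 2 * i)) := by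
  rw [rho, prod_range_succ, ← rho]

lemma rho_pos (h : Adm e a d) (i : ℕ) : 0 < rho e a d i := by
  refine prod_pos fun t _ => div_pos ?_ ?_
  · have := h.den_pos (2 * t); push_cast at this; linarith
  · have : (0 : ℝ) ≤ t := Nat.cast_nonneg t
    linarith [h.a_gt]

lemma opr_X_pow (i : ℕ) : opr e a d (1 / 2) (X ^ i) =
    C ((a + 1 + 2 * i) / 2) * X ^ i - C ((d + 2 * e * i) / 2) * X ^ (i + 1) := by
  have hX : X * derivative (X ^ i : ℝ[X]) = C (i : ℝ) * X ^ i := by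
    cases i with
    | zero => simp
    | succ i => rw [derivative_X_pow]; push_cast; simp; ring
  have h2 : (C (1 / 2 : ℝ) : ℝ[X]) * C 2 = 1 := by rw [← C_mul, ← C_1]; norm_num
  rw [opr, sig, tau, mul_right_comm, hX]
  rw [div_eq_mul_one_div (a + 1 + 2 * (i : ℝ)), div_eq_mul_one_div (d + 2 * e * (i : ℝ))]
  simp only [map_add, map_mul]
  linear_combination (- C (i : ℝ) * X ^ i + C (i : ℝ) * C e * X ^ (i + 1)) * h2

/-- `1` and `x ^ k` agree up to a factor and the image of the operator. -/
lemma one_eq_rho (h : Adm e a d) (k : ℕ) : (1 : ℝ[X]) = C (rho e a d k) * X ^ k +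
    ∑ i ∈ range k, C (2 * rho e a d i / (a + 1 + 2 * i)) * opr e a d (1 / 2) (X ^ i) := by
  induction k with
  | zero => simp [rho]
  | succ k ih =>
    have hk : (a + 1 + 2 * k) ≠ 0 := by
      have : (0 : ℝ) ≤ k := Nat.cast_nonneg k
      linarith [h.a_gt]
    -- The image of `X ^ k` is a combination of `X ^ k` and `X ^ (k + 1)` only, so it trades one
    -- power for the next.
    rw [sum_range_succ, opr_X_pow, mul_sub, ← mul_assoc, ← mul_assoc, ← C_mul, ← C_mul]
    have h1 : 2 * rho e a d k / (a + 1 + 2 * k) * ((a + 1 + 2 * k) / 2) = rho e a d k := by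
      field_simp
    have h2 : 2 * rho e a d k / (a + 1 + 2 * k) * ((d + 2 * e * k) / 2) = rho e a d (k + 1) := by
      rw [rho_succ]; field_simp
    rw [h1, h2]
    nth_rewrite 1 [ih]
    ring

end SkewForms

end ClassicalEnsemble

/-! ### Analysis of weights satisfying a Pearson equation. -/

namespace ClassicalEnsemble

section PearsonWeights

open Polynomial Finset

variable {μ : Measure ℝ} {u u' v v' : ℝ → ℝ}

lemma integrable_skewPair (hu : Integrable u μ) (hv : Integrable v μ) :
    Integrable (fun z : ℝ × ℝ => sgn (z.2 - z.1) * (u z.1 * v z.2)) (μ.prod μ) :=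
  (hu.mul_prod hv).bdd_mul
    (measurable_sgn.comp (measurable_snd.sub measurable_fst)).aestronglyMeasurable
    (Filter.Eventually.of_forall fun _ => abs_sgn_le _)

lemma skewPair_smul_left (c : ℝ) : skewPair μ (fun x => c * u x) v = c * skewPair μ u v := by
  rw [skewPair, skewPair, ← integral_const_mul]
  congr 1; ext z; ring

lemma skewPair_congr (hu : u =ᵐ[μ] u') (hv : v =ᵐ[μ] v') : skewPair μ u v = skewPair μ u' v' := by
  refine integral_congr_ae ?_
  have h1 := Measure.quasiMeasurePreserving_fst (μ := μ) (ν := μ) |>.ae_eq_comp hu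
  have h2 := Measure.quasiMeasurePreserving_snd (μ := μ) (ν := μ) |>.ae_eq_comp hv
  filter_upwards [h1, h2] with z hz1 hz2
  simp only [Function.comp_apply] at hz1 hz2
  rw [hz1, hz2]

lemma skewPair_add_left (hu : Integrable u μ) (hu' : Integrable u' μ) (hv : Integrable v μ) :
    skewPair μ (fun x => u x + u' x) v = skewPair μ u v + skewPair μ u' v := by
  rw [skewPair, skewPair, skewPair, ← integral_add (integrable_skewPair hu hv)
    (integrable_skewPair hu' hv)]
  congr 1; ext z; ring

variable [SigmaFinite μ]

lemma skewPair_add_right (hu : Integrable u μ) (hv : Integrable v μ) (hv' : Integrable v' μ) :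
    skewPair μ u (fun x => v x + v' x) = skewPair μ u v + skewPair μ u v' := by
  rw [skewPair_antisymm, skewPair_add_left hv hv' hu, skewPair_antisymm u v,
    skewPair_antisymm u v']
  ring

lemma skewPair_smul_right (c : ℝ) : skewPair μ u (fun x => c * v x) = c * skewPair μ u v := by
  rw [skewPair_antisymm, skewPair_smul_left, skewPair_antisymm u v]
  ring

lemma skewPair_eq_integral (hu : Integrable u μ) (hv : Integrable v μ) :
    skewPair μ u v = ∫ x, u x * ∫ y, sgn (y - x) * v y ∂μ ∂μ := by
  rw [skewPair, integral_prod _ (integrable_skewPair hu hv)]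
  congr 1; ext x
  rw [← integral_const_mul]
  congr 1; ext y; ring

/-- The skew-symmetric form on polynomials with the weights `φ` and `ψ`. -/
noncomputable def skewForm (μ : Measure ℝ) [SigmaFinite μ] (φ ψ : ℝ → ℝ)
    (hφ : ∀ q : ℝ[X], Integrable (fun x => q.eval x * φ x) μ)
    (hψ : ∀ q : ℝ[X], Integrable (fun x => q.eval x * ψ x) μ) : ℝ[X] →ₗ[ℝ] ℝ[X] →ₗ[ℝ] ℝ :=
  LinearMap.mk₂ ℝ
    (fun f g => skewPair μ (fun x => f.eval x * φ x) (fun x => g.eval x * ψ x))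
    (fun f f' g => by
      rw [← skewPair_add_left (hφ f) (hφ f') (hψ g)]
      congr 1; ext x; rw [eval_add]; ring)
    (fun c f g => by
      rw [smul_eq_mul, ← skewPair_smul_left]
      congr 1; ext x; rw [eval_smul, smul_eq_mul]; ring)
    (fun f g g' => by
      rw [← skewPair_add_right (hφ f) (hψ g) (hψ g')]
      congr 1; ext x; rw [eval_add]; ring)
    (fun c f g => by
      rw [smul_eq_mul, ← skewPair_smul_right]
      congr 1; ext x; rw [eval_smul, smul_eq_mul]; ring)

/-- A weight `w` on `J` such that `(σ w)' = (τ / 2) w` and `σ w` vanishes at the boundary of `J`,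
in integrated form. -/
structure PearsonWeight (e a d : ℝ) (J : Set ℝ) (w : ℝ → ℝ) : Prop where
  adm : Adm e a d
  meas : MeasurableSet J
  vol_pos : 0 < volume J
  pos : ∀ x ∈ J, 0 < w x
  sig_pos : ∀ x ∈ J, 0 < (sig e).eval x
  int : ∀ q : ℝ[X], IntegrableOn (fun x => q.eval x * w x) J
  stokes : ∀ g : ℝ[X], ∀ x ∈ J, ∫ y in J, sgn (y - x) * ((opr e a d (1 / 2) g).eval y * w y) =
    -2 * (g.eval x * ((sig e).eval x * w x))

namespace PearsonWeight

variable {e a d : ℝ} {J : Set ℝ} {w : ℝ → ℝ}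

/-- By the Stokes property, `g σ w` is up to a constant the inner integral of the skew pairing.
Fubini therefore yields integrability without any bound on `σ w`. -/
lemma integrable_mul_sq (W : PearsonWeight e a d J w) {φ : ℝ → ℝ} (hφ : IntegrableOn φ J)
    (g : ℝ[X]) : IntegrableOn (fun x => φ x * (g.eval x * ((sig e).eval x * w x))) J := by
  have h1 := (integrable_skewPair hφ (W.int (opr e a d (1 / 2) g))).integral_prod_left
  refine (h1.const_mul (-1 / 2)).congr ?_
  filter_upwards [ae_restrict_mem W.meas] with x hx
  have h2 := W.stokes g x hx
  have h3 : ∫ y in J, sgn (y - x) * (φ x * ((opr e a d (1 / 2) g).eval y * w y)) =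
      φ x * ∫ y in J, sgn (y - x) * ((opr e a d (1 / 2) g).eval y * w y) := by
    rw [← integral_const_mul]; congr 1; ext y; ring
  rw [h3, h2]
  ring

lemma skewPair_opr (W : PearsonWeight e a d J w) {φ : ℝ → ℝ} (hφ : IntegrableOn φ J)
    (g : ℝ[X]) : skewPair (volume.restrict J) φ (fun y => (opr e a d (1 / 2) g).eval y * w y) =
      -2 * ∫ x in J, φ x * (g.eval x * ((sig e).eval x * w x)) := by
  rw [skewPair_eq_integral hφ (W.int _), ← integral_const_mul]
  refine setIntegral_congr_fun W.meas fun x hx => ?_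
  rw [W.stokes g x hx]
  ring

/-- The total mass of `σ w ^ 2`. -/
noncomputable def mass (_ : PearsonWeight e a d J w) : ℝ :=
  ∫ x in J, (sig e).eval x * w x ^ 2

/-- The skew-symmetric form of a Pearson weight. -/
noncomputable def form (W : PearsonWeight e a d J w) : ℝ[X] →ₗ[ℝ] ℝ[X] →ₗ[ℝ] ℝ :=
  skewForm (volume.restrict J) w w W.int W.int

lemma form_apply (W : PearsonWeight e a d J w) (f g : ℝ[X]) : W.form f g =
    skewPair (volume.restrict J) (fun x => f.eval x * w x) (fun x => g.eval x * w x) := rfl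

lemma form_antisymm (W : PearsonWeight e a d J w) (f g : ℝ[X]) : W.form g f = -W.form f g := by
  rw [form_apply, form_apply, skewPair_antisymm]

lemma form_opr (W : PearsonWeight e a d J w) (f g : ℝ[X]) :
    W.form f (opr e a d (1 / 2) g) = -2 * ∫ x in J, (f * g).eval x * ((sig e).eval x * w x ^ 2) := by
  rw [form_apply, W.skewPair_opr (W.int f)]
  congr 2; ext x; rw [eval_mul]; ring

lemma integrable_sq (W : PearsonWeight e a d J w) (q : ℝ[X]) :
    IntegrableOn (fun x => q.eval x * ((sig e).eval x * w x ^ 2)) J := by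
  refine (W.integrable_mul_sq (W.int q) 1).congr (Filter.Eventually.of_forall fun x => ?_)
  simp only [eval_one]
  ring

/-- The integral against `σ w²` satisfies the Stokes identity of `mom`, and this identity determines
all moments up to the total mass. The identity is obtained from the antisymmetry of the skew form,
evaluated on two images of the operator. -/
lemma integral_eq_mom (W : PearsonWeight e a d J w) (q : ℝ[X]) :
    ∫ x in J, q.eval x * ((sig e).eval x * w x ^ 2) = W.mass * mom e a d q := by
  let L : ℝ[X] →ₗ[ℝ] ℝ := (-1 / 2 : ℝ) • W.form.flip (opr e a d (1 / 2) 1)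
  have hL : ∀ f g, L (f * g) = -1 / 2 * W.form f (opr e a d (1 / 2) g) := by
    intro f g
    simp only [L, LinearMap.smul_apply, LinearMap.flip_apply, smul_eq_mul]
    rw [W.form_opr, W.form_opr, mul_one]
  have hL1 : ∀ f, L f = ∫ x in J, f.eval x * ((sig e).eval x * w x ^ 2) := by
    intro f
    have := hL f 1
    rw [mul_one] at this
    rw [this, W.form_opr, mul_one]
    ring
  have hst : ∀ g, L (sig e * derivative g + tau a d * g) = 0 := by
    intro g
    have h1 : sig e * derivative g + tau a d * g =
        opr e a d (1 / 2) 1 * g + opr e a d (1 / 2) g * 1 := by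
      have h2 : (C (1 / 2 : ℝ) : ℝ[X]) + C (1 / 2) = 1 := by rw [← C_add, ← C_1]; norm_num
      rw [opr, opr, derivative_one]
      linear_combination -(tau a d * g) * h2
    rw [h1, map_add, hL, hL, W.form_antisymm (opr e a d (1 / 2) g)]
    ring
  have hpow : ∀ i, L (X ^ i) = W.mass * mu e a d i := by
    intro i
    induction i with
    | zero =>
      rw [pow_zero, mu_zero, mul_one, hL1, mass]
      simp
    | succ i ih =>
      have h1 := hst (X ^ i)
      have h2 : sig e * derivative (X ^ i : ℝ[X]) + tau a d * X ^ i =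
          (a + 1 + i : ℝ) • (X ^ i : ℝ[X]) - (d + e * i : ℝ) • (X ^ (i + 1) : ℝ[X]) := by
        have hX : X * derivative (X ^ i : ℝ[X]) = C (i : ℝ) * X ^ i := by
          cases i with
          | zero => simp
          | succ i => rw [derivative_X_pow]; push_cast; simp; ring
        rw [sig, mul_right_comm, hX, tau, smul_eq_C_mul, smul_eq_C_mul]
        simp only [map_add, map_mul]
        ring
      rw [h2, map_sub, map_smul, map_smul, smul_eq_mul, smul_eq_mul, ih] at h1
      have h3 := (W.adm.den_pos i).ne'
      rw [mu_succ, ← mul_assoc, mul_div_assoc', eq_div_iff h3]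
      linarith
  have : L = W.mass • mom e a d := by
    refine Polynomial.lhom_ext' fun i => LinearMap.ext_ring ?_
    simp only [LinearMap.comp_apply, LinearMap.smul_apply, smul_eq_mul]
    rw [mom_monomial, mul_one, ← hpow, monomial_one_right_eq_X_pow]
  rw [← hL1, this, LinearMap.smul_apply, smul_eq_mul]

lemma mass_pos (W : PearsonWeight e a d J w) : 0 < W.mass := by
  have hint : IntegrableOn (fun x => (sig e).eval x * w x ^ 2) J := by
    simpa using W.integrable_sq 1
  have hpos : ∀ x ∈ J, 0 < (sig e).eval x * w x ^ 2 := fun x hx =>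
    mul_pos (W.sig_pos x hx) (pow_pos (W.pos x hx) 2)
  rw [mass, setIntegral_pos_iff_support_of_nonneg_ae]
  · refine lt_of_lt_of_le W.vol_pos (measure_mono fun x hx => ⟨(hpos x hx).ne', hx⟩)
  · filter_upwards [ae_restrict_mem W.meas] with x hx using (hpos x hx).le
  · exact hint

lemma invertedBy_form (W : PearsonWeight e a d J w) :
    InvertedBy e a d W.mass (mom e a d) W.form := by
  intro f g
  rw [W.form_opr, W.integral_eq_mom]
  ring

/-- Averages of linear statistics in the orthogonal ensemble of a Pearson weight. -/
theorem average_one (W : PearsonWeight e a d J w) {I : Set ℝ} (hI : MeasurableSet I)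
    (hIJ : (volume : Measure ℝ).restrict I = volume.restrict J) (hw : ∀ x ∈ I, 0 ≤ w x)
    (f : ℝ → ℝ) (hf : ∀ q : ℝ[X], IntegrableOn (fun x => q.eval x * (f x * w x)) J)
    (F : ℝ[X] →ₗ[ℝ] ℝ)
    (hF : ∀ q : ℝ[X], ∫ x in J, f x * (q.eval x * ((sig e).eval x * w x ^ 2)) = W.mass * F q)
    (p : ℕ) :
    BallisticCavity.AverageExists 1 w I (2 * (p + 1)) f ∧
    BallisticCavity.average 1 w I (2 * (p + 1)) f =
      ∑ l ∈ range (2 * p + 1), F (pol e l a d * pol e l a d) / hn e l a d +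
      (-∑ i ∈ range p, oddVal e a d i / hn e (2 * i + 1) a d *
          F (pol e (2 * p + 1) a d * pol e (2 * i + 1) a d) -
        skewPair (volume.restrict J) (fun x => (pol e (2 * p + 1) a d).eval x * (f x * w x)) w /
          W.mass) / oddVal e a d p := by
  have hz := W.mass_pos.ne'
  have hB := W.invertedBy_form
  -- `T` carries the statistic in its first argument only. The terms with `f` in the second argument
  -- follow from the antisymmetry of the pairing.
  let T := skewForm (volume.restrict J) (fun x => f x * w x) w hf W.int
  have hTa : ∀ q g, T q g = skewPair (volume.restrict J) (fun x => q.eval x * (f x * w x))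
    (fun x => g.eval x * w x) := fun _ _ => rfl
  have hT : InvertedBy e a d W.mass F T := by
    intro q g
    rw [hTa, W.skewPair_opr (hf q), mul_assoc, ← hF]
    congr 2; ext x; rw [eval_mul]; ring
  have hanti := fun f g => W.form_antisymm f g
  have hlead : ∀ l, lead e d l ≠ 0 := fun l => (lead_neg W.adm l).ne
  have key := average_one_eq w f hI (p + 1) (skewPol e a d) (skewPol_monic W.adm)
    (natDegree_skewPol W.adm) hw (fun q => by rw [IntegrableOn, hIJ]; exact W.int q)
    (fun q => by
      rw [IntegrableOn, hIJ]
      exact (hf q).congr (Filter.Eventually.of_forall fun x => by simp only; ring))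
    (fun i j => by
      rw [hIJ, skewPol_even, skewPol_even]
      exact form_even_even W.adm hanti hB i j)
    (fun i j => by
      rw [hIJ, ← W.form_apply, skewPol_odd, skewPol_odd, map_C_mul, map_C_mul,
        LinearMap.smul_apply, form_opr_opr W.adm hB, smul_zero, smul_zero])
    (fun i j hij => by
      rw [hIJ, ← W.form_apply, skewPol_even, skewPol_odd, map_C_mul, form_even_opr W.adm hB,
        if_neg hij, smul_zero])
    (fun i => by
      rw [hIJ, ← W.form_apply, skewPol_even, skewPol_odd, map_C_mul, form_even_opr W.adm hB,
        if_pos rfl, smul_eq_mul]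
      exact mul_ne_zero (one_div_ne_zero (hlead _))
        (mul_ne_zero (mul_ne_zero (by norm_num) hz) (hn_pos W.adm _).ne'))
  refine ⟨key.1, ?_⟩
  rw [key.2, hIJ]
  have hb := boundary_form_eq (T := T (pol e (2 * p + 1) a d)) (F := F)
    (g := pol e (2 * p + 1) a d) W.adm hz (fun g => hT _ g) p
  have hT1 : T (pol e (2 * p + 1) a d) 1 = skewPair (volume.restrict J)
      (fun x => (pol e (2 * p + 1) a d).eval x * (f x * w x)) w := by
    rw [hTa]
    congr 1; ext x; simp
  rw [← hT1, ← hb, ← sum_form_eq W.adm hz hT p]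
  refine sum_congr rfl fun i _ => ?_
  have h1 : ∀ q g : ℝ[X], skewPair (volume.restrict J) (fun x => f x * (q.eval x * w x))
      (fun x => g.eval x * w x) = T q g := by
    intro q g
    rw [hTa]
    congr 1; ext x; ring
  have h2 : ∀ q g : ℝ[X], skewPair (volume.restrict J) (fun x => q.eval x * w x)
      (fun x => f x * (g.eval x * w x)) = -T g q := by
    intro q g
    rw [skewPair_antisymm, h1]
  rw [h1, h2, ← W.form_apply, skewPol_even, skewPol_odd, map_C_mul, map_C_mul, map_C_mul,
    form_even_opr W.adm hB, if_pos rfl, LinearMap.smul_apply, ← sub_eq_add_neg,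
    smul_eq_mul, smul_eq_mul, smul_eq_mul, ← mul_sub, mul_div_mul_left]
  exact one_div_ne_zero (hlead _)

/-- Averages of linear statistics in the unitary ensemble with weight `σ w ^ 2`. -/
theorem average_two (W : PearsonWeight e a d J w) {I : Set ℝ} {w₂ : ℝ → ℝ}
    (hIJ : (volume : Measure ℝ).restrict I = volume.restrict J)
    (hw : ∀ x ∈ J, w₂ x = (sig e).eval x * w x ^ 2)
    (f : ℝ → ℝ) (hf : ∀ q : ℝ[X], IntegrableOn (fun x => q.eval x * (f x * w x)) J)
    (F : ℝ[X] →ₗ[ℝ] ℝ)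
    (hF : ∀ q : ℝ[X], ∫ x in J, f x * (q.eval x * ((sig e).eval x * w x ^ 2)) = W.mass * F q)
    (N : ℕ) :
    BallisticCavity.average 2 w₂ I N f =
      ∑ l ∈ range N, F (pol e l a d * pol e l a d) / hn e l a d := by
  have hz := W.mass_pos.ne'
  have hi : ∀ q : ℝ[X], ∫ x in I, q.eval x * w₂ x = W.mass * mom e a d q := by
    intro q
    rw [hIJ, ← W.integral_eq_mom]
    exact setIntegral_congr_fun W.meas fun x hx => by simp only [hw x hx]
  rw [average_two_eq w₂ f I N (fun l => pol e l a d) (pol_monic W.adm) (natDegree_pol W.adm)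
    (fun l => W.mass * hn e l a d) (fun l => mul_ne_zero hz (hn_pos W.adm l).ne')]
  · refine sum_congr rfl fun l _ => ?_
    rw [hIJ]
    have : ∫ x in J, f x * ((pol e l a d * pol e l a d).eval x * w₂ x) =
        W.mass * F (pol e l a d * pol e l a d) := by
      rw [← hF]
      exact setIntegral_congr_fun W.meas fun x hx => by simp only [hw x hx]
    rw [this, mul_div_mul_left _ _ hz]
  · intro q
    rw [IntegrableOn, hIJ]
    refine (W.integrable_sq q).congr ?_
    filter_upwards [ae_restrict_mem W.meas] with x hx
    rw [hw x hx]
  · intro q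
    rw [IntegrableOn, hIJ]
    refine (W.integrable_mul_sq (hf q) 1).congr ?_
    filter_upwards [ae_restrict_mem W.meas] with x hx
    rw [hw x hx, eval_one]
    ring
  · intro i j hij
    rw [hi, mom_pol_mul_pol_of_ne W.adm hij, mul_zero]
  · intro i
    rw [hi, mom_pol_mul_self W.adm]

end PearsonWeight

end PearsonWeights

end ClassicalEnsemble

/-! ### Jacobi and Laguerre weights satisfy the Pearson equation. -/

namespace ClassicalEnsemble

section ClassicalWeights

open Polynomial Set Filter Topology

/-- In the applications `h` is the value at `x` of a primitive of `G` that vanishes at both ends of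
`J`. -/
lemma integral_sgn_mul {J : Set ℝ} {G : ℝ → ℝ} {x h : ℝ} (hJ : MeasurableSet J)
    (hint : IntegrableOn G J) (hL : ∫ y in J ∩ Iic x, G y = h)
    (hR : ∫ y in J ∩ Ioi x, G y = -h) : ∫ y in J, sgn (y - x) * G y = -2 * h := by
  have hs : IntegrableOn (fun y => sgn (y - x) * G y) J :=
    hint.bdd_mul (measurable_sgn.comp (measurable_id.sub_const x)).aestronglyMeasurable
      (Eventually.of_forall fun _ => abs_sgn_le _)
  have hsplit : J = (J ∩ Iic x) ∪ (J ∩ Ioi x) := by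
    rw [← inter_union_distrib_left, Iic_union_Ioi, inter_univ]
  rw [hsplit, setIntegral_union (by
      rw [Set.disjoint_left]; rintro y ⟨-, h1⟩ ⟨-, h2⟩; exact absurd (Set.mem_Iic.1 h1) (not_le.2 (Set.mem_Ioi.1 h2)))
    (hJ.inter measurableSet_Ioi) (hs.mono_set inter_subset_left) (hs.mono_set inter_subset_left)]
  have h1 : ∫ y in J ∩ Iic x, sgn (y - x) * G y = ∫ y in J ∩ Iic x, -G y := by
    refine setIntegral_congr_ae (hJ.inter measurableSet_Iic) ?_
    have : ∀ᵐ y : ℝ, y ≠ x := by simp [ae_iff]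
    filter_upwards [this] with y hy hyx
    rw [sgn_of_neg (sub_neg.2 (lt_of_le_of_ne hyx.2 hy))]
    ring
  have h2 : ∫ y in J ∩ Ioi x, sgn (y - x) * G y = ∫ y in J ∩ Ioi x, G y := by
    refine setIntegral_congr_fun (hJ.inter measurableSet_Ioi) fun y hy => ?_
    rw [sgn_of_pos (sub_pos.2 hy.2), one_mul]
  rw [h1, h2, integral_neg, hL, hR]
  ring

lemma eval_sig (e x : ℝ) : (sig e).eval x = x * (1 - e * x) := by
  simp [sig]

lemma eval_opr (e a d : ℝ) (g : ℝ[X]) (x : ℝ) : (opr e a d (1 / 2) g).eval x =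
    x * (1 - e * x) * (derivative g).eval x + 1 / 2 * ((a + 1 - d * x) * g.eval x) := by
  simp [opr, eval_sig, tau]

/-- The Jacobi weight `x ^ ((a - 1) / 2) (1 - x) ^ ((b - 1) / 2)`. -/
noncomputable def jacobiWeight (a b x : ℝ) : ℝ := x ^ ((a - 1) / 2) * (1 - x) ^ ((b - 1) / 2)

/-- The function is the norm of the integrand of a convergent Beta integral. -/
lemma integrableOn_jacobi {α β : ℝ} (hα : -1 < α) (hβ : -1 < β) :
    IntegrableOn (fun x : ℝ => x ^ α * (1 - x) ^ β) (Ioo 0 1) := by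
  have h := (Complex.betaIntegral_convergent (u := ((α + 1 : ℝ) : ℂ)) (v := ((β + 1 : ℝ) : ℂ))
    (by rw [Complex.ofReal_re]; linarith) (by rw [Complex.ofReal_re]; linarith)).norm
  rw [intervalIntegrable_iff_integrableOn_Ioo_of_le zero_le_one] at h
  refine h.congr_fun (fun x hx => ?_) measurableSet_Ioo
  have h1 : (1 : ℂ) - (x : ℂ) = ((1 - x : ℝ) : ℂ) := by push_cast; ring
  simp only [norm_mul]
  rw [h1, Complex.norm_cpow_eq_rpow_re_of_pos hx.1,
    Complex.norm_cpow_eq_rpow_re_of_pos (sub_pos.2 hx.2)]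
  simp

lemma integrableOn_poly_mul_jacobi {α β : ℝ} (hα : -1 < α) (hβ : -1 < β) (q : ℝ[X]) :
    IntegrableOn (fun x : ℝ => q.eval x * (x ^ α * (1 - x) ^ β)) (Ioo 0 1) := by
  obtain ⟨c, hc⟩ := isCompact_Icc.exists_bound_of_continuousOn (s := Icc (0 : ℝ) 1)
    (f := fun x => q.eval x) q.continuous.continuousOn
  refine (integrableOn_jacobi hα hβ).bdd_mul (c := c) q.continuous.aestronglyMeasurable ?_
  filter_upwards [ae_restrict_mem measurableSet_Ioo] with x hx using hc x (Ioo_subset_Icc_self hx)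

/-- The differentiated function is `g σ w`, so this is the Pearson equation in differential form. -/
lemma jacobi_primitive {a b : ℝ} (g : ℝ[X]) {y : ℝ} (hy : y ∈ Ioo (0 : ℝ) 1) :
    HasDerivAt (fun y : ℝ => g.eval y * (y ^ ((a - 1) / 2 + 1) * (1 - y) ^ ((b - 1) / 2 + 1)))
      ((opr 1 a (a + b + 2) (1 / 2) g).eval y * jacobiWeight a b y) y := by
  have h0 : y ≠ 0 := hy.1.ne'
  have h1 : 1 - y ≠ 0 := (sub_pos.2 hy.2).ne'
  have hd1 := Real.hasDerivAt_rpow_const (p := (a - 1) / 2 + 1) (Or.inl h0)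
  have hd2 := (Real.hasDerivAt_rpow_const (p := (b - 1) / 2 + 1) (Or.inl h1)).comp y
    ((hasDerivAt_id y).const_sub 1)
  have hd3 := (g.hasDerivAt y).mul (hd1.mul hd2)
  refine hd3.congr_deriv ?_
  simp only [Pi.mul_apply, Function.comp_apply]
  rw [add_sub_cancel_right, add_sub_cancel_right, Real.rpow_add_one h0, Real.rpow_add_one h1,
    eval_opr, jacobiWeight]
  ring

/-- The Jacobi weights are Pearson weights. -/
lemma pearsonWeight_jacobi {a b : ℝ} (ha : -1 < a) (hb : -1 < b) :
    PearsonWeight 1 a (a + b + 2) (Ioo 0 1) (jacobiWeight a b) where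
  adm := ⟨zero_le_one, ha, by linarith, by linarith⟩
  meas := measurableSet_Ioo
  vol_pos := by simp
  pos := fun x hx => mul_pos (Real.rpow_pos_of_pos hx.1 _)
    (Real.rpow_pos_of_pos (sub_pos.2 hx.2) _)
  sig_pos := fun x hx => by
    rw [eval_sig, one_mul]; exact mul_pos hx.1 (sub_pos.2 hx.2)
  int := integrableOn_poly_mul_jacobi (by linarith) (by linarith)
  stokes := by
    intro g x hx
    -- The exponents are `(a + 1) / 2` and `(b + 1) / 2`, both positive, so `H` is continuous up to
    -- the endpoints and vanishes there.
    set H : ℝ → ℝ := fun y => g.eval y * (y ^ ((a - 1) / 2 + 1) * (1 - y) ^ ((b - 1) / 2 + 1))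
      with hH
    have hint : IntegrableOn
        (fun y => (opr 1 a (a + b + 2) (1 / 2) g).eval y * jacobiWeight a b y) (Ioo 0 1) :=
      integrableOn_poly_mul_jacobi (by linarith) (by linarith) _
    have hcont : Continuous H := by
      refine g.continuous.mul (Continuous.mul ?_ ?_)
      · exact Real.continuous_rpow_const (by linarith)
      · exact (Real.continuous_rpow_const (by linarith)).comp (continuous_const.sub continuous_id)
    have hH0 : H 0 = 0 := by
      simp only [hH]; rw [Real.zero_rpow (by linarith)]; ring
    have hH1 : H 1 = 0 := by
      simp only [hH]; rw [sub_self, Real.zero_rpow (x := (b - 1) / 2 + 1) (by linarith)]; ring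
    have hHx : H x = g.eval x * ((sig 1).eval x * jacobiWeight a b x) := by
      simp only [hH]
      rw [Real.rpow_add_one hx.1.ne', Real.rpow_add_one (sub_pos.2 hx.2).ne', eval_sig,
        jacobiWeight]
      ring
    rw [← hHx]
    refine integral_sgn_mul measurableSet_Ioo hint ?_ ?_
    · have hset : Ioo (0 : ℝ) 1 ∩ Iic x = Ioc 0 x := by
        ext y; simp only [mem_inter_iff, mem_Ioo, mem_Iic, mem_Ioc]
        exact ⟨fun h => ⟨h.1.1, h.2⟩, fun h => ⟨⟨h.1, h.2.trans_lt hx.2⟩, h.2⟩⟩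
      rw [hset, ← intervalIntegral.integral_of_le hx.1.le,
        intervalIntegral.integral_eq_sub_of_hasDerivAt_of_le hx.1.le hcont.continuousOn
          (fun y hy => jacobi_primitive g ⟨hy.1, hy.2.trans hx.2⟩), hH0, sub_zero]
      rw [intervalIntegrable_iff_integrableOn_Ioc_of_le hx.1.le, ← hset]
      exact hint.mono_set inter_subset_left
    · have hset : Ioo (0 : ℝ) 1 ∩ Ioi x = Ioo x 1 := by
        ext y; simp only [mem_inter_iff, mem_Ioo, mem_Ioi]
        exact ⟨fun h => ⟨h.2, h.1.2⟩, fun h => ⟨⟨hx.1.trans h.1, h.2⟩, h.1⟩⟩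
      rw [hset, ← integral_Ioc_eq_integral_Ioo, ← intervalIntegral.integral_of_le hx.2.le,
        intervalIntegral.integral_eq_sub_of_hasDerivAt_of_le hx.2.le hcont.continuousOn
          (fun y hy => jacobi_primitive g ⟨hx.1.trans hy.1, hy.2⟩), hH1, zero_sub]
      rw [intervalIntegrable_iff_integrableOn_Ioo_of_le hx.2.le, ← hset]
      exact hint.mono_set inter_subset_left

/-- The Laguerre weight `x ^ c exp (-r x / 2)`. -/
noncomputable def expWeight (c r x : ℝ) : ℝ := x ^ c * Real.exp (-r * x / 2)

lemma integrableOn_poly_mul_expWeight {c r : ℝ} (hc : -1 < c) (hr : 0 < r) (q : ℝ[X]) :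
    IntegrableOn (fun x : ℝ => q.eval x * expWeight c r x) (Ioi 0) := by
  induction q using Polynomial.induction_on' with
  | add p q hp hq =>
    refine (hp.add hq).congr (Eventually.of_forall fun x => ?_)
    simp [add_mul]
  | monomial i t =>
    have h := (integrableOn_rpow_mul_exp_neg_mul_rpow (s := c + i) (p := 1) (b := r / 2)
      (by have : (0 : ℝ) ≤ i := Nat.cast_nonneg i
          linarith) one_pos (by positivity)).const_mul t
    refine IntegrableOn.congr_fun h (fun x hx => ?_) measurableSet_Ioi
    simp only [eval_monomial, expWeight, Real.rpow_one]
    rw [Real.rpow_add_natCast (ne_of_gt hx)]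
    ring_nf

lemma expWeight_primitive {c r : ℝ} (g : ℝ[X]) {y : ℝ} (hy : 0 < y) :
    HasDerivAt (fun y : ℝ => g.eval y * (y ^ (c + 1) * Real.exp (-r * y / 2)))
      ((opr 0 (2 * c + 1) r (1 / 2) g).eval y * expWeight c r y) y := by
  have hd1 := Real.hasDerivAt_rpow_const (p := c + 1) (Or.inl hy.ne')
  have hd2 : HasDerivAt (fun y : ℝ => Real.exp (-r * y / 2))
      (Real.exp (-r * y / 2) * (-r * 1 / 2)) y :=
    (((hasDerivAt_id y).const_mul (-r)).div_const 2).exp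
  have hd3 := (g.hasDerivAt y).mul (hd1.mul hd2)
  refine hd3.congr_deriv ?_
  simp only [Pi.mul_apply]
  rw [add_sub_cancel_right, Real.rpow_add_one hy.ne', eval_opr, expWeight]
  ring

lemma tendsto_poly_mul_exp {c r : ℝ} (hr : 0 < r) (g : ℝ[X]) :
    Tendsto (fun y : ℝ => g.eval y * (y ^ c * Real.exp (-r * y / 2))) atTop (𝓝 0) := by
  induction g using Polynomial.induction_on' with
  | add p q hp hq =>
    refine Tendsto.congr (fun x => ?_) (by simpa using hp.add hq)
    simp [add_mul]
  | monomial i t =>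
    have h := (tendsto_rpow_mul_exp_neg_mul_atTop_nhds_zero (c + i) (r / 2)
      (by positivity)).const_mul t
    rw [mul_zero] at h
    refine h.congr' ?_
    filter_upwards [eventually_gt_atTop 0] with x hx
    simp only [eval_monomial]
    rw [Real.rpow_add_natCast hx.ne']
    ring_nf

/-- The Laguerre weights are Pearson weights. -/
lemma pearsonWeight_exp {c r : ℝ} (hc : -1 < c) (hr : 0 < r) :
    PearsonWeight 0 (2 * c + 1) r (Ioi 0) (expWeight c r) where
  adm := ⟨le_rfl, by linarith, hr, by linarith⟩
  meas := measurableSet_Ioi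
  vol_pos := by simp
  pos := fun x hx => mul_pos (Real.rpow_pos_of_pos hx _) (Real.exp_pos _)
  sig_pos := fun x hx => by
    rw [eval_sig, zero_mul, sub_zero, mul_one]; exact hx
  int := integrableOn_poly_mul_expWeight hc hr
  stokes := by
    intro g x hx
    have hx0 : 0 < x := hx
    -- Here `σ = x` and `σ w² = x ^ (2c + 1) exp(-r x)`, whence the parameters. `H` vanishes at `0`
    -- because `c + 1 > 0`, and it tends to `0` at infinity.
    set H : ℝ → ℝ := fun y => g.eval y * (y ^ (c + 1) * Real.exp (-r * y / 2)) with hH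
    have hint : IntegrableOn
        (fun y => (opr 0 (2 * c + 1) r (1 / 2) g).eval y * expWeight c r y) (Ioi 0) :=
      integrableOn_poly_mul_expWeight hc hr _
    have hcont : Continuous H := by
      refine g.continuous.mul (Continuous.mul ?_ (by fun_prop))
      exact Real.continuous_rpow_const (by linarith)
    have hH0 : H 0 = 0 := by
      simp only [hH]; rw [Real.zero_rpow (by linarith)]; ring
    have hHx : H x = g.eval x * ((sig 0).eval x * expWeight c r x) := by
      simp only [hH]
      rw [Real.rpow_add_one hx0.ne', eval_sig, expWeight]
      ring
    rw [← hHx]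
    refine integral_sgn_mul measurableSet_Ioi hint ?_ ?_
    · have hset : Ioi (0 : ℝ) ∩ Iic x = Ioc 0 x := rfl
      rw [hset, ← intervalIntegral.integral_of_le hx0.le,
        intervalIntegral.integral_eq_sub_of_hasDerivAt_of_le hx0.le hcont.continuousOn
          (fun y hy => expWeight_primitive g hy.1), hH0, sub_zero]
      rw [intervalIntegrable_iff_integrableOn_Ioc_of_le hx0.le, ← hset]
      exact hint.mono_set inter_subset_left
    · have hset : Ioi (0 : ℝ) ∩ Ioi x = Ioi x := by
        rw [Ioi_inter_Ioi, max_eq_right hx0.le]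
      rw [hset, integral_Ioi_of_hasDerivAt_of_tendsto hcont.continuousWithinAt
        (fun y hy => expWeight_primitive g (hx0.trans hy))
        (hint.mono_set (Ioi_subset_Ioi hx0.le)) (tendsto_poly_mul_exp hr g), zero_sub]

end ClassicalWeights

end ClassicalEnsemble

/-! ### The boundary pairing for weights shifted by powers of `x`. -/

namespace ClassicalEnsemble

section SkewForms

open Polynomial Finset

variable {e a d s z : ℝ} {B : ℝ[X] →ₗ[ℝ] ℝ[X] →ₗ[ℝ] ℝ}

lemma sum_range_two_mul_add_two {M : Type*} [AddCommMonoid M] (f : ℕ → M) (p : ℕ) :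
    ∑ l ∈ range (2 * p + 2), f l = ∑ i ∈ range (p + 1), (f (2 * i) + f (2 * i + 1)) := by
  induction p with
  | zero => simp [sum_range_succ]
  | succ p ih =>
    rw [sum_range_succ _ (p + 1), ← ih, show 2 * (p + 1) + 2 = 2 * p + 2 + 1 + 1 by ring,
      sum_range_succ, sum_range_succ, add_assoc, mul_add_one]

/-- Pairing of `1` with an odd orthogonal polynomial of a shifted weight. -/
lemma form_one_pol_shift (h : Adm e a d) (h' : Adm e (a + s) (d + e * s))
    (hz : ∀ f g, B g f = -B f g)
    (hB : InvertedBy e (a + s) (d + e * s) z (mom e (a + s) (d + e * s)) B) (p : ℕ) :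
    B 1 (pol e (2 * p + 1) a d) = z * ∑ i ∈ range (p + 1),
      conn e (2 * p + 1) (2 * i + 1) a d s * oddVal e (a + s) (d + e * s) i := by
  rw [pol_eq_sum_conn h h', show 2 * p + 1 + 1 = 2 * p + 2 by ring, sum_range_two_mul_add_two,
    map_sum, mul_sum]
  refine sum_congr rfl fun i _ => ?_
  rw [map_add, map_C_mul, map_C_mul, form_one_even h' hz hB, form_one_odd h' hB, smul_zero,
    zero_add, smul_eq_mul]
  ring

lemma form_opr_left (hz : ∀ f g, B g f = -B f g) (hB : InvertedBy e a d z (mom e a d) B)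
    (g f : ℝ[X]) : B (opr e a d (1 / 2) g) f = 2 * z * mom e a d (g * f) := by
  rw [hz, hB, mul_comm f]
  ring

/-- The pairing of `x ^ k P_{2p+1}` with `1`. -/
lemma form_X_pow_mul_pol_one (h : Adm e a d) (hz : ∀ f g, B g f = -B f g)
    (hB : InvertedBy e a d z (mom e a d) B) (k p : ℕ) :
    -B (X ^ k * pol e (2 * p + 1) a d) 1 =
      z * (rho e a d k * mu e a d (2 * k) * ∑ i ∈ range (p + 1),
        conn e (2 * p + 1) (2 * i + 1) a d (2 * k) * oddVal e (a + 2 * k) (d + e * (2 * k)) i +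
      ∑ i ∈ range k, 2 * rho e a d i / (a + 1 + 2 * i) *
        (2 * (mu e a d (i + k) * d0 e (2 * p + 1) a d (i + k)))) := by
  have h' : Adm e (a + 2 * k) (d + e * (2 * k)) := by
    have := h.shift_nat (2 * k); push_cast at this; exact this
  have hmom : ∀ i, mom e a d (X ^ i * (X ^ k * pol e (2 * p + 1) a d)) =
      mu e a d (i + k) * d0 e (2 * p + 1) a d (i + k) := by
    intro i
    have h1 := h.shift_nat (i + k)
    rw [← mul_assoc, ← pow_add, mom_X_pow_mul]
    push_cast at h1 ⊢
    rw [mom_pol_shift h h1]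
  let B₂ : ℝ[X] →ₗ[ℝ] ℝ[X] →ₗ[ℝ] ℝ := B.compl₁₂ (LinearMap.mulLeft ℝ (X ^ k))
    (LinearMap.mulLeft ℝ (X ^ k))
  have hB₂ : ∀ f g, B₂ f g = B (X ^ k * f) (X ^ k * g) := fun f g => rfl
  have hinv : InvertedBy e (a + 2 * k) (d + e * (2 * k)) (z * mu e a d (2 * k))
      (mom e (a + 2 * k) (d + e * (2 * k))) B₂ := by
    intro f g
    rw [hB₂, ← opr_X_pow_mul, hB,
      show X ^ k * f * (X ^ k * g) = X ^ (2 * k) * (f * g) by ring, mom_X_pow_mul]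
    push_cast
    ring
  have h2 := form_one_pol_shift (B := B₂) h h' (fun f g => hz _ _) hinv p
  rw [hB₂, mul_one] at h2
  -- The multiple of `X ^ k` puts a common power into both arguments, which is the form `B₂` with
  -- shifted parameters. The images of the operator are evaluated by inversion.
  rw [← hz, one_eq_rho h k]
  simp only [map_add, map_sum, LinearMap.add_apply, LinearMap.coe_sum, Finset.sum_apply,
    map_C_mul, LinearMap.smul_apply, smul_eq_mul, h2, form_opr_left hz hB, hmom]
  rw [mul_add, mul_sum (range k)]
  congr 1
  · ring
  · refine sum_congr rfl fun i _ => ?_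
    ring

/-- The pairing of `P_{2p+1}` with `x ^ k` for a shifted weight. -/
lemma form_pol_X_pow (h : Adm e a d) (k : ℕ)
    (h' : Adm e (a + s) (d + e * s)) (hz : ∀ f g, B g f = -B f g)
    (hB : InvertedBy e (a + s) (d + e * s) z (mom e (a + s) (d + e * s)) B) (p : ℕ) :
    rho e (a + s) (d + e * s) k * -B (pol e (2 * p + 1) a d) (X ^ k) =
      z * (∑ i ∈ range (p + 1),
        conn e (2 * p + 1) (2 * i + 1) a d s * oddVal e (a + s) (d + e * s) i -
      ∑ i ∈ range k, 2 * rho e (a + s) (d + e * s) i / (a + s + 1 + 2 * i) *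
        (2 * (mu e (a + s) (d + e * s) i * d0 e (2 * p + 1) a d (s + i)))) := by
  have hmom : ∀ i : ℕ, mom e (a + s) (d + e * s) (X ^ i * pol e (2 * p + 1) a d) =
      mu e (a + s) (d + e * s) i * d0 e (2 * p + 1) a d (s + i) := by
    intro i
    have h1 := h'.shift_nat i
    rw [mom_X_pow_mul, add_assoc a, add_assoc d, ← mul_add]
    rw [add_assoc a, add_assoc d, ← mul_add] at h1
    rw [mom_pol_shift h h1]
  have h2 := form_one_pol_shift h h' hz hB p
  -- Now the relation is read backwards: the pairing with `1` is known for the shifted form, and the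
  -- pairing with `X ^ k` is solved for.
  rw [one_eq_rho h' k] at h2
  simp only [map_add, map_sum, LinearMap.add_apply, LinearMap.coe_sum, Finset.sum_apply,
    map_C_mul, LinearMap.smul_apply, smul_eq_mul, form_opr_left hz hB, hmom] at h2
  rw [← hz, mul_sub, ← h2, mul_sum (range k), add_sub_assoc, ← sum_sub_distrib,
    sum_eq_zero fun i _ => by ring, add_zero]

end SkewForms

end ClassicalEnsemble

/-! ### Moments of the ensembles as finite sums of connection coefficients. -/

namespace ClassicalEnsemble

section ClassicalAverages

open Polynomial Set Finset

lemma sq_rpow_half_mul {x c : ℝ} (hx : 0 < x) : x * (x ^ ((c - 1) / 2)) ^ 2 = x ^ c := by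
  rw [← Real.rpow_mul_natCast hx.le, mul_comm, ← Real.rpow_add_one hx.ne']
  congr 1
  push_cast
  ring

lemma restrict_Icc_eq_restrict_Ioo (x y : ℝ) :
    (volume : Measure ℝ).restrict (Icc x y) = volume.restrict (Ioo x y) :=
  Measure.restrict_congr_set Ioo_ae_eq_Icc.symm

lemma integrableOn_poly_mul_pow_mul_jacobi {a b : ℝ} (ha : -1 < a) (hb : -1 < b) (k : ℕ) (q : ℝ[X]) :
    IntegrableOn (fun x => q.eval x * (x ^ k * jacobiWeight a b x)) (Ioo 0 1) := by
  refine ((pearsonWeight_jacobi ha hb).int (q * X ^ k)).congr (Filter.Eventually.of_forall fun x => ?_)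
  simp only [eval_mul, eval_pow, eval_X]
  ring

lemma integral_pow_mul_jacobi {a b : ℝ} (ha : -1 < a) (hb : -1 < b) (k : ℕ) (q : ℝ[X]) :
    ∫ x in Ioo (0 : ℝ) 1, x ^ k * (q.eval x * ((sig 1).eval x * jacobiWeight a b x ^ 2)) =
      (pearsonWeight_jacobi ha hb).mass *
        (mom 1 a (a + b + 2) ∘ₗ LinearMap.mulLeft ℝ (X ^ k)) q := by
  rw [LinearMap.comp_apply, LinearMap.mulLeft_apply, ← PearsonWeight.integral_eq_mom]
  congr 1; ext x
  simp only [eval_mul, eval_pow, eval_X]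
  ring

/-- Moments of the Jacobi orthogonal ensemble. -/
lemma average_one_jacobi {a b d : ℝ} (ha : -1 < a) (hb : -1 < b) (hd : a + b + 2 = d) (k p : ℕ) :
    BallisticCavity.AverageExists 1 (jacobiWeight a b) (Icc 0 1) (2 * (p + 1)) (fun x => x ^ k) ∧
    BallisticCavity.average 1 (jacobiWeight a b) (Icc 0 1) (2 * (p + 1)) (fun x => x ^ k) =
      ∑ l ∈ range (2 * p + 1), mom 1 a d (X ^ k * (pol 1 l a d * pol 1 l a d)) / hn 1 l a d +
      (-∑ i ∈ range p, oddVal 1 a d i / hn 1 (2 * i + 1) a d * (mu 1 a d k *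
        ∑ q ∈ range (2 * i + 2), conn 1 (2 * i + 1) q a d k * conn 1 (2 * p + 1) q a d k *
          hn 1 q (a + k) (d + k)) +
        (rho 1 a d k * mu 1 a d (2 * k) * ∑ i ∈ range (p + 1),
          conn 1 (2 * p + 1) (2 * i + 1) a d (2 * k) * oddVal 1 (a + 2 * k) (d + 2 * k) i +
        ∑ i ∈ range k, 2 * rho 1 a d i / (a + 1 + 2 * i) *
          (2 * (mu 1 a d (i + k) * d0 1 (2 * p + 1) a d (i + k))))) / oddVal 1 a d p := by
  subst hd
  have W := pearsonWeight_jacobi ha hb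
  obtain ⟨h1, h2⟩ := W.average_one (I := Icc 0 1) measurableSet_Icc
    (restrict_Icc_eq_restrict_Ioo 0 1)
    (fun x hx => mul_nonneg (Real.rpow_nonneg hx.1 _) (Real.rpow_nonneg (sub_nonneg.2 hx.2) _))
    (fun x => x ^ k) (integrableOn_poly_mul_pow_mul_jacobi ha hb k)
    (mom 1 a (a + b + 2) ∘ₗ LinearMap.mulLeft ℝ (X ^ k)) (integral_pow_mul_jacobi ha hb k) p
  refine ⟨h1, h2.trans ?_⟩
  have h3 := form_X_pow_mul_pol_one W.adm W.form_antisymm W.invertedBy_form k p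
  have h4 : skewPair (volume.restrict (Ioo 0 1)) (fun x => (pol 1 (2 * p + 1) a (a + b + 2)).eval x *
      (x ^ k * jacobiWeight a b x)) (jacobiWeight a b) =
      W.form (X ^ k * pol 1 (2 * p + 1) a (a + b + 2)) 1 := by
    rw [W.form_apply]
    congr 1
    · ext x; simp only [eval_mul, eval_pow, eval_X]; ring
    · ext x; simp
  rw [h4, sub_eq_add_neg, ← neg_div, h3, mul_div_cancel_left₀ _ W.mass_pos.ne']
  simp only [LinearMap.comp_apply, LinearMap.mulLeft_apply, one_mul]
  have h5 : ∀ i ∈ range p, mom 1 a (a + b + 2) (X ^ k * (pol 1 (2 * p + 1) a (a + b + 2) *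
      pol 1 (2 * i + 1) a (a + b + 2))) = mu 1 a (a + b + 2) k * ∑ q ∈ range (2 * i + 2),
        conn 1 (2 * i + 1) q a (a + b + 2) k * conn 1 (2 * p + 1) q a (a + b + 2) k *
          hn 1 q (a + k) (a + b + 2 + k) := ?_
  · congr 4
    exact sum_congr rfl fun i hi => by rw [h5 i hi]
  intro i hi
  rw [mom_X_pow_mul, mul_comm (pol 1 (2 * p + 1) _ _), mom_pol_mul_pol W.adm (W.adm.shift_nat k)
    (by have := Finset.mem_range.1 hi; omega)]
  simp only [one_mul]

/-- Moments of the Jacobi unitary ensemble. -/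
lemma average_two_jacobi {a b d : ℝ} (ha : -1 < a) (hb : -1 < b) (hd : a + b + 2 = d) (k N : ℕ) :
    BallisticCavity.average 2 (fun x => x ^ a * (1 - x) ^ b) (Icc 0 1) N (fun x => x ^ k) =
      ∑ l ∈ range N, mom 1 a d (X ^ k * (pol 1 l a d * pol 1 l a d)) / hn 1 l a d := by
  subst hd
  refine (pearsonWeight_jacobi ha hb).average_two (restrict_Icc_eq_restrict_Ioo 0 1)
    (fun x hx => ?_) (fun x => x ^ k) (integrableOn_poly_mul_pow_mul_jacobi ha hb k)
    (mom 1 a (a + b + 2) ∘ₗ LinearMap.mulLeft ℝ (X ^ k)) (integral_pow_mul_jacobi ha hb k) N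
  rw [eval_sig, jacobiWeight, mul_pow, ← sq_rpow_half_mul hx.1,
    ← sq_rpow_half_mul (sub_pos.2 hx.2)]
  ring

section Exponential

variable {a c r s : ℝ} {k : ℕ}

lemma expWeight_eq_pow_mul {x : ℝ} (hx : 0 < x) :
    expWeight c r x = x ^ k * expWeight (c - k) r x := by
  rw [expWeight, expWeight, ← mul_assoc, mul_comm (x ^ k), ← Real.rpow_add_natCast hx.ne',
    sub_add_cancel]

lemma inv_pow_mul_expWeight {x : ℝ} (hx : 0 < x) :
    x⁻¹ ^ k * expWeight c r x = expWeight (c - k) r x := by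
  rw [expWeight_eq_pow_mul (k := k) hx, ← mul_assoc, ← mul_pow, inv_mul_cancel₀ hx.ne', one_pow,
    one_mul]

lemma integrableOn_poly_mul_inv_pow_mul_expWeight (hc : -1 < c - k) (hr : 0 < r) (q : ℝ[X]) :
    IntegrableOn (fun x => q.eval x * (x⁻¹ ^ k * expWeight c r x)) (Ioi 0) :=
  ((pearsonWeight_exp hc hr).int q).congr_fun
    (fun x hx => by simp only [inv_pow_mul_expWeight (Set.mem_Ioi.1 hx)]) measurableSet_Ioi

lemma mass_expWeight (h0 : -1 < c) (hc : -1 < c - k) (hr : 0 < r) :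
    (pearsonWeight_exp h0 hr).mass =
      (pearsonWeight_exp hc hr).mass * mu 0 (2 * (c - k) + 1) r (2 * k) := by
  have h1 : mu 0 (2 * (c - k) + 1) r (2 * k) = mom 0 (2 * (c - k) + 1) r (X ^ (2 * k)) := by
    rw [← mul_one (X ^ (2 * k)), mom_X_pow_mul, mom_one, mul_one]
  rw [h1, ← PearsonWeight.integral_eq_mom, PearsonWeight.mass]
  refine setIntegral_congr_fun measurableSet_Ioi fun x hx => ?_
  simp only [eval_pow, eval_X, expWeight_eq_pow_mul (c := c) (k := k) (Set.mem_Ioi.1 hx)]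
  ring

/-- With `v = x⁻ᵏ w` one has `x⁻ᵏ σ w² = xᵏ σ v²`, so the negative moment is a positive one for the
weight `v`. The inverse of `mu` is the quotient of the two masses. -/
lemma integral_inv_pow_mul_expWeight (h0 : -1 < c) (hc : -1 < c - k) (hr : 0 < r) (q : ℝ[X]) :
    ∫ x in Ioi (0 : ℝ), x⁻¹ ^ k * (q.eval x * ((sig 0).eval x * expWeight c r x ^ 2)) =
      (pearsonWeight_exp h0 hr).mass * ((mu 0 (2 * (c - k) + 1) r (2 * k))⁻¹ •
        (mom 0 (2 * (c - k) + 1) r ∘ₗ LinearMap.mulLeft ℝ (X ^ k))) q := by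
  have h2 := (mu_pos (pearsonWeight_exp hc hr).adm (2 * k)).ne'
  rw [LinearMap.smul_apply, LinearMap.comp_apply, LinearMap.mulLeft_apply, smul_eq_mul,
    mass_expWeight h0 hc hr, mul_assoc, mul_inv_cancel_left₀ h2, ← PearsonWeight.integral_eq_mom]
  refine setIntegral_congr_fun measurableSet_Ioi fun x hx => ?_
  have h3 : x⁻¹ ^ k * (q.eval x * ((sig 0).eval x * expWeight c r x ^ 2)) =
    q.eval x * ((sig 0).eval x * ((x⁻¹ ^ k * expWeight c r x) * expWeight c r x)) := by ring
  simp only [eval_mul, eval_pow, eval_X]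
  rw [h3, inv_pow_mul_expWeight (Set.mem_Ioi.1 hx),
    expWeight_eq_pow_mul (c := c) (k := k) (Set.mem_Ioi.1 hx)]
  ring

lemma adm_zero_of_expWeight (hr : 0 < r) (ha : -1 < a) : Adm 0 a r :=
  ⟨le_rfl, ha, hr, by linarith⟩

/-- Negative moments of a squared Laguerre polynomial. -/
noncomputable def negDiag (a r : ℝ) (k l : ℕ) : ℝ :=
  mu 0 (a - 2 * k) r k / mu 0 (a - 2 * k) r (2 * k) *
    (∑ q ∈ range (l + 1), conn 0 l q a r (-k) * conn 0 l q a r (-k) * hn 0 q (a - k) r) / hn 0 l a r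

lemma mom_X_pow_mul_pol_mul_pol (hr : 0 < r) (ha : -1 < a - 2 * k) {M N : ℕ} (hMN : M ≤ N) :
    ((mu 0 (a - 2 * k) r (2 * k))⁻¹ • (mom 0 (a - 2 * k) r ∘ₗ LinearMap.mulLeft ℝ (X ^ k)))
      (pol 0 M a r * pol 0 N a r) =
    mu 0 (a - 2 * k) r k / mu 0 (a - 2 * k) r (2 * k) *
      ∑ q ∈ range (M + 1), conn 0 M q a r (-k) * conn 0 N q a r (-k) * hn 0 q (a - k) r := by
  have hk : (0 : ℝ) ≤ k := Nat.cast_nonneg k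
  have h := adm_zero_of_expWeight hr (by linarith : -1 < a)
  have h' : Adm 0 (a + -k) (r + 0 * -k) :=
    ⟨le_rfl, by linarith, by linarith, by linarith⟩
  have h1 := mom_pol_mul_pol h h' hMN
  rw [zero_mul, add_zero, ← sub_eq_add_neg] at h1
  rw [LinearMap.smul_apply, LinearMap.comp_apply, LinearMap.mulLeft_apply, smul_eq_mul,
    mom_X_pow_mul, zero_mul, add_zero, show a - 2 * k + k = a - k by ring, h1]
  ring

/-- Negative moments of the Laguerre orthogonal ensemble. -/
lemma average_one_exp (hr : 0 < r) (ha : -1 < a - 2 * k) (hac : 2 * c + 1 = a) (p : ℕ) :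
    BallisticCavity.AverageExists 1 (expWeight c r) (Ici 0) (2 * (p + 1)) (fun x => x⁻¹ ^ k) ∧
    BallisticCavity.average 1 (expWeight c r) (Ici 0) (2 * (p + 1)) (fun x => x⁻¹ ^ k) =
      ∑ l ∈ range (2 * p + 1), negDiag a r k l +
      (-∑ i ∈ range p, oddVal 0 a r i / hn 0 (2 * i + 1) a r *
        (mu 0 (a - 2 * k) r k / mu 0 (a - 2 * k) r (2 * k) *
        ∑ q ∈ range (2 * i + 2), conn 0 (2 * i + 1) q a r (-k) * conn 0 (2 * p + 1) q a r (-k) *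
          hn 0 q (a - k) r) +
        (∑ i ∈ range (p + 1),
          conn 0 (2 * p + 1) (2 * i + 1) a r (-(2 * k)) * oddVal 0 (a - 2 * k) r i -
        ∑ i ∈ range k, 2 * rho 0 (a - 2 * k) r i / (a - 2 * k + 1 + 2 * i) *
          (2 * (mu 0 (a - 2 * k) r i * d0 0 (2 * p + 1) a r (-(2 * k) + i)))) /
          (rho 0 (a - 2 * k) r k * mu 0 (a - 2 * k) r (2 * k))) / oddVal 0 a r p := by
  subst hac
  have hk : (0 : ℝ) ≤ k := Nat.cast_nonneg k
  have h0 : -1 < c := by linarith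
  have hc : -1 < c - k := by linarith
  have hck : 2 * (c - k) + 1 = 2 * c + 1 - 2 * (k : ℝ) := by ring
  have W := pearsonWeight_exp h0 hr
  have W' := pearsonWeight_exp hc hr
  obtain ⟨h1, h2⟩ := W.average_one (I := Ici 0) measurableSet_Ici
    restrict_Ioi_eq_restrict_Ici.symm
    (fun x hx => mul_nonneg (Real.rpow_nonneg hx _) (Real.exp_pos _).le)
    (fun x => x⁻¹ ^ k) (integrableOn_poly_mul_inv_pow_mul_expWeight hc hr) _
    (integral_inv_pow_mul_expWeight h0 hc hr) p
  refine ⟨h1, h2.trans ?_⟩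
  have hs : 2 * (c - k) + 1 = 2 * c + 1 + -(2 * k) := by ring
  have hadm' := W'.adm
  have hB := W'.invertedBy_form
  have hr0 : r = r + 0 * -(2 * k) := by ring
  have h3 := form_pol_X_pow (s := -(2 * k)) (B := W'.form) (z := W'.mass) W.adm k
    (by rw [← hs, ← hr0]; exact hadm') W'.form_antisymm (by rw [← hs, ← hr0]; exact hB) p
  rw [← hs, ← hr0] at h3
  -- The weights `(x⁻ᵏ w, w)` are `(v, xᵏ v)` for `v = x⁻ᵏ w`, so the boundary pairing is a value of
  -- the skew form of `v` with `X ^ k` in the second argument.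
  have h4 : skewPair (volume.restrict (Ioi 0)) (fun x => (pol 0 (2 * p + 1) (2 * c + 1) r).eval x *
      (x⁻¹ ^ k * expWeight c r x)) (expWeight c r) =
      W'.form (pol 0 (2 * p + 1) (2 * c + 1) r) (X ^ k) := by
    rw [W'.form_apply]
    refine skewPair_congr ?_ ?_
    · filter_upwards [ae_restrict_mem measurableSet_Ioi] with x hx
      rw [inv_pow_mul_expWeight hx]
    · filter_upwards [ae_restrict_mem measurableSet_Ioi] with x hx
      rw [expWeight_eq_pow_mul (k := k) hx, eval_pow, eval_X]
  have hF := fun {M N : ℕ} (hMN : M ≤ N) => mom_X_pow_mul_pol_mul_pol hr ha hMN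
  have hm := W'.mass_pos.ne'
  have hmass : W.mass = W'.mass * mu 0 (2 * (c - k) + 1) r (2 * k) := mass_expWeight h0 hc hr
  have hmu := (mu_pos hadm' (2 * k)).ne'
  have hrho := (rho_pos hadm' k).ne'
  rw [h4, sub_eq_add_neg (-Finset.sum _ _), ← neg_div, hmass]
  generalize W'.form = B at h3 ⊢
  generalize W'.mass = z at h3 hm ⊢
  rw [hck] at hmu hrho h3 ⊢
  have h5 : -B (pol 0 (2 * p + 1) (2 * c + 1) r) (X ^ k) /
      (z * mu 0 (2 * c + 1 - 2 * k) r (2 * k)) =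
      (rho 0 (2 * c + 1 - 2 * k) r k * -B (pol 0 (2 * p + 1) (2 * c + 1) r) (X ^ k)) /
      z / (rho 0 (2 * c + 1 - 2 * k) r k * mu 0 (2 * c + 1 - 2 * k) r (2 * k)) := by
    field_simp
  rw [h5, h3, mul_div_cancel_left₀ _ hm]
  congr 1
  · refine sum_congr rfl fun l _ => ?_
    rw [hF le_rfl, negDiag]
  · congr 3
    refine sum_congr rfl fun i hi => ?_
    rw [mul_comm (pol 0 (2 * p + 1) _ _), hF (by have := Finset.mem_range.1 hi; omega)]

/-- Negative moments of the Laguerre unitary ensemble. -/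
lemma average_two_exp (hr : 0 < r) (ha : -1 < a - 2 * k) (N : ℕ) :
    BallisticCavity.average 2 (fun x => x ^ a * Real.exp (-r * x)) (Ici 0) N (fun x => x⁻¹ ^ k) =
      ∑ l ∈ range N, negDiag a r k l := by
  obtain ⟨c, rfl⟩ : ∃ c, 2 * c + 1 = a := ⟨(a - 1) / 2, by ring⟩
  have hk : (0 : ℝ) ≤ k := Nat.cast_nonneg k
  have h0 : -1 < c := by linarith
  have hc : -1 < c - k := by linarith
  rw [(pearsonWeight_exp h0 hr).average_two restrict_Ioi_eq_restrict_Ici.symm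
    (fun x hx => ?_) (fun x => x⁻¹ ^ k) (integrableOn_poly_mul_inv_pow_mul_expWeight hc hr) _
    (integral_inv_pow_mul_expWeight h0 hc hr) N]
  · refine sum_congr rfl fun l _ => ?_
    rw [show 2 * (c - k) + 1 = 2 * c + 1 - 2 * (k : ℝ) by ring,
      mom_X_pow_mul_pol_mul_pol hr ha le_rfl, negDiag]
  · rw [eval_sig, expWeight, mul_pow, ← Real.exp_nat_mul, ← sq_rpow_half_mul (Set.mem_Ioi.1 hx),
      show (2 * c + 1 - 1) / 2 = c by ring]
    push_cast
    rw [show 2 * (-r * x / 2) = -r * x by ring]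
    ring

end Exponential

end ClassicalAverages

end ClassicalEnsemble

/-! ### Gamma function formulas for Jacobi norms and connection coefficients. -/

namespace ClassicalEnsemble

section ClosedForms

open Finset Real

variable {a b d s x : ℝ}

/-- The duplication formula for a step of `2j`, in which the factor `√π` and the real powers of `2`
have cancelled. -/
lemma Gamma_add_two_mul_nat (hx : 0 < x) (j : ℕ) :
    Gamma (x + 2 * j) * Gamma (x / 2) * Gamma ((x + 1) / 2) =
      4 ^ j * Gamma x * Gamma (x / 2 + j) * Gamma ((x + 1) / 2 + j) := by
  induction j with
  | zero => simp
  | succ j ih =>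
    have hj : (0 : ℝ) ≤ j := Nat.cast_nonneg j
    push_cast
    rw [show x + 2 * ((j : ℝ) + 1) = x + 2 * j + 1 + 1 by ring, ← add_assoc, ← add_assoc,
      Gamma_add_one (by positivity), Gamma_add_one (by positivity), Gamma_add_one (by positivity),
      Gamma_add_one (by positivity)]
    linear_combination (x + 2 * j + 1) * (x + 2 * j) * ih

lemma prod_add_nat (hx : 0 < x) (N : ℕ) :
    ∏ t ∈ range N, (x + t) = Gamma (x + N) / Gamma x := by
  induction N with
  | zero => simp [(Gamma_pos_of_pos hx).ne']
  | succ N ih =>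
    have hN : (0 : ℝ) ≤ N := Nat.cast_nonneg N
    rw [prod_range_succ, ih, Nat.cast_succ, ← add_assoc, Gamma_add_one (by positivity)]
    ring

lemma prod_add_two_mul_nat (hx : 0 < x) (N : ℕ) :
    ∏ t ∈ range N, (x + 2 * t) = 2 ^ N * (Gamma (x / 2 + N) / Gamma (x / 2)) := by
  rw [← prod_add_nat (half_pos hx), ← card_range N, ← prod_const, card_range, ← prod_mul_distrib]
  exact prod_congr rfl fun t _ => by ring

/-- Integer `s` of either sign is needed, since negative moments lead to the generalised binomial
coefficients. -/
lemma prod_sub_eq_factorial_mul_choose (s : ℤ) (N : ℕ) :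
    ∏ t ∈ range N, ((s : ℝ) - t) = N.factorial * ((Ring.choose s N : ℤ) : ℝ) := by
  have h := Ring.descPochhammer_eq_factorial_smul_choose s N
  rw [nsmul_eq_mul] at h
  have h2 : ((∏ t ∈ range N, (s - t) : ℤ) : ℝ) = ∏ t ∈ range N, ((s : ℝ) - t) := by push_cast; rfl
  rw [← h2, ← Int.cast_natCast N.factorial, ← Int.cast_mul, ← h]
  congr 1
  clear h h2
  induction N with
  | zero => simp
  | succ N ih =>
    rw [prod_range_succ, ih, descPochhammer_succ_right, Polynomial.smeval_mul,
      Polynomial.smeval_sub, Polynomial.smeval_X, Polynomial.smeval_natCast]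
    simp

lemma prod_natCast_sub (k N : ℕ) :
    ∏ t ∈ range N, ((k : ℝ) - t) = N.factorial * (k.choose N : ℝ) := by
  have := prod_sub_eq_factorial_mul_choose k N
  rw [Ring.choose_natCast] at this
  exact_mod_cast this

lemma mu_one_eq (ha : -1 < a) (hd : 0 < d) (k : ℕ) :
    mu 1 a d k = Gamma (a + 1 + k) / Gamma (a + 1) * (Gamma d / Gamma (d + k)) := by
  simp only [mu, one_mul]
  rw [prod_div_distrib, prod_add_nat (by linarith), prod_add_nat hd]
  have h1 := (Gamma_pos_of_pos hd).ne'
  field_simp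

lemma rho_one_eq (ha : -1 < a) (hd : 0 < d) (k : ℕ) : rho 1 a d k =
    Gamma (d / 2 + k) / Gamma (d / 2) * (Gamma ((a + 1) / 2) / Gamma ((a + 1) / 2 + k)) := by
  simp only [rho, mul_one]
  rw [prod_div_distrib, prod_add_two_mul_nat hd, prod_add_two_mul_nat (by linarith),
    mul_div_mul_left _ _ (by positivity)]
  have h1 := (Gamma_pos_of_pos (by linarith : 0 < (a + 1) / 2)).ne'
  field_simp

lemma hn_one_eq (ha : -1 < a) (hb : -1 < b) (hd : d = a + b + 2) (hd1 : 1 < d) (N : ℕ) :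
    hn 1 N a d = N.factorial * (Gamma (a + 1 + N) / Gamma (a + 1)) *
      (Gamma (b + 1 + N) / Gamma (b + 1)) * (Gamma d / Gamma (d + 2 * N)) *
      (Gamma (d + N - 1) / Gamma (d + 2 * N - 1)) := by
  have hΓ : ∀ {y : ℝ}, 0 < y → Gamma y ≠ 0 := fun hy => (Gamma_pos_of_pos hy).ne'
  induction N generalizing a b d with
  | zero =>
    have h1 := hΓ (by linarith : 0 < a + 1)
    have h2 := hΓ (by linarith : 0 < b + 1)
    have h3 := hΓ (by linarith : 0 < d)
    have h4 := hΓ (by linarith : 0 < d - 1)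
    simp [hn, h1, h2, h3, h4]
  | succ N ih =>
    have hN : (0 : ℝ) ≤ N := Nat.cast_nonneg N
    rw [hn, mul_one, ih (a := a + 1) (b := b + 1) (d := d + 2) (by linarith) (by linarith)
      (by linarith) (by linarith), lam, Nat.factorial_succ]
    push_cast
    have h1 := hΓ (by linarith : 0 < a + 1)
    have h2 := hΓ (by linarith : 0 < b + 1)
    have h3 := hΓ (by linarith : 0 < d)
    have h4 := hΓ (by linarith : 0 < d + 2 * (N + 1))
    have h5 := hΓ (by linarith : 0 < d + 2 * (N + 1) - 1)
    have h6 : a + 1 ≠ 0 := by linarith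
    have h7 : b + 1 ≠ 0 := by linarith
    have h8 : d + N ≠ 0 := by linarith
    have h9 : d ≠ 0 := by linarith
    have h10 : d + 1 ≠ 0 := by linarith
    rw [show a + 1 + 1 + (N : ℝ) = a + 1 + (N + 1) by ring, Gamma_add_one h6,
      show b + 1 + 1 + (N : ℝ) = b + 1 + (N + 1) by ring, Gamma_add_one h7,
      show d + 2 + 2 * (N : ℝ) = d + 2 * (N + 1) by ring,
      show d + 2 + (N : ℝ) - 1 = d + N + 1 by ring, Gamma_add_one h8,
      show d + ((N : ℝ) + 1) - 1 = d + N by ring, show d + 2 = d + 1 + 1 by ring,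
      Gamma_add_one h10, Gamma_add_one h9, show d - 1 * (a + 1) = b + 1 by linarith]
    field_simp

/-- The product over `t` stays unevaluated because it may vanish; it becomes a binomial coefficient
in `conn_one_eq` and a Gamma quotient in the boundary term. -/
lemma d0_one_eq (ha : -1 < a) (hb : -1 < b) (hd : d = a + b + 2) (hd1 : 1 < d) (hs : 0 < d + s)
    (N : ℕ) : d0 1 N a d s = (∏ t ∈ range N, (s - t)) * (Gamma (b + 1 + N) / Gamma (b + 1)) *
      (Gamma (d + N - 1) / Gamma (d + 2 * N - 1)) * (Gamma (d + s) / Gamma (d + s + N)) := by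
  have hΓ : ∀ {y : ℝ}, 0 < y → Gamma y ≠ 0 := fun hy => (Gamma_pos_of_pos hy).ne'
  induction N generalizing a b d s with
  | zero =>
    have h1 := hΓ (by linarith : 0 < d + s)
    have h2 := hΓ (by linarith : 0 < b + 1)
    have h4 := hΓ (by linarith : 0 < d - 1)
    simp [d0, h1, h2, h4]
  | succ N ih =>
    have hN : (0 : ℝ) ≤ N := Nat.cast_nonneg N
    rw [d0, mul_one, ih (a := a + 1) (b := b + 1) (d := d + 2) (s := s - 1) (by linarith)
      (by linarith) (by linarith) (by linarith) (by linarith), prod_range_succ']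
    push_cast
    have h2 := hΓ (by linarith : 0 < b + 1)
    have h4 := hΓ (by linarith : 0 < d + s + (N + 1))
    have h5 := hΓ (by linarith : 0 < d + 2 * (N + 1) - 1)
    have h7 : b + 1 ≠ 0 := by linarith
    have h8 : d + N ≠ 0 := by linarith
    have h9 : d + s ≠ 0 := by linarith
    rw [show b + 1 + 1 + (N : ℝ) = b + 1 + (N + 1) by ring, Gamma_add_one h7,
      show d + 2 + 2 * (N : ℝ) = d + 2 * (N + 1) by ring,
      show d + 2 + (N : ℝ) - 1 = d + N + 1 by ring, Gamma_add_one h8,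
      show d + ((N : ℝ) + 1) - 1 = d + N by ring, show d + 2 + (s - 1) = d + s + 1 by ring,
      Gamma_add_one h9, show d - 1 * (a + 1) = b + 1 by linarith,
      show d + s + 1 + (N : ℝ) = d + s + (N + 1) by ring,
      prod_congr rfl fun (t : ℕ) _ => show s - 1 - (t : ℝ) = s - (t + 1) by ring, one_mul,
      one_mul, sub_zero]
    field_simp

lemma choose_mul_factorial_sub {N M : ℕ} (h : M ≤ N) :
    (N.choose M : ℝ) * (N - M).factorial = N.factorial / M.factorial := by
  rw [eq_div_iff (by positivity), ← Nat.choose_mul_factorial_mul_factorial h]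
  push_cast
  ring

lemma conn_one_eq (ha : -1 < a) (hb : -1 < b) (hd : d = a + b + 2) (hd1 : 1 < d) (k : ℕ) {N M : ℕ}
    (h : M ≤ N) : conn 1 N M a d k = (k.choose (N - M) : ℝ) * (N.factorial / M.factorial) *
      (Gamma (b + 1 + N) / Gamma (b + 1 + M)) *
      (Gamma (d + N + M - 1) / Gamma (d + 2 * N - 1)) *
      (Gamma (d + k + 2 * M) / Gamma (d + k + N + M)) := by
  have hM : (0 : ℝ) ≤ M := Nat.cast_nonneg M
  have hk : (0 : ℝ) ≤ k := Nat.cast_nonneg k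
  rw [conn, d0_one_eq (b := b + M) (by linarith) (by linarith) (by linarith) (by linarith)
    (by linarith), prod_natCast_sub, ← choose_mul_factorial_sub h, Nat.cast_sub h,
    show b + M + 1 + ((N : ℝ) - M) = b + 1 + N by ring, show b + M + 1 = b + 1 + (M : ℝ) by ring,
    show d + 2 * 1 * M + ((N : ℝ) - M) - 1 = d + N + M - 1 by ring,
    show d + 2 * 1 * M + 2 * ((N : ℝ) - M) - 1 = d + 2 * N - 1 by ring,
    show d + 2 * 1 * (M : ℝ) + k = d + k + 2 * M by ring,
    show d + k + 2 * M + ((N : ℝ) - M) = d + k + N + M by ring]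
  ring

lemma hn_one_succ (ha : -1 < a) (hb : -1 < b) (hd : d = a + b + 2) (hd1 : 1 < d) (l : ℕ) :
    hn 1 (l + 1) a d = hn 1 l a d * ((l + 1) * (a + 1 + l) * (b + 1 + l) * (d + l - 1) /
      ((d + 2 * l) ^ 2 * (d + 2 * l + 1) * (d + 2 * l - 1))) := by
  have hΓ : ∀ {y : ℝ}, 0 < y → Gamma y ≠ 0 := fun hy => (Gamma_pos_of_pos hy).ne'
  have hl : (0 : ℝ) ≤ l := Nat.cast_nonneg l
  rw [hn_one_eq ha hb hd hd1, hn_one_eq ha hb hd hd1, Nat.factorial_succ]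
  push_cast
  have e1 : a + 1 + l ≠ 0 := by linarith
  have e2 : b + 1 + l ≠ 0 := by linarith
  have e3 : d + l - 1 ≠ 0 := by linarith
  have e4 : d + 2 * l ≠ 0 := by linarith
  have e5 : d + 2 * l + 1 ≠ 0 := by linarith
  have e6 : d + 2 * l - 1 ≠ 0 := by linarith
  rw [← add_assoc, ← add_assoc, Gamma_add_one e1, Gamma_add_one e2,
    show d + 2 * ((l : ℝ) + 1) = d + 2 * l + 1 + 1 by ring, Gamma_add_one e5, Gamma_add_one e4,
    show d + ((l : ℝ) + 1) - 1 = d + l - 1 + 1 by ring, Gamma_add_one e3, add_sub_cancel_right,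
    Gamma_add_one e4, show d + 2 * (l : ℝ) = d + 2 * l - 1 + 1 by ring, Gamma_add_one e6,
    sub_add_cancel]
  have h1 := hΓ (by linarith : 0 < a + 1)
  have h2 := hΓ (by linarith : 0 < b + 1)
  have h3 := hΓ (by linarith : 0 < d + 2 * l - 1)
  field_simp

end ClosedForms

end ClassicalEnsemble

/-! ### Gamma function formulas for the Jacobi skew constants. -/

namespace ClassicalEnsemble

section ClosedForms

open Finset Real

variable {a b d s x : ℝ}

lemma oddVal_one_eq (ha : -1 < a) (hb : -1 < b) (hd : d = a + b + 2) (hd1 : 1 < d) (i : ℕ) :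
    oddVal 1 a d i = 4 * 16 ^ i * i.factorial * (Gamma (a / 2 + 1 + i) / Gamma (a / 2 + 1)) *
      (Gamma (b / 2 + 1 + i) / Gamma (b / 2 + 1)) * (Gamma (d / 2 + i) / Gamma (d / 2)) *
      (Gamma d / Gamma (d + 4 * i + 1)) := by
  have hΓ : ∀ {y : ℝ}, 0 < y → Gamma y ≠ 0 := fun hy => (Gamma_pos_of_pos hy).ne'
  have h1 := hΓ (by linarith : 0 < a / 2 + 1)
  have h2 := hΓ (by linarith : 0 < b / 2 + 1)
  have h3 := hΓ (by linarith : 0 < d / 2)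
  have h4 := hΓ (by linarith : 0 < d)
  have h5 : d ≠ 0 := by linarith
  induction i with
  | zero =>
    rw [oddVal_zero, lead]
    simp only [Nat.cast_zero, mul_zero, add_zero, zero_add, pow_zero, Nat.factorial_zero,
      Nat.cast_one, mul_one, div_self h1, div_self h2, div_self h3, Gamma_add_one h5]
    field_simp
    norm_num
  | succ i ih =>
    have hi : (0 : ℝ) ≤ i := Nat.cast_nonneg i
    have hh := (hn_pos (e := 1) (a := a) (d := d) ⟨zero_le_one, ha, by linarith, by linarith⟩
      (2 * i + 1)).ne'
    rw [oddVal_succ, ih, show 2 * i + 2 = 2 * i + 1 + 1 by ring, hn_one_succ ha hb hd hd1, lead,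
      lead, Nat.factorial_succ]
    have e1 : a / 2 + 1 + i ≠ 0 := by linarith
    have e2 : b / 2 + 1 + i ≠ 0 := by linarith
    have e3 : d / 2 + i ≠ 0 := by linarith
    have g1 : d + 4 * i + 1 ≠ 0 := by linarith
    have g2 : d + 4 * i + 2 ≠ 0 := by linarith
    have g3 : d + 4 * i + 3 ≠ 0 := by linarith
    have g4 : d + 4 * i + 4 ≠ 0 := by linarith
    have g0 := hΓ (by linarith : 0 < d + 4 * i + 1)
    push_cast
    rw [← add_assoc (a / 2 + 1), ← add_assoc (b / 2 + 1), ← add_assoc (d / 2), Gamma_add_one e1,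
      Gamma_add_one e2, Gamma_add_one e3, show d + 4 * ((i : ℝ) + 1) + 1 = d + 4 * i + 4 + 1 by ring,
      Gamma_add_one g4, show d + 4 * (i : ℝ) + 4 = d + 4 * i + 3 + 1 by ring, Gamma_add_one g3,
      show d + 4 * (i : ℝ) + 3 = d + 4 * i + 2 + 1 by ring, Gamma_add_one g2,
      show d + 4 * (i : ℝ) + 2 = d + 4 * i + 1 + 1 by ring, Gamma_add_one g1]
    rw [show 1 * (2 * (i : ℝ) + 1) + d / 2 = (d + 4 * i + 2) / 2 by ring,
      show 1 * (2 * (i : ℝ) + 1 + 1) + d / 2 = (d + 4 * i + 4) / 2 by ring,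
      show d + 2 * (2 * (i : ℝ) + 1) = d + 4 * i + 2 by ring,
      show d + 4 * (i : ℝ) + 2 - 1 = d + 4 * i + 1 by ring,
      show d + 4 * (i : ℝ) + 1 + 1 = d + 4 * i + 2 by ring,
      show d + 4 * (i : ℝ) + 2 + 1 = d + 4 * i + 3 by ring,
      show d + 4 * (i : ℝ) + 3 + 1 = d + 4 * i + 4 by ring]
    field_simp
    ring

/-- The product of Gamma factors governing the ratios `oddVal i / hn (2 i + 1)`. -/
noncomputable def oddGamma (a b d : ℝ) (i : ℕ) : ℝ :=
  Gamma (3 / 2 + i) * Gamma ((a + 3) / 2 + i) * Gamma ((b + 3) / 2 + i) * Gamma ((d + 1) / 2 + i)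

/-- The product is independent of `i`. Comparing two indices then gives `oddVal_div_hn_one_eq`,
already with the half-integer Gamma arguments that occur in `symplecticCoeff`. -/
lemma oddVal_div_hn_one_mul (ha : -1 < a) (hb : -1 < b) (hd : d = a + b + 2) (hd1 : 1 < d) (i : ℕ) :
    oddVal 1 a d i / hn 1 (2 * i + 1) a d * (16 ^ i * oddGamma a b d i / Gamma (d + 4 * i + 2)) =
      oddVal 1 a d 0 / hn 1 1 a d * (oddGamma a b d 0 / Gamma (d + 2)) := by
  have hΓ : ∀ {y : ℝ}, 0 < y → Gamma y ≠ 0 := fun hy => (Gamma_pos_of_pos hy).ne'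
  have hadm : Adm 1 a d := ⟨zero_le_one, ha, by linarith, by linarith⟩
  induction i with
  | zero => simp
  | succ i ih =>
    rw [← ih]
    have hi : (0 : ℝ) ≤ i := Nat.cast_nonneg i
    have hh := (hn_pos hadm (2 * i + 1)).ne'
    rw [oddVal_succ, show 2 * (i + 1) + 1 = 2 * i + 1 + 1 + 1 by ring,
      hn_one_succ ha hb hd hd1 (2 * i + 1 + 1), show 2 * i + 2 = 2 * i + 1 + 1 by ring,
      hn_one_succ ha hb hd hd1 (2 * i + 1), lead, lead, oddGamma,
      oddGamma]
    have e0 : 3 / 2 + (i : ℝ) ≠ 0 := by linarith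
    have e1 : (a + 3) / 2 + i ≠ 0 := by linarith
    have e2 : (b + 3) / 2 + i ≠ 0 := by linarith
    have e3 : (d + 1) / 2 + i ≠ 0 := by linarith
    have g1 : d + 4 * i + 1 ≠ 0 := by linarith
    have g2 : d + 4 * i + 2 ≠ 0 := by linarith
    have g3 : d + 4 * i + 3 ≠ 0 := by linarith
    have g4 : d + 4 * i + 4 ≠ 0 := by linarith
    have g5 : d + 4 * i + 5 ≠ 0 := by linarith
    have f1 : a + 1 + (2 * (i : ℝ) + 1) ≠ 0 := by linarith
    have f2 : b + 1 + (2 * (i : ℝ) + 1) ≠ 0 := by linarith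
    have f3 : d + (2 * (i : ℝ) + 1) - 1 ≠ 0 := by linarith
    have f4 : a + 1 + (2 * (i : ℝ) + 1 + 1) ≠ 0 := by linarith
    have f5 : b + 1 + (2 * (i : ℝ) + 1 + 1) ≠ 0 := by linarith
    have f6 : d + (2 * (i : ℝ) + 1 + 1) - 1 ≠ 0 := by linarith
    have f7 : 2 * (i : ℝ) + 1 + 1 + 1 ≠ 0 := by linarith
    have f8 : 2 * (i : ℝ) + 1 + 1 ≠ 0 := by linarith
    have g0 := hΓ (by linarith : 0 < d + 4 * i + 2)
    push_cast
    rw [← add_assoc (3 / 2 : ℝ), ← add_assoc ((a + 3) / 2), ← add_assoc ((b + 3) / 2),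
      ← add_assoc ((d + 1) / 2), Gamma_add_one e0, Gamma_add_one e1, Gamma_add_one e2,
      Gamma_add_one e3, show d + 4 * ((i : ℝ) + 1) + 2 = d + 4 * i + 5 + 1 by ring,
      Gamma_add_one g5, show d + 4 * (i : ℝ) + 5 = d + 4 * i + 4 + 1 by ring, Gamma_add_one g4,
      show d + 4 * (i : ℝ) + 4 = d + 4 * i + 3 + 1 by ring, Gamma_add_one g3,
      show d + 4 * (i : ℝ) + 3 = d + 4 * i + 2 + 1 by ring, Gamma_add_one g2]
    rw [show 1 * (2 * (i : ℝ) + 1) + d / 2 = (d + 4 * i + 2) / 2 by ring,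
      show 1 * (2 * (i : ℝ) + 1 + 1) + d / 2 = (d + 4 * i + 4) / 2 by ring,
      show d + 2 * (2 * (i : ℝ) + 1 + 1) = d + 4 * i + 4 by ring,
      show d + 2 * (2 * (i : ℝ) + 1) = d + 4 * i + 2 by ring,
      show d + 4 * (i : ℝ) + 2 - 1 = d + 4 * i + 1 by ring,
      show d + 4 * (i : ℝ) + 4 - 1 = d + 4 * i + 3 by ring,
      show d + 4 * (i : ℝ) + 2 + 1 = d + 4 * i + 3 by ring,
      show d + 4 * (i : ℝ) + 3 + 1 = d + 4 * i + 4 by ring,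
      show d + 4 * (i : ℝ) + 4 + 1 = d + 4 * i + 5 by ring]
    have k1 : (a + 3) / 2 + i = (a + 1 + (2 * (i : ℝ) + 1 + 1)) / 2 := by ring
    have k2 : (b + 3) / 2 + i = (b + 1 + (2 * (i : ℝ) + 1 + 1)) / 2 := by ring
    have k3 : (d + 1) / 2 + i = (d + (2 * (i : ℝ) + 1 + 1) - 1) / 2 := by ring
    have k4 : 3 / 2 + (i : ℝ) = (2 * (i : ℝ) + 1 + 1 + 1) / 2 := by ring
    generalize hA : Gamma ((a + 3) / 2 + i) = A
    generalize hB : Gamma ((b + 3) / 2 + i) = B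
    generalize hC : Gamma ((d + 1) / 2 + i) = C
    generalize hD : Gamma (3 / 2 + (i : ℝ)) = D
    rw [k1, k2, k3, k4]
    generalize a + 1 + (2 * (i : ℝ) + 1 + 1) = u1 at *
    generalize b + 1 + (2 * (i : ℝ) + 1 + 1) = u2 at *
    generalize d + (2 * (i : ℝ) + 1 + 1) - 1 = u3 at *
    generalize 2 * (i : ℝ) + 1 + 1 + 1 = u4 at *
    generalize a + 1 + (2 * (i : ℝ) + 1) = v1 at *
    generalize b + 1 + (2 * (i : ℝ) + 1) = v2 at *
    generalize d + (2 * (i : ℝ) + 1) - 1 = v3 at *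
    generalize 2 * (i : ℝ) + 1 + 1 = v4 at *
    field_simp
    ring

lemma oddVal_div_hn_one_eq (ha : -1 < a) (hb : -1 < b) (hd : d = a + b + 2) (hd1 : 1 < d) (i p : ℕ) :
    oddVal 1 a d i / hn 1 (2 * i + 1) a d / oddVal 1 a d p =
      16 ^ p / 16 ^ i * (oddGamma a b d p / oddGamma a b d i) *
        (Gamma (d + 4 * i + 2) / Gamma (d + 4 * p + 2)) / hn 1 (2 * p + 1) a d := by
  have hΓ : ∀ {y : ℝ}, 0 < y → Gamma y ≠ 0 := fun hy => (Gamma_pos_of_pos hy).ne'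
  have hadm : Adm 1 a d := ⟨zero_le_one, ha, by linarith, by linarith⟩
  have h := (oddVal_div_hn_one_mul ha hb hd hd1 i).trans (oddVal_div_hn_one_mul ha hb hd hd1 p).symm
  have hO : ∀ i : ℕ, oddGamma a b d i ≠ 0 := fun i => by
    have hi : (0 : ℝ) ≤ i := Nat.cast_nonneg i
    exact mul_ne_zero (mul_ne_zero (mul_ne_zero (hΓ (by linarith)) (hΓ (by linarith)))
      (hΓ (by linarith))) (hΓ (by linarith))
  have hG : ∀ i : ℕ, Gamma (d + 4 * i + 2) ≠ 0 := fun i => by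
    have hi : (0 : ℝ) ≤ i := Nat.cast_nonneg i
    exact hΓ (by linarith)
  have h1 := hO i
  have h2 := hO p
  have h3 := hG i
  have h4 := hG p
  have h5 := (hn_pos hadm (2 * i + 1)).ne'
  have h6 := (hn_pos hadm (2 * p + 1)).ne'
  have h7 := (oddVal_pos hadm p).ne'
  field_simp at h ⊢
  linear_combination h

end ClosedForms

end ClassicalEnsemble

/-! ### Jacobi case: matching with the double sum. -/

namespace ClassicalEnsemble

section JacobiMatching

open Finset Real BallisticCavity

variable {a b d : ℝ} {i p j k l N q c : ℕ}

lemma poch_eq {x y y' : ℝ} {z : ℤ} (h1 : x + z = y) (h2 : x = y') :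
    poch x z = Gamma y / Gamma y' := by
  rw [poch, h1, h2]

-- The dictionary is `b = δ + 1`, doubled arguments `N = 2p + 1` and `a + N`, odd index `l = 2i + 1
-- = N - 2j`, and `q = l - c`. Each Pochhammer symbol becomes a Gamma quotient by linear arithmetic
-- in its arguments.
set_option maxHeartbeats 1000000 in
lemma symplecticCoeff_eq (ha : 0 ≤ a) (hb : -1 < b) (hd : d = a + b + 2) (hl : l = 2 * i + 1)
    (hN : N = 2 * p + 1) (hj : l + 2 * j = N) (hc : q + c = l) :
    2 * symplecticCoeff (2 * b + 2) c j k ((a + N) / 2) ((N : ℝ) / 2) =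
      16 ^ p / 16 ^ i * (oddGamma a b d p / oddGamma a b d i) *
      (Gamma (b + 1 + l) / Gamma (b + 1 + q)) * (Gamma (a + k + 1 + q) / Gamma (a + 1 + N)) *
      (Gamma (d + k + q - 1) / Gamma (d + N - 1)) * (l.factorial / q.factorial) *
      ((d + 2 * l - 1) * (d + k + 2 * q - 1) *
      ((Gamma (d + N + q - 1) / Gamma (d + k + N + q)) *
        (Gamma (d + l + q - 1) / Gamma (d + k + l + q)))) := by
  have hΓ : ∀ {y : ℝ}, 0 < y → Gamma y ≠ 0 := fun hy => (Gamma_pos_of_pos hy).ne'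
  have hi0 : (0 : ℝ) ≤ i := Nat.cast_nonneg i
  have hp0 : (0 : ℝ) ≤ p := Nat.cast_nonneg p
  have hq0 : (0 : ℝ) ≤ q := Nat.cast_nonneg q
  have hk0 : (0 : ℝ) ≤ k := Nat.cast_nonneg k
  have hl' : (l : ℝ) = 2 * i + 1 := by rw [hl]; push_cast; ring
  have hN' : (N : ℝ) = 2 * p + 1 := by rw [hN]; push_cast; ring
  have hj' : (j : ℝ) = p - i := by
    have : (l : ℝ) + 2 * j = N := by exact_mod_cast hj
    linarith
  have hc' : (c : ℝ) = l - q := by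
    have : (q : ℝ) + c = l := by exact_mod_cast hc
    linarith
  have hpi : p = i + j := by omega
  have hz : (2 : ℝ) ^ (4 * (j : ℤ) - 3) = 16 ^ p / 16 ^ i / 8 := by
    rw [zpow_sub₀ two_ne_zero, zpow_mul, hpi, pow_add, mul_div_cancel_left₀ _ (by positivity)]
    norm_num
  have g1 := hΓ (by linarith : 0 < b + 1 + q)
  have g2 := hΓ (by linarith : 0 < a + 1 + N)
  have g3 := hΓ (by linarith : 0 < d + N - 1)
  have g4 := hΓ (by linarith : 0 < (b + 3) / 2 + p)
  have g5 := hΓ (by linarith : 0 < (a + 3) / 2 + p)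
  have g6 := hΓ (by linarith : 0 < (d + 1) / 2 + p)
  have g7 := hΓ (by linarith : 0 < 3 / 2 + (p : ℝ))
  have g8 := hΓ (by linarith : 0 < (b + 3) / 2 + i)
  have g9 := hΓ (by linarith : 0 < (a + 3) / 2 + i)
  have g10 := hΓ (by linarith : 0 < (d + 1) / 2 + i)
  have g11 := hΓ (by linarith : 0 < 3 / 2 + (i : ℝ))
  have g12 := hΓ (by linarith : 0 < d + k + N + q)
  have g13 := hΓ (by linarith : 0 < d + k + l + q)
  have e1 : (a + N) / 2 ≠ 0 := by linarith
  have e2 : (a + b + N) / 2 ≠ 0 := by linarith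
  have e3 : a + N ≠ 0 := by linarith
  have e4 : d + N - 2 ≠ 0 := by linarith
  have p1 : poch ((2 * b + 2) / 2 + 2 * ((N : ℝ) / 2) - c - 2 * j) c =
      Gamma (b + 1 + l) / Gamma (b + 1 + q) :=
    poch_eq (by push_cast; linarith only [hl', hN', hj', hc', hd])
      (by linarith only [hl', hN', hj', hc', hd])
  have p2 : poch (2 * ((a + N) / 2)) ((k : ℤ) - c - 2 * j + 1) =
      Gamma (a + k + 1 + q) / (Gamma (a + 1 + N) / (a + N)) := by
    rw [show a + 1 + (N : ℝ) = a + N + 1 by ring, Gamma_add_one e3, mul_div_cancel_left₀ _ e3]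
    exact poch_eq (by push_cast; linarith only [hl', hN', hj', hc', hd])
      (by linarith only [hl', hN', hj', hc', hd])
  have p3 : poch ((2 * b + 2) / 2 + 2 * ((a + N) / 2) - 1) ((k : ℤ) - c - 2 * j + 1) =
      Gamma (d + k + q - 1) / (Gamma (d + N - 1) / (d + N - 2)) := by
    rw [show d + (N : ℝ) - 1 = d + N - 2 + 1 by ring, Gamma_add_one e4, mul_div_cancel_left₀ _ e4]
    exact poch_eq (by push_cast; linarith only [hl', hN', hj', hc', hd])
      (by linarith only [hl', hN', hj', hc', hd])
  have p4 : poch ((2 * b + 2) / 4 + (N : ℝ) / 2 + 1 / 2) (-(j : ℤ)) =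
      Gamma ((b + 3) / 2 + i) / Gamma ((b + 3) / 2 + p) :=
    poch_eq (by push_cast; linarith only [hl', hN', hj', hc', hd])
      (by linarith only [hl', hN', hj', hc', hd])
  have p5 : poch ((a + N) / 2) (1 - (j : ℤ)) =
      Gamma ((a + 3) / 2 + i) / (Gamma ((a + 3) / 2 + p) / ((a + N) / 2)) := by
    rw [show (a + 3) / 2 + (p : ℝ) = (a + N) / 2 + 1 by linarith, Gamma_add_one e1,
      mul_div_cancel_left₀ _ e1]
    exact poch_eq (by push_cast; linarith only [hl', hN', hj', hc', hd])
      (by linarith only [hl', hN', hj', hc', hd])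
  have p6 : poch ((2 * b + 2) / 4 + (a + N) / 2 - 1 / 2) (1 - (j : ℤ)) =
      Gamma ((d + 1) / 2 + i) / (Gamma ((d + 1) / 2 + p) / ((a + b + N) / 2)) := by
    rw [show (d + 1) / 2 + (p : ℝ) = (a + b + N) / 2 + 1 by linarith, Gamma_add_one e2,
      mul_div_cancel_left₀ _ e2]
    exact poch_eq (by push_cast; linarith only [hl', hN', hj', hc', hd])
      (by linarith only [hl', hN', hj', hc', hd])
  have p7 : poch (2 * ((N : ℝ) / 2) - 2 * j + 1) (-(c : ℤ)) = q.factorial / l.factorial := by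
    rw [← Gamma_nat_eq_factorial, ← Gamma_nat_eq_factorial]
    exact poch_eq (by push_cast; linarith only [hl', hN', hj', hc', hd])
      (by linarith only [hl', hN', hj', hc', hd])
  have p8 : poch ((N : ℝ) / 2 + 1) (-(j : ℤ)) = Gamma (3 / 2 + i) / Gamma (3 / 2 + p) :=
    poch_eq (by push_cast; linarith only [hl', hN', hj', hc', hd])
      (by linarith only [hl', hN', hj', hc', hd])
  have p9 : poch ((2 * b + 2) / 2 + 2 * ((a + N) / 2) + 2 * ((N : ℝ) / 2) - c - 2 * j)
      (1 + (k : ℤ)) = Gamma (d + k + N + q) / Gamma (d + N + q - 1) :=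
    poch_eq (by push_cast; linarith only [hl', hN', hj', hc', hd])
      (by linarith only [hl', hN', hj', hc', hd])
  have p10 : poch ((2 * b + 2) / 2 + 2 * ((a + N) / 2) + 2 * ((N : ℝ) / 2) - c - 4 * j)
      (1 + (k : ℤ)) = Gamma (d + k + l + q) / Gamma (d + l + q - 1) :=
    poch_eq (by push_cast; linarith only [hl', hN', hj', hc', hd])
      (by linarith only [hl', hN', hj', hc', hd])
  have p11 : (2 * b + 2) / 2 + 2 * ((a + N) / 2) + 2 * ((N : ℝ) / 2) - 4 * j = d + 2 * l - 1 := by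
    linarith
  have p12 : (2 * b + 2) / 2 + 2 * ((a + N) / 2) + 2 * ((N : ℝ) / 2) - 2 * c - 4 * j + k =
      d + k + 2 * q - 1 := by
    linarith
  rw [symplecticCoeff, p1, p2, p3, p4, p5, p6, p7, p8, p9, p10, p11, p12, hz, oddGamma, oddGamma,
    show (a + b + N) / 2 = (d + N - 2) / 2 by linarith]
  clear p1 p2 p3 p4 p5 p6 p7 p8 p9 p10 p11 p12 hz e1 e2
  generalize Gamma (b + 1 + q) = x1 at g1 ⊢
  generalize Gamma (a + 1 + N) = x2 at g2 ⊢
  generalize Gamma (d + N - 1) = x3 at g3 ⊢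
  generalize Gamma ((b + 3) / 2 + p) = x4 at g4 ⊢
  generalize Gamma ((a + 3) / 2 + p) = x5 at g5 ⊢
  generalize Gamma ((d + 1) / 2 + p) = x6 at g6 ⊢
  generalize Gamma (3 / 2 + (p : ℝ)) = x7 at g7 ⊢
  generalize Gamma ((b + 3) / 2 + i) = x8 at g8 ⊢
  generalize Gamma ((a + 3) / 2 + i) = x9 at g9 ⊢
  generalize Gamma ((d + 1) / 2 + i) = x10 at g10 ⊢
  generalize Gamma (3 / 2 + (i : ℝ)) = x11 at g11 ⊢
  generalize Gamma (d + k + N + q) = x12 at g12 ⊢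
  generalize Gamma (d + k + l + q) = x13 at g13 ⊢
  generalize a + N = u at e3 ⊢
  generalize d + N - 2 = v at e4 ⊢
  field_simp
  norm_num

-- The connection coefficients drop from `l` and from `N` to `q`, that is by `c` and by `c + 2j`.
-- They supply the two binomial coefficients.
set_option maxHeartbeats 1000000 in
lemma jacobi_double_term (ha : 0 ≤ a) (hb : -1 < b) (hd : d = a + b + 2) (hl : l = 2 * i + 1)
    (hN : N = 2 * p + 1) (hj : l + 2 * j = N) (hc : q + c = l) :
    oddVal 1 a d i / hn 1 l a d / oddVal 1 a d p * (mu 1 a d k *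
      (conn 1 l q a d k * conn 1 N q a d k * hn 1 q (a + k) (d + k))) =
    2 * ((k.choose c : ℝ) * (k.choose (c + 2 * j) : ℝ) *
      symplecticCoeff (2 * b + 2) c j k ((a + N) / 2) ((N : ℝ) / 2)) := by
  have hΓ : ∀ {y : ℝ}, 0 < y → Gamma y ≠ 0 := fun hy => (Gamma_pos_of_pos hy).ne'
  have hi0 : (0 : ℝ) ≤ i := Nat.cast_nonneg i
  have hp0 : (0 : ℝ) ≤ p := Nat.cast_nonneg p
  have hq0 : (0 : ℝ) ≤ q := Nat.cast_nonneg q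
  have hk0 : (0 : ℝ) ≤ k := Nat.cast_nonneg k
  have hl' : (l : ℝ) = 2 * i + 1 := by rw [hl]; push_cast; ring
  have hN' : (N : ℝ) = 2 * p + 1 := by rw [hN]; push_cast; ring
  have ha' : -1 < a := by linarith
  have hd1 : 1 < d := by linarith
  have g1 := hΓ (by linarith : 0 < b + 1 + q)
  have g2 := hΓ (by linarith : 0 < a + 1 + N)
  have g3 := hΓ (by linarith : 0 < d + N - 1)
  have g4 := hΓ (by linarith : 0 < a + 1 + k)
  have g5 := hΓ (by linarith : 0 < a + 1)
  have g6 := hΓ (by linarith : 0 < b + 1)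
  have g7 := hΓ (by linarith : 0 < d)
  have g8 := hΓ (by linarith : 0 < d + k)
  have g9 := hΓ (by linarith : 0 < d + 2 * N)
  have g10 := hΓ (by linarith : 0 < d + 2 * N - 1)
  have g11 := hΓ (by linarith : 0 < d + 2 * l - 1)
  have g12 := hΓ (by linarith : 0 < d + k + N + q)
  have g13 := hΓ (by linarith : 0 < d + k + l + q)
  have g14 := hΓ (by linarith : 0 < d + k + 2 * q - 1)
  have g15 : d + k + 2 * q - 1 ≠ 0 := by linarith
  have g16 := hΓ (by linarith : 0 < b + 1 + N)
  have g17 := hΓ (by linarith : 0 < (b + 3) / 2 + i)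
  have g18 := hΓ (by linarith : 0 < (a + 3) / 2 + i)
  have g19 := hΓ (by linarith : 0 < (d + 1) / 2 + i)
  have g20 := hΓ (by linarith : 0 < 3 / 2 + (i : ℝ))
  have g21 : oddGamma a b d i ≠ 0 := mul_ne_zero (mul_ne_zero (mul_ne_zero g20 g18) g17) g19
  have h1 := oddVal_div_hn_one_eq ha' hb hd hd1 i p
  rw [← hl, ← hN, show d + 4 * (i : ℝ) + 2 = d + 2 * l - 1 + 1 by linarith,
    show d + 4 * (p : ℝ) + 2 = d + 2 * N by linarith,
    Gamma_add_one (show d + 2 * (l : ℝ) - 1 ≠ 0 by linarith)] at h1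
  have h2 : l - q = c := by omega
  have h3 : N - q = c + 2 * j := by omega
  have h4 := symplecticCoeff_eq (k := k) ha hb hd hl hN hj hc
  rw [mul_left_comm 2, h4, h1, mu_one_eq ha' (by linarith), conn_one_eq ha' hb hd hd1 k (by omega),
    conn_one_eq ha' hb hd hd1 k (by omega), h2, h3,
    hn_one_eq (a := a + k) (b := b) (d := d + k) (by linarith) hb (by linarith) (by linarith),
    hn_one_eq ha' hb hd hd1, show a + (k : ℝ) + 1 = a + 1 + k by ring,
    show d + k + 2 * (q : ℝ) = d + k + 2 * q - 1 + 1 by ring,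
    Gamma_add_one (show d + k + 2 * (q : ℝ) - 1 ≠ 0 by linarith), sub_add_cancel]
  clear g17 g18 g19 g20 h1 h4
  generalize oddGamma a b d i = O₁ at g21 ⊢
  generalize oddGamma a b d p = O₂ at ⊢
  generalize Gamma (b + 1 + (q : ℝ)) = x1 at g1 ⊢
  generalize Gamma (a + 1 + (N : ℝ)) = x2 at g2 ⊢
  generalize Gamma (d + (N : ℝ) - 1) = x3 at g3 ⊢
  generalize Gamma (a + 1 + (k : ℝ)) = x4 at g4 ⊢
  generalize Gamma (a + 1) = x5 at g5 ⊢
  generalize Gamma (b + 1) = x6 at g6 ⊢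
  generalize Gamma (d) = x7 at g7 ⊢
  generalize Gamma (d + (k : ℝ)) = x8 at g8 ⊢
  generalize Gamma (d + 2 * (N : ℝ)) = x9 at g9 ⊢
  generalize Gamma (d + 2 * (N : ℝ) - 1) = x10 at g10 ⊢
  generalize Gamma (d + 2 * (l : ℝ) - 1) = x11 at g11 ⊢
  generalize Gamma (d + k + N + (q : ℝ)) = x12 at g12 ⊢
  generalize Gamma (d + k + l + (q : ℝ)) = x13 at g13 ⊢
  generalize Gamma (d + k + 2 * (q : ℝ) - 1) = x14 at g14 ⊢
  generalize Gamma (b + 1 + (N : ℝ)) = x16 at g16 ⊢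
  generalize d + k + 2 * (q : ℝ) - 1 = v at g15 ⊢
  field_simp

end JacobiMatching

end ClassicalEnsemble

/-! ### Jacobi case: matching with the single sum and with the correction term. -/

namespace ClassicalEnsemble

section JacobiMatching

open Finset Real BallisticCavity

variable {a b d x : ℝ} {i p j k l m n N : ℕ}

lemma Gamma_add_two_mul_nat_div (hx : 0 < x) (j : ℕ) : Gamma (x + 2 * j) / Gamma x =
    4 ^ j * (Gamma (x / 2 + j) / Gamma (x / 2)) * (Gamma ((x + 1) / 2 + j) / Gamma ((x + 1) / 2)) := by
  have h1 := (Gamma_pos_of_pos hx).ne'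
  have h2 := (Gamma_pos_of_pos (by linarith : 0 < x / 2)).ne'
  have h3 := (Gamma_pos_of_pos (by linarith : 0 < (x + 1) / 2)).ne'
  have h := Gamma_add_two_mul_nat hx j
  field_simp at h ⊢
  linear_combination h

lemma Gamma_eq_half_mul_half (x : ℝ) :
    Gamma x = Gamma (x / 2) * Gamma ((x + 1) / 2) * 2 ^ (x - 1) / √π := by
  rw [eq_div_iff (sqrt_pos.2 pi_pos).ne']
  symm
  have h := Gamma_mul_Gamma_add_half (x / 2)
  rw [show 2 * (x / 2) = x by ring, show x / 2 + 1 / 2 = (x + 1) / 2 by ring] at h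
  rw [h, mul_right_comm _ (2 ^ (1 - x)), mul_assoc (Gamma x * √π), ← rpow_add two_pos]
  simp

-- The shift by `x ^ (2k)` from degree `N` down to `l = N - 2j` supplies the binomial coefficient of
-- `2k` over `2j`. The duplication formula at `a + 1`, `b + 1 + l` and `l + 1` splits the rest into
-- half arguments.
set_option maxHeartbeats 1000000 in
lemma jacobi_single_term (ha : 0 ≤ a) (hb : -1 < b) (hd : d = a + b + 2) (hl : l = 2 * i + 1)
    (hN : N = 2 * p + 1) (hj : l + 2 * j = N) (hm : (m : ℝ) = a + N + 1) (hn : n = N + 1) :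
    rho 1 a d k * mu 1 a d (2 * k) *
      (conn 1 N l a d (2 * k) * oddVal 1 (a + 2 * k) (d + 2 * k) i) / oddVal 1 a d p =
    ((2 * k).choose (2 * j) : ℝ) * orthogonalCoeff (b - 1) j k m n := by
  have hΓ : ∀ {y : ℝ}, 0 < y → Gamma y ≠ 0 := fun hy => (Gamma_pos_of_pos hy).ne'
  have hi0 : (0 : ℝ) ≤ i := Nat.cast_nonneg i
  have hj0 : (0 : ℝ) ≤ j := Nat.cast_nonneg j
  have hk0 : (0 : ℝ) ≤ k := Nat.cast_nonneg k
  have hl' : (l : ℝ) = 2 * i + 1 := by rw [hl]; push_cast; ring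
  have hN' : (N : ℝ) = l + 2 * j := by rw [← hj]; push_cast; ring
  have hpi : p = i + j := by omega
  have hp' : (p : ℝ) = i + j := by rw [hpi]; push_cast; ring
  have hn' : (n : ℝ) = N + 1 := by rw [hn]; push_cast; ring
  have ha' : -1 < a := by linarith
  have hd1 : 1 < d := by linarith
  have hlN : l ≤ N := by omega
  have hNl : N - l = 2 * j := by omega
  have g1 := hΓ (by linarith : 0 < d / 2)
  have g2 := hΓ (by linarith : 0 < (a + 1) / 2 + k)
  have g3 := hΓ (by linarith : 0 < (a + 1) / 2)
  have g4 := hΓ (by linarith : 0 < d + 2 * k)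
  have g5 := hΓ (by linarith : 0 < d + 2 * N - 1)
  have g6 := hΓ (by linarith : 0 < a / 2 + 1)
  have g7 := hΓ (by linarith : 0 < a / 2 + 1 + k)
  have g8 := hΓ (by linarith : 0 < b / 2 + 1)
  have g9 := hΓ (by linarith : 0 < d / 2 + k)
  have g10 := hΓ (by linarith : 0 < d + 2 * k + 2 * l - 1)
  have g11 := hΓ (by linarith : 0 < d)
  have g12 := hΓ (by linarith : 0 < a / 2 + 1 + p)
  have g13 := hΓ (by linarith : 0 < b / 2 + 1 + p)
  have g14 := hΓ (by linarith : 0 < d / 2 + p)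
  have g15 := hΓ (by linarith : 0 < (b + 3) / 2 + i)
  have g16 := hΓ (by linarith : 0 < (b + 3) / 2 + p)
  have g17 := hΓ (by linarith : 0 < 3 / 2 + (i : ℝ))
  have g18 := hΓ (by linarith : 0 < 3 / 2 + (p : ℝ))
  have g19 := hΓ (by linarith : 0 < d + 2 * k + N + l)
  have g20 := hΓ (by linarith : 0 < b / 2 + 1 + i)
  have g21 := hΓ (by linarith : 0 < d + N + l - 1)
  have g22 : d + 2 * k + 2 * l - 1 ≠ 0 := by linarith
  have q1 : poch ((b - 1 + m + 1) / 2) ((k : ℤ) - j) =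
      Gamma (d / 2 + k + i) / Gamma (d / 2 + p) :=
    poch_eq (by push_cast; linarith only [hl', hN', hn', hm, hd])
      (by linarith only [hl', hN', hp', hn', hm, hd])
  have q2 : poch ((m : ℝ) / 2) ((k : ℤ) - j) =
      Gamma (a / 2 + 1 + k + i) / Gamma (a / 2 + 1 + p) :=
    poch_eq (by push_cast; linarith only [hl', hN', hn', hm, hd])
      (by linarith only [hl', hN', hp', hn', hm, hd])
  have q3 : poch (b - 1 + m + n - 2 * j) (2 * (k : ℤ) + 1) =
      Gamma (d + 2 * k + N + l) / Gamma (d + N + l - 1) :=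
    poch_eq (by push_cast; linarith only [hl', hN', hn', hm, hd])
      (by linarith only [hl', hN', hp', hn', hm, hd])
  have q4 : poch ((b - 1 + n + 2) / 2) (-(j : ℤ)) =
      Gamma ((b + 3) / 2 + i) / Gamma ((b + 3) / 2 + p) :=
    poch_eq (by push_cast; linarith only [hl', hN', hn', hm, hd])
      (by linarith only [hl', hN', hp', hn', hm, hd])
  have q5 : poch ((1 + (n : ℝ)) / 2) (-(j : ℤ)) = Gamma (3 / 2 + i) / Gamma (3 / 2 + p) :=
    poch_eq (by push_cast; linarith only [hl', hN', hn', hm, hd])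
      (by linarith only [hl', hN', hp', hn', hm, hd])
  have q6 : b - 1 + (m : ℝ) + n - 4 * j + 2 * k = d + 2 * k + 2 * l - 1 := by
    linarith only [hl', hN', hn', hm, hd]
  have r1 := Gamma_add_two_mul_nat_div (by linarith : 0 < a + 1) k
  rw [show (a + 1 + 1) / 2 = a / 2 + 1 by ring] at r1
  have r2 := Gamma_add_two_mul_nat_div (by linarith : 0 < b + 1 + l) j
  rw [show b + 1 + l + 2 * (j : ℝ) = b + 1 + N by rw [hN']; ring,
    show (b + 1 + l) / 2 + (j : ℝ) = b / 2 + 1 + p by rw [hp', hl']; ring,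
    show (b + 1 + (l : ℝ)) / 2 = b / 2 + 1 + i by rw [hl']; ring,
    show (b + 1 + l + 1) / 2 + (j : ℝ) = (b + 3) / 2 + p by rw [hp', hl']; ring,
    show (b + 1 + (l : ℝ) + 1) / 2 = (b + 3) / 2 + i by rw [hl']; ring] at r2
  have r3 := Gamma_add_two_mul_nat_div (by linarith : 0 < (l : ℝ) + 1) j
  rw [show (l : ℝ) + 1 + 2 * j = N + 1 by rw [hN']; ring,
    show ((l : ℝ) + 1) / 2 + j = p + 1 by rw [hp', hl']; ring,
    show ((l : ℝ) + 1) / 2 = i + 1 by rw [hl']; ring,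
    show ((l : ℝ) + 1 + 1) / 2 + j = 3 / 2 + p by rw [hp', hl']; ring,
    show ((l : ℝ) + 1 + 1) / 2 = 3 / 2 + i by rw [hl']; ring,
    Gamma_nat_eq_factorial, Gamma_nat_eq_factorial, Gamma_nat_eq_factorial,
    Gamma_nat_eq_factorial] at r3
  have hk2 := conn_one_eq ha' hb hd hd1 (2 * k) hlN
  rw [hNl, r2, r3] at hk2
  push_cast at hk2
  have hmu := mu_one_eq (k := 2 * k) ha' (by linarith : 0 < d)
  push_cast at hmu
  rw [r1] at hmu
  have hβ := oddVal_one_eq (a := a + 2 * k) (d := d + 2 * k) (by linarith) hb (by linarith)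
    (by linarith) i
  rw [show (a + 2 * (k : ℝ)) / 2 + 1 = a / 2 + 1 + k by ring,
    show (d + 2 * (k : ℝ)) / 2 = d / 2 + k by ring,
    show d + 2 * k + 4 * (i : ℝ) + 1 = d + 2 * k + 2 * l - 1 by rw [hl']; ring] at hβ
  have hβp := oddVal_one_eq ha' hb hd hd1 p
  rw [show d + 4 * (p : ℝ) + 1 = d + 2 * N - 1 by rw [hN', hp', hl']; ring] at hβp
  have h16 : (16 : ℝ) ^ p = 16 ^ i * (4 ^ j * 4 ^ j) := by
    rw [hpi, pow_add, ← mul_pow]; norm_num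
  rw [hk2, hmu, hβ, hβp, rho_one_eq ha' (by linarith), orthogonalCoeff, q1, q2, q3, q4, q5, q6, h16,
    show d + 2 * k + 2 * (l : ℝ) = d + 2 * k + 2 * l - 1 + 1 by ring, Gamma_add_one g22,
    sub_add_cancel, show d + 2 * (k : ℝ) + N + l = d + 2 * k + N + l by ring]
  clear q1 q2 q3 q4 q5 q6 r1 r2 r3 hk2 hmu hβ hβp h16
  generalize Gamma (d / 2) = x1 at g1 ⊢
  generalize Gamma ((a + 1) / 2 + k) = x2 at g2 ⊢
  generalize Gamma ((a + 1) / 2) = x3 at g3 ⊢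
  generalize Gamma (d + 2 * k) = x4 at g4 ⊢
  generalize Gamma (d + 2 * N - 1) = x5 at g5 ⊢
  generalize Gamma (a / 2 + 1) = x6 at g6 ⊢
  generalize Gamma (a / 2 + 1 + k) = x7 at g7 ⊢
  generalize Gamma (b / 2 + 1) = x8 at g8 ⊢
  generalize Gamma (d / 2 + k) = x9 at g9 ⊢
  generalize Gamma (d + 2 * k + 2 * l - 1) = x10 at g10 ⊢
  generalize Gamma (d) = x11 at g11 ⊢
  generalize Gamma (a / 2 + 1 + p) = x12 at g12 ⊢
  generalize Gamma (b / 2 + 1 + p) = x13 at g13 ⊢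
  generalize Gamma (d / 2 + p) = x14 at g14 ⊢
  generalize Gamma ((b + 3) / 2 + i) = x15 at g15 ⊢
  generalize Gamma ((b + 3) / 2 + p) = x16 at g16 ⊢
  generalize Gamma (3 / 2 + (i : ℝ)) = x17 at g17 ⊢
  generalize Gamma (3 / 2 + (p : ℝ)) = x18 at g18 ⊢
  generalize Gamma (d + 2 * k + N + l) = x19 at g19 ⊢
  generalize Gamma (b / 2 + 1 + i) = x20 at g20 ⊢
  generalize Gamma (d + N + l - 1) = x21 at g21 ⊢
  field_simp

/-- For `N > s` the product has a zero factor, while the right side divides by Gamma at a pole,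
whose assigned value `0` makes the quotient `0`. -/
lemma prod_natCast_sub_eq_Gamma (s N : ℕ) :
    ∏ t ∈ range N, ((s : ℝ) - t) = Gamma (s + 1) / Gamma (s + 1 - N) := by
  rw [prod_natCast_sub, Gamma_nat_eq_factorial]
  rcases le_or_gt N s with h | h
  · rw [show (s : ℝ) + 1 - N = ((s - N : ℕ) : ℝ) + 1 by rw [Nat.cast_sub h]; ring,
      Gamma_nat_eq_factorial, ← Nat.choose_mul_factorial_mul_factorial h]
    push_cast
    have : ((s - N).factorial : ℝ) ≠ 0 := by positivity
    field_simp
  · rw [Nat.choose_eq_zero_of_lt h, show (s : ℝ) + 1 - N = -((N - (s + 1) : ℕ) : ℝ) by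
      rw [Nat.cast_sub h]; push_cast; ring, Gamma_neg_nat_eq_zero]
    simp

-- The `i`-th image of the operator corresponds to the summand `j = i + 1` of `phiJ`.
set_option maxHeartbeats 1000000 in
lemma jacobi_boundary_term (ha : 0 ≤ a) (hb : -1 < b) (hd : d = a + b + 2)
    (hN : N = 2 * p + 1) (hm : (m : ℝ) = a + N + 1) (hn : n = N + 1) :
    2 * rho 1 a d i / (a + 1 + 2 * i) *
      (2 * (mu 1 a d (i + k) * d0 1 N a d (i + k))) / oddVal 1 a d p =
    (2 : ℝ) ^ (b - 1 + 2) * Gamma ((b - 1 + m - n + 2 * (i + 1 : ℕ) + 1) / 2) *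
        Gamma ((b - 1 + m + 2) / 2) / (Gamma (b - 1 + 1 + m + (i + 1 : ℕ) + k) *
          Gamma (((i + 1 : ℕ) : ℝ) + k + 1 - n) * Gamma (((m : ℝ) - n + 1 + 2 * (i + 1 : ℕ)) / 2)) *
      (Gamma ((b - 1 + n + 2) / 2) * Gamma ((m : ℝ) - n + k + (i + 1 : ℕ)) *
          Gamma (((i + 1 : ℕ) : ℝ) + k) /
        (Gamma ((m : ℝ) / 2) * Gamma ((b - 1) / 2 + 1) * Gamma ((n : ℝ) / 2))) := by
  have hΓ : ∀ {y : ℝ}, 0 < y → Gamma y ≠ 0 := fun hy => (Gamma_pos_of_pos hy).ne'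
  have hi0 : (0 : ℝ) ≤ i := Nat.cast_nonneg i
  have hp0 : (0 : ℝ) ≤ p := Nat.cast_nonneg p
  have hk0 : (0 : ℝ) ≤ k := Nat.cast_nonneg k
  have hN' : (N : ℝ) = 2 * p + 1 := by rw [hN]; push_cast; ring
  have hn' : (n : ℝ) = 2 * p + 2 := by rw [hn]; push_cast; rw [hN']; ring
  have ha' : -1 < a := by linarith
  have hd1 : 1 < d := by linarith
  have e1 : (a + 1) / 2 + i ≠ 0 := by linarith
  have g1 := hΓ (by linarith : 0 < d / 2)
  have g2 := hΓ (by linarith : 0 < (a + 1) / 2 + i)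
  have g3 := hΓ (by linarith : 0 < (a + 1) / 2)
  have g4 := hΓ (by linarith : 0 < d + i + k)
  have g5 := hΓ (by linarith : 0 < d + 2 * N - 1)
  have g6 := hΓ (by linarith : 0 < a / 2 + 1)
  have g7 := hΓ (by linarith : 0 < b / 2 + 1)
  have g8 := hΓ (by linarith : 0 < d)
  have g9 := hΓ (by linarith : 0 < a / 2 + 1 + p)
  have g10 := hΓ (by linarith : 0 < b / 2 + 1 + p)
  have g11 := hΓ (by linarith : 0 < d / 2 + p)
  have g12 := hΓ (by linarith : 0 < (b + 1) / 2)
  have g13 := hΓ (by linarith : 0 < d + i + k + N)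
  have g14 : √π ≠ 0 := (sqrt_pos.2 pi_pos).ne'
  have e2 : (2 : ℝ) ^ a ≠ 0 := (rpow_pos_of_pos two_pos a).ne'
  have e3 : (2 : ℝ) ^ b ≠ 0 := (rpow_pos_of_pos two_pos b).ne'
  have r1 := Gamma_eq_half_mul_half (a + 1)
  rw [show (a + 1 + 1) / 2 = a / 2 + 1 by ring, add_sub_cancel_right] at r1
  have r2 := Gamma_eq_half_mul_half (b + 1)
  rw [show (b + 1 + 1) / 2 = b / 2 + 1 by ring, add_sub_cancel_right] at r2
  have r3 := Gamma_eq_half_mul_half (b + 1 + N)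
  rw [show (b + 1 + N) / 2 = b / 2 + 1 + p by rw [hN']; ring,
    show (b + 1 + N + 1) / 2 = (b + 3) / 2 + p by rw [hN']; ring,
    show b + 1 + N - 1 = b + (1 + (2 * p : ℕ)) by rw [hN']; push_cast; ring, rpow_add two_pos,
    rpow_add two_pos, rpow_natCast, pow_mul, rpow_one] at r3
  have r4 := Gamma_eq_half_mul_half (d + N - 1)
  rw [show (d + N - 1) / 2 = d / 2 + p by rw [hN']; ring,
    show (d + N - 1 + 1) / 2 = (d + 1) / 2 + p by rw [hN']; ring,
    show d + N - 1 - 1 = a + (b + (1 + (2 * p : ℕ))) by rw [hN', hd]; push_cast; ring,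
    rpow_add two_pos, rpow_add two_pos, rpow_add two_pos, rpow_natCast, pow_mul, rpow_one] at r4
  have hmu := mu_one_eq (k := i + k) ha' (by linarith : 0 < d)
  push_cast at hmu
  rw [r1, ← add_assoc, ← add_assoc] at hmu
  have hprod := prod_natCast_sub_eq_Gamma (i + k) N
  push_cast at hprod
  have hd0 := d0_one_eq ha' hb hd hd1 (s := i + k) (by linarith) N
  rw [hprod, r2, r3, r4, ← add_assoc] at hd0
  have hβ := oddVal_one_eq ha' hb hd hd1 p
  rw [show d + 4 * (p : ℝ) + 1 = d + 2 * N - 1 by rw [hN']; ring] at hβ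
  have h16 : (16 : ℝ) ^ p = (2 ^ 2) ^ p * (2 ^ 2) ^ p := by rw [← mul_pow]; norm_num
  have h2 : (2 : ℝ) ^ (b - 1 + 2) = 2 ^ b * 2 := by
    rw [← rpow_add_one two_ne_zero]; congr 1; ring
  push_cast
  rw [show (b - 1 + m - n + 2 * ((i : ℝ) + 1) + 1) / 2 = d / 2 + i by rw [hm, hn', hN', hd]; ring,
    show (b - 1 + (m : ℝ) + 2) / 2 = (d + 1) / 2 + p by rw [hm, hN', hd]; ring,
    show b - 1 + 1 + m + ((i : ℝ) + 1) + k = d + i + k + N by rw [hm, hN', hd]; ring,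
    show (i : ℝ) + 1 + k + 1 - n = i + k + 1 - N by rw [hn', hN']; ring,
    show ((m : ℝ) - n + 1 + 2 * (i + 1)) / 2 = (a + 1) / 2 + i + 1 by rw [hm, hn', hN']; ring,
    show (b - 1 + (n : ℝ) + 2) / 2 = (b + 3) / 2 + p by rw [hn']; ring,
    show (m : ℝ) - n + k + (i + 1) = a + 1 + i + k by rw [hm, hn', hN']; ring,
    show (i : ℝ) + 1 + k = i + k + 1 by ring,
    show (m : ℝ) / 2 = a / 2 + 1 + p by rw [hm, hN']; ring,
    show (b - 1) / 2 + 1 = (b + 1) / 2 by ring,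
    show (n : ℝ) / 2 = p + 1 by rw [hn']; ring,
    show a + 1 + 2 * (i : ℝ) = ((a + 1) / 2 + i) * 2 by ring,
    Gamma_add_one e1, Gamma_nat_eq_factorial, hmu, hd0, hβ, rho_one_eq ha' (by linarith), h16, h2]
  have g15 : (p.factorial : ℝ) ≠ 0 := by positivity
  clear hmu hd0 hβ hprod r1 r2 r3 r4 h16 h2
  generalize (2 : ℝ) ^ a = y1 at e2 ⊢
  generalize (2 : ℝ) ^ b = y2 at e3 ⊢
  generalize √π = y3 at g14 ⊢
  generalize Gamma ((i : ℝ) + k + 1 - N) = y4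
  -- The only Gamma value that can sit at a pole; it stands in a denominator on both sides, which
  -- then are both zero.
  rcases eq_or_ne y4 0 with rfl | g16
  · simp
  generalize Gamma (d / 2) = x1 at g1 ⊢
  generalize Gamma ((a + 1) / 2 + i) = x2 at g2 ⊢
  generalize Gamma ((a + 1) / 2) = x3 at g3 ⊢
  generalize Gamma (d + i + k) = x4 at g4 ⊢
  generalize Gamma (d + 2 * N - 1) = x5 at g5 ⊢
  generalize Gamma (a / 2 + 1) = x6 at g6 ⊢
  generalize Gamma (b / 2 + 1) = x7 at g7 ⊢
  generalize Gamma (d) = x8 at g8 ⊢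
  generalize Gamma (a / 2 + 1 + p) = x9 at g9 ⊢
  generalize Gamma (b / 2 + 1 + p) = x10 at g10 ⊢
  generalize Gamma (d / 2 + p) = x11 at g11 ⊢
  generalize Gamma ((b + 1) / 2) = x12 at g12 ⊢
  generalize Gamma (d + i + k + N) = x13 at g13 ⊢
  generalize (a + 1) / 2 + (i : ℝ) = u at e1 ⊢
  field_simp
  ring

/-- Since `j ≤ k`, the argument `j + k + 1 - n` is a non-positive integer in every summand. -/
lemma phiJ_eq_zero {δ : ℝ} (h : 2 * k < n) : phiJ δ k n m = 0 := by
  refine sum_eq_zero fun j hj => ?_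
  have hj' := mem_Icc.1 hj
  rw [show (j : ℝ) + k + 1 - n = -((n - (j + k + 1) : ℕ) : ℝ) by
    rw [Nat.cast_sub (by omega)]; push_cast; ring, Gamma_neg_nat_eq_zero]
  simp

end JacobiMatching

end ClassicalEnsemble

/-! ### Assembly of the transmission moments. -/

namespace ClassicalEnsemble

section TransmissionMoments

open Finset BallisticCavity

variable {k n m p N : ℕ}

lemma sum_range_eq_sum_Icc_one {M : Type*} [AddCommMonoid M] (f : ℕ → M) (p : ℕ) :
    ∑ i ∈ range p, f i = ∑ j ∈ Icc 1 p, f (p - j) := by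
  refine sum_bij' (fun i _ => p - i) (fun j _ => p - j) ?_ ?_ ?_ ?_ ?_
  · intro i hi; rw [mem_range] at hi; rw [mem_Icc]; omega
  · intro j hj; rw [mem_Icc] at hj; rw [mem_range]; omega
  · intro i hi; rw [mem_range] at hi; omega
  · intro j hj; rw [mem_Icc] at hj; omega
  · intro i hi; rw [mem_range] at hi; congr 1; omega

lemma sum_range_eq_sum_Icc_zero {M : Type*} [AddCommMonoid M] (f : ℕ → M) (p : ℕ) :
    ∑ i ∈ range (p + 1), f i = ∑ j ∈ Icc 0 p, f (p - j) := by
  refine sum_bij' (fun i _ => p - i) (fun j _ => p - j) ?_ ?_ ?_ ?_ ?_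
  · intro i hi; rw [mem_range] at hi; rw [mem_Icc]; omega
  · intro j hj; rw [mem_Icc] at hj; rw [mem_range]; omega
  · intro i hi; rw [mem_range] at hi; omega
  · intro j hj; rw [mem_Icc] at hj; omega
  · intro i hi; rw [mem_range] at hi; congr 1; omega

/-- The truncations at `k`, `k / 2` and `k - 2j` only remove summands in which a binomial
coefficient is zero. -/
lemma sum_Icc_min {M : Type*} [AddCommMonoid M] {f : ℕ → M} {x y z : ℕ}
    (h : ∀ j, x ≤ j → z < j → f j = 0) : ∑ j ∈ Icc x (min y z), f j = ∑ j ∈ Icc x y, f j := by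
  refine sum_subset (Icc_subset_Icc_right (min_le_left _ _)) fun j hj hj' => ?_
  rw [mem_Icc] at hj hj'
  exact h j hj.1 (by omega)

lemma jacobi_double_sum {a b d : ℝ} (ha : 0 ≤ a) (hb : -1 < b) (hd : d = a + b + 2) (k p : ℕ) :
    (∑ i ∈ range p, oddVal 1 a d i / hn 1 (2 * i + 1) a d * (mu 1 a d k *
      ∑ q ∈ range (2 * i + 2), conn 1 (2 * i + 1) q a d k * conn 1 (2 * p + 1) q a d k *
        hn 1 q (a + k) (d + k))) / oddVal 1 a d p =
    2 * ∑ j ∈ Icc 1 (min p (k / 2)), ∑ c ∈ Icc 0 (min (k - 2 * j) (2 * p + 1 - 2 * j)),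
      (k.choose c : ℝ) * (k.choose (c + 2 * j) : ℝ) *
        symplecticCoeff (2 * b + 2) c j k ((a + (2 * p + 1 : ℕ)) / 2) (((2 * p + 1 : ℕ) : ℝ) / 2) := by
  have hzero : ∀ c j : ℕ, k < c + 2 * j → (k.choose c : ℝ) * (k.choose (c + 2 * j) : ℝ) *
      symplecticCoeff (2 * b + 2) c j k ((a + (2 * p + 1 : ℕ)) / 2) (((2 * p + 1 : ℕ) : ℝ) / 2) = 0 := by
    intro c j h
    rw [Nat.choose_eq_zero_of_lt h]
    simp
  rw [sum_Icc_min fun j _ hj => sum_eq_zero fun c _ => hzero _ _ (by omega), sum_div,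
    sum_range_eq_sum_Icc_one, mul_sum]
  refine sum_congr rfl fun j hj => ?_
  rw [mem_Icc] at hj
  rw [min_comm, sum_Icc_min fun c _ hc => hzero _ _ (by omega), mul_sum, mul_sum, mul_sum, sum_div,
    sum_range_eq_sum_Icc_zero, show 2 * (p - j) + 1 = 2 * p + 1 - 2 * j by omega]
  refine sum_congr rfl fun c hc => ?_
  rw [mem_Icc] at hc
  rw [← jacobi_double_term (i := p - j) (q := 2 * p + 1 - 2 * j - c) (l := 2 * p + 1 - 2 * j)
    ha hb hd (by omega) rfl (by omega) (by omega)]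
  ring

lemma jacobi_single_sum {a b d : ℝ} (ha : 0 ≤ a) (hb : -1 < b) (hd : d = a + b + 2) (k p : ℕ)
    (hm : (m : ℝ) = a + (2 * p + 1 : ℕ) + 1) :
    (rho 1 a d k * mu 1 a d (2 * k) * ∑ i ∈ range (p + 1),
      conn 1 (2 * p + 1) (2 * i + 1) a d (2 * k) * oddVal 1 (a + 2 * k) (d + 2 * k) i) /
        oddVal 1 a d p =
    ∑ j ∈ Icc 0 (min p k), ((2 * k).choose (2 * j) : ℝ) *
      orthogonalCoeff (b - 1) j k m (2 * (p + 1)) := by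
  rw [sum_Icc_min fun j _ hj => by rw [Nat.choose_eq_zero_of_lt (by omega)]; simp, mul_sum, sum_div,
    sum_range_eq_sum_Icc_zero]
  refine sum_congr rfl fun j hj => ?_
  rw [mem_Icc] at hj
  exact jacobi_single_term ha hb hd rfl rfl (by omega) hm (by omega)

lemma jacobi_boundary_sum {a b d : ℝ} (ha : 0 ≤ a) (hb : -1 < b) (hd : d = a + b + 2) (k p : ℕ)
    (hm : (m : ℝ) = a + (2 * p + 1 : ℕ) + 1) :
    (∑ i ∈ range k, 2 * rho 1 a d i / (a + 1 + 2 * i) *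
      (2 * (mu 1 a d (i + k) * d0 1 (2 * p + 1) a d (i + k)))) / oddVal 1 a d p =
    phiJ (b - 1) k (2 * (p + 1)) m := by
  have hIcc : Icc 1 k = Ico (0 + 1) (k + 1) := by ext; simp [mem_Icc, mem_Ico]
  rw [phiJ, sum_div, hIcc, ← sum_Ico_add', ← range_eq_Ico]
  refine sum_congr rfl fun i _ => ?_
  exact jacobi_boundary_term ha hb hd rfl hm (by omega)

/-- Moments of the transmission eigenvalues in the orthogonal symmetry class. -/
theorem transmissionMoment_one (k : ℕ) (hn : Even n) (hn0 : 0 < n) (hnm : n ≤ m) {δ : ℝ}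
    (hδ : -2 < δ) :
    AverageExists 1 (transmissionWeight 1 δ n m) (Set.Icc 0 1) n (fun T => T ^ k) ∧
      transmissionMoment 1 δ k n m =
        2 * halfSymplecticTransmission (2 * δ + 4) k (n - 1) (m - 1) +
          ∑ j ∈ Icc 0 (min (n / 2 - 1) k),
            ((2 * k).choose (2 * j) : ℝ) * orthogonalCoeff δ j k m n + phiJ δ k n m := by
  obtain ⟨p, rfl⟩ : ∃ p, n = 2 * (p + 1) := by
    obtain ⟨r, hr⟩ := hn
    exact ⟨r - 1, by omega⟩
  -- With `a = m - n` and `b = δ + 1` the `β = 1` exponents are `(a - 1) / 2` and `(b - 1) / 2`.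
  obtain ⟨a, ha⟩ : ∃ a : ℝ, (m : ℝ) - (2 * (p + 1) : ℕ) = a := ⟨_, rfl⟩
  have ha0 : 0 ≤ a := by
    rw [← ha, sub_nonneg]; exact_mod_cast hnm
  have hb : -1 < δ + 1 := by linarith
  have hm : (m : ℝ) = a + (2 * p + 1 : ℕ) + 1 := by rw [← ha]; push_cast; ring
  have hm' : ((m - 1 : ℕ) : ℝ) = a + (2 * p + 1 : ℕ) := by
    rw [Nat.cast_sub (by omega), hm]; push_cast; ring
  have hw : transmissionWeight 1 δ (2 * (p + 1)) m = jacobiWeight a (δ + 1) := by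
    funext T
    rw [transmissionWeight, jacobiWeight, ha]
    congr 2 <;> push_cast <;> ring
  -- The unitary weight in the symplectic expression at `(n - 1) / 2`, `(m - 1) / 2` is exactly `σ
  -- w²`.
  have hw2 : transmissionWeight 2 (2 * δ + 4 - 2) (2 * p + 1) (m - 1) =
      fun x => x ^ a * (1 - x) ^ (δ + 1) := by
    funext T
    rw [transmissionWeight, hm']
    congr 2 <;> push_cast <;> ring
  obtain ⟨h1, h2⟩ := average_one_jacobi (by linarith : -1 < a) hb rfl k p
  rw [transmissionMoment, hw]
  refine ⟨h1, h2.trans ?_⟩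
  rw [halfSymplecticTransmission, show 2 * (p + 1) - 1 = 2 * p + 1 by omega,
    show 2 * (p + 1) / 2 - 1 = p by omega, show (2 * p + 1) / 2 = p by omega,
    transmissionMoment, hw2, average_two_jacobi (by linarith : -1 < a) hb rfl, add_div, neg_div,
    add_div, jacobi_double_sum ha0 hb rfl, jacobi_single_sum ha0 hb rfl k p hm,
    jacobi_boundary_sum ha0 hb rfl k p hm, hm', add_sub_cancel_right,
    show 2 * (δ + 1) + 2 = 2 * δ + 4 by ring]
  ring

end TransmissionMoments

end ClassicalEnsemble

/-! ### Gamma function formulas in the Laguerre case. -/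

namespace ClassicalEnsemble

section ClosedForms

open Finset Real

variable {a r s : ℝ}

lemma mu_zero_eq (ha : -1 < a) (k : ℕ) :
    mu 0 a r k = Gamma (a + 1 + k) / Gamma (a + 1) / r ^ k := by
  simp only [mu, zero_mul, add_zero]
  rw [prod_div_distrib, prod_add_nat (by linarith), prod_const, card_range]

lemma rho_zero_eq (ha : -1 < a) (k : ℕ) :
    rho 0 a r k = r ^ k / (2 ^ k * (Gamma ((a + 1) / 2 + k) / Gamma ((a + 1) / 2))) := by
  simp only [rho, mul_zero, zero_mul, add_zero]
  rw [prod_div_distrib, prod_add_two_mul_nat (by linarith), prod_const, card_range]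

lemma hn_zero_eq (ha : -1 < a) (hr : 0 < r) (N : ℕ) :
    hn 0 N a r = N.factorial * (Gamma (a + 1 + N) / Gamma (a + 1)) / r ^ (2 * N) := by
  induction N generalizing a with
  | zero => simp [hn, (Gamma_pos_of_pos (by linarith : 0 < a + 1)).ne']
  | succ N ih =>
    have h1 := (Gamma_pos_of_pos (by linarith : 0 < a + 1)).ne'
    have h2 : a + 1 ≠ 0 := by linarith
    rw [hn, mul_zero, add_zero, zero_mul, add_zero, ih (by linarith), lam, Nat.factorial_succ,
      Gamma_add_one h2]
    push_cast
    rw [show a + 1 + 1 + (N : ℝ) = a + 1 + (N + 1) by ring]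
    field_simp
    ring

lemma d0_zero_eq (hr : 0 < r) (N : ℕ) (a s : ℝ) :
    d0 0 N a r s = (∏ t ∈ range N, (s - t)) / r ^ N := by
  induction N generalizing a s with
  | zero => simp [d0]
  | succ N ih =>
    rw [d0, zero_mul, add_zero, zero_mul, zero_mul, sub_zero, add_zero, div_self hr.ne', mul_zero,
      add_zero, ih, prod_range_succ',
      prod_congr rfl fun (t : ℕ) _ => show s - 1 - (t : ℝ) = s - (t + 1) by ring]
    push_cast
    field_simp
    ring

lemma conn_zero_eq (hr : 0 < r) (a : ℝ) (z : ℤ) {N M : ℕ} (h : M ≤ N) :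
    conn 0 N M a r z = N.factorial / M.factorial * ((Ring.choose z (N - M) : ℤ) : ℝ) /
      r ^ (N - M) := by
  rw [conn, mul_zero, zero_mul, add_zero, d0_zero_eq hr, prod_sub_eq_factorial_mul_choose,
    ← choose_mul_factorial_sub h]
  ring

lemma oddVal_zero_eq (ha : -1 < a) (hr : 0 < r) (i : ℕ) : oddVal 0 a r i =
    4 * 4 ^ i * i.factorial * (Gamma (a / 2 + 1 + i) / Gamma (a / 2 + 1)) / r ^ (2 * i + 1) := by
  have hadm : Adm 0 a r := ⟨le_rfl, ha, hr, by linarith⟩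
  have h1 := (Gamma_pos_of_pos (by linarith : 0 < a / 2 + 1)).ne'
  have h2 := (Gamma_pos_of_pos (by linarith : 0 < a + 1)).ne'
  induction i with
  | zero => rw [oddVal_zero, lead]; simp [h1]; field_simp; norm_num
  | succ i ih =>
    have hi : (0 : ℝ) ≤ i := Nat.cast_nonneg i
    have e1 : a / 2 + 1 + i ≠ 0 := by linarith
    have e2 : a + 1 + (2 * (i : ℝ) + 1) ≠ 0 := by linarith
    have h3 : hn 0 (2 * i + 1) a r ≠ 0 := (hn_pos hadm _).ne'
    have h4 : hn 0 (2 * i + 2) a r =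
        hn 0 (2 * i + 1) a r * ((2 * i + 2) * (a + 1 + (2 * i + 1)) / r ^ 2) := by
      rw [hn_zero_eq ha hr, hn_zero_eq ha hr, Nat.factorial_succ]
      push_cast
      rw [show a + 1 + (2 * (i : ℝ) + 2) = a + 1 + (2 * i + 1) + 1 by ring, Gamma_add_one e2]
      field_simp
      ring
    rw [oddVal_succ, ih, h4, lead, lead, Nat.factorial_succ]
    push_cast
    rw [← add_assoc (a / 2 + 1), Gamma_add_one e1]
    field_simp
    ring

end ClosedForms

end ClassicalEnsemble

/-! ### Laguerre case: matching with the double and the single sum. -/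

namespace ClassicalEnsemble

section LaguerreMatching

open Finset Real BallisticCavity

variable {a b r : ℝ} {i p j k l N q c n : ℕ}

lemma factorial_div_factorial_eq (hl : l = 2 * i + 1) (hN : N = 2 * p + 1) (hj : l + 2 * j = N) :
    (N.factorial : ℝ) / l.factorial =
      4 ^ j * (p.factorial / i.factorial) * (Gamma (3 / 2 + p) / Gamma (3 / 2 + i)) := by
  have hl' : (l : ℝ) = 2 * i + 1 := by rw [hl]; push_cast; ring
  have hN' : (N : ℝ) = l + 2 * j := by rw [← hj]; push_cast; ring
  have hp' : (p : ℝ) = i + j := by rw [show p = i + j by omega]; push_cast; ring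
  have hl0 : (0 : ℝ) ≤ l := Nat.cast_nonneg l
  have h := Gamma_add_two_mul_nat_div (by linarith : 0 < (l : ℝ) + 1) j
  rwa [show (l : ℝ) + 1 + 2 * j = N + 1 by rw [hN']; ring,
    show ((l : ℝ) + 1) / 2 + j = p + 1 by rw [hp', hl']; ring,
    show ((l : ℝ) + 1) / 2 = i + 1 by rw [hl']; ring,
    show ((l : ℝ) + 1 + 1) / 2 + j = 3 / 2 + p by rw [hp', hl']; ring,
    show ((l : ℝ) + 1 + 1) / 2 = 3 / 2 + i by rw [hl']; ring,
    Gamma_nat_eq_factorial, Gamma_nat_eq_factorial, Gamma_nat_eq_factorial,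
    Gamma_nat_eq_factorial] at h

lemma Gamma_div_Gamma_eq (ha : -1 < a) (hl : l = 2 * i + 1) (hN : N = 2 * p + 1)
    (hj : l + 2 * j = N) : Gamma (a + 1 + N) / Gamma (a + 1 + l) =
      4 ^ j * (Gamma (a / 2 + 1 + p) / Gamma (a / 2 + 1 + i)) *
        (Gamma ((a + 3) / 2 + p) / Gamma ((a + 3) / 2 + i)) := by
  have hl' : (l : ℝ) = 2 * i + 1 := by rw [hl]; push_cast; ring
  have hN' : (N : ℝ) = l + 2 * j := by rw [← hj]; push_cast; ring
  have hp' : (p : ℝ) = i + j := by rw [show p = i + j by omega]; push_cast; ring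
  have hl0 : (0 : ℝ) ≤ l := Nat.cast_nonneg l
  have h := Gamma_add_two_mul_nat_div (by linarith : 0 < a + 1 + l) j
  rwa [show a + 1 + l + 2 * (j : ℝ) = a + 1 + N by rw [hN']; ring,
    show (a + 1 + l) / 2 + (j : ℝ) = a / 2 + 1 + p by rw [hp', hl']; ring,
    show (a + 1 + (l : ℝ)) / 2 = a / 2 + 1 + i by rw [hl']; ring,
    show (a + 1 + l + 1) / 2 + (j : ℝ) = (a + 3) / 2 + p by rw [hp', hl']; ring,
    show (a + 1 + (l : ℝ) + 1) / 2 = (a + 3) / 2 + i by rw [hl']; ring] at h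

lemma oddVal_div_hn_zero_eq (ha : -1 < a) (hr : 0 < r) (hl : l = 2 * i + 1) (hN : N = 2 * p + 1)
    (hj : l + 2 * j = N) : oddVal 0 a r i / hn 0 l a r / oddVal 0 a r p =
      4 ^ j * (Gamma (3 / 2 + p) / Gamma (3 / 2 + i)) *
        (Gamma ((a + 3) / 2 + p) / Gamma ((a + 3) / 2 + i)) * Gamma (a + 1) /
          (N.factorial * Gamma (a + 1 + N)) * r ^ (l + N) := by
  have hΓ : ∀ {y : ℝ}, 0 < y → Gamma y ≠ 0 := fun hy => (Gamma_pos_of_pos hy).ne'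
  have hi0 : (0 : ℝ) ≤ i := Nat.cast_nonneg i
  have hp0 : (0 : ℝ) ≤ p := Nat.cast_nonneg p
  have hl0 : (0 : ℝ) ≤ l := Nat.cast_nonneg l
  have hN0 : (0 : ℝ) ≤ N := Nat.cast_nonneg N
  have hf : (N.factorial : ℝ) ≠ 0 := by positivity
  have hf' : (i.factorial : ℝ) ≠ 0 := by positivity
  have hf'' : (l.factorial : ℝ) ≠ 0 := by positivity
  have hf3 : (p.factorial : ℝ) ≠ 0 := by positivity
  have g1 := hΓ (by linarith : 0 < a / 2 + 1)
  have g2 := hΓ (by linarith : 0 < a + 1)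
  have g3 := hΓ (by linarith : 0 < a + 1 + l)
  have g4 := hΓ (by linarith : 0 < a + 1 + N)
  have g5 := hΓ (by linarith : 0 < a / 2 + 1 + i)
  have g6 := hΓ (by linarith : 0 < a / 2 + 1 + p)
  have g7 := hΓ (by linarith : 0 < (a + 3) / 2 + i)
  have g8 := hΓ (by linarith : 0 < 3 / 2 + (i : ℝ))
  have g9 := hΓ (by linarith : 0 < (a + 3) / 2 + p)
  have h1 := factorial_div_factorial_eq hl hN hj
  have h2 := Gamma_div_Gamma_eq ha hl hN hj
  have hp : (4 : ℝ) ^ p = 4 ^ i * 4 ^ j := by rw [← pow_add]; congr 1; omega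
  rw [div_eq_iff hf''] at h1
  rw [div_eq_iff g3] at h2
  rw [oddVal_zero_eq ha hr, oddVal_zero_eq ha hr, hn_zero_eq ha hr, ← hl, ← hN, h1, h2, hp, pow_add,
    pow_mul', pow_two]
  clear h1 h2 hp
  generalize Gamma (a / 2 + 1) = x1 at g1 ⊢
  generalize Gamma (a + 1) = x2 at g2 ⊢
  generalize Gamma (a + 1 + l) = x3 at g3 ⊢
  generalize Gamma (a + 1 + N) = x4 at g4 ⊢
  generalize Gamma (a / 2 + 1 + i) = x5 at g5 ⊢
  generalize Gamma (a / 2 + 1 + p) = x6 at g6 ⊢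
  generalize Gamma ((a + 3) / 2 + i) = x7 at g7 ⊢
  generalize Gamma (3 / 2 + (i : ℝ)) = x8 at g8 ⊢
  generalize Gamma ((a + 3) / 2 + p) = x9 at g9 ⊢
  field_simp

-- As in the Jacobi case, but with shift `-k`, which produces generalised binomial coefficients. All
-- powers of the rate combine to `r ^ k`.
set_option maxHeartbeats 1000000 in
lemma laguerre_double_term (hab : a = 2 * b) (ha : -1 < a - 2 * k) (hr : 0 < r) (hl : l = 2 * i + 1)
    (hN : N = 2 * p + 1) (hj : l + 2 * j = N) (hc : q + c = l) :
    oddVal 0 a r i / hn 0 l a r / oddVal 0 a r p *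
      (mu 0 (a - 2 * k) r k / mu 0 (a - 2 * k) r (2 * k) *
        (conn 0 l q a r (-k) * conn 0 N q a r (-k) * hn 0 q (a - k) r)) =
    r ^ k * ((2 : ℝ) ^ (1 - (k : ℤ)) *
      (((Ring.choose (-(k : ℤ)) c : ℤ) : ℝ) * ((Ring.choose (-(k : ℤ)) (c + 2 * j) : ℤ) : ℝ) *
        (poch (2 * b + N) (-(k : ℤ) - c - 2 * j + 1) * poch ((N : ℝ) - c - 2 * j + 1) c /
          ((2 : ℝ) ^ (-(k : ℤ) - 2 * (j : ℤ) + 2) * poch ((N : ℝ) / 2 + 1) (-(j : ℤ)) *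
            poch (b + (N : ℝ) / 2) (1 - (j : ℤ)))))) := by
  have hΓ : ∀ {y : ℝ}, 0 < y → Gamma y ≠ 0 := fun hy => (Gamma_pos_of_pos hy).ne'
  have hi0 : (0 : ℝ) ≤ i := Nat.cast_nonneg i
  have hp0 : (0 : ℝ) ≤ p := Nat.cast_nonneg p
  have hq0 : (0 : ℝ) ≤ q := Nat.cast_nonneg q
  have hk0 : (0 : ℝ) ≤ k := Nat.cast_nonneg k
  have hl' : (l : ℝ) = 2 * i + 1 := by rw [hl]; push_cast; ring
  have hN' : (N : ℝ) = 2 * p + 1 := by rw [hN]; push_cast; ring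
  have hj' : (j : ℝ) = p - i := by
    have : (l : ℝ) + 2 * j = N := by exact_mod_cast hj
    linarith
  have hc' : (c : ℝ) = l - q := by
    have : (q : ℝ) + c = l := by exact_mod_cast hc
    linarith
  have ha' : -1 < a := by linarith
  have hf : (N.factorial : ℝ) ≠ 0 := by positivity
  have hf' : (q.factorial : ℝ) ≠ 0 := by positivity
  have e1 : a + N ≠ 0 := by linarith
  have e2 : (a + N) / 2 ≠ 0 := by linarith
  have g1 := hΓ (by linarith : 0 < a - k + 1)
  have g2 := hΓ (by linarith : 0 < a - 2 * k + 1)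
  have g3 := hΓ (by linarith : 0 < a + 1)
  have g4 := hΓ (by linarith : 0 < a + 1 + N)
  have g5 := hΓ (by linarith : 0 < (a + 3) / 2 + i)
  have g6 := hΓ (by linarith : 0 < 3 / 2 + (i : ℝ))
  have g7 := hΓ (by linarith : 0 < (a + 3) / 2 + p)
  have g8 := hΓ (by linarith : 0 < 3 / 2 + (p : ℝ))
  have h1 := conn_zero_eq hr a (-(k : ℤ)) (by omega : q ≤ l)
  have h2 := conn_zero_eq hr a (-(k : ℤ)) (by omega : q ≤ N)
  push_cast at h1 h2
  rw [show l - q = c by omega] at h1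
  rw [show N - q = c + 2 * j by omega] at h2
  have h3 : (2 : ℝ) ^ (1 - (k : ℤ)) / 2 ^ (-(k : ℤ) - 2 * (j : ℤ) + 2) = 4 ^ j / 2 := by
    rw [← zpow_sub₀ two_ne_zero,
      show 1 - (k : ℤ) - (-(k : ℤ) - 2 * (j : ℤ) + 2) = (2 * j : ℕ) - 1 by push_cast; ring,
      zpow_sub₀ two_ne_zero, zpow_natCast, pow_mul, zpow_one]
    norm_num
  have p1 : poch (2 * b + N) (-(k : ℤ) - c - 2 * j + 1) =
      Gamma (a - k + 1 + q) / (Gamma (a + 1 + N) / (a + N)) := by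
    rw [show a + 1 + (N : ℝ) = a + N + 1 by ring, Gamma_add_one e1, mul_div_cancel_left₀ _ e1]
    exact poch_eq (by push_cast; linarith only [hl', hN', hj', hc', hab]) (by rw [hab])
  have p2 : poch ((N : ℝ) - c - 2 * j + 1) c = l.factorial / q.factorial := by
    rw [← Gamma_nat_eq_factorial, ← Gamma_nat_eq_factorial]
    exact poch_eq (by push_cast; linarith only [hl', hN', hj', hc'])
      (by linarith only [hl', hN', hj', hc'])
  have p3 : poch ((N : ℝ) / 2 + 1) (-(j : ℤ)) = Gamma (3 / 2 + i) / Gamma (3 / 2 + p) :=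
    poch_eq (by push_cast; linarith only [hN', hj']) (by linarith only [hN'])
  have p4 : poch (b + (N : ℝ) / 2) (1 - (j : ℤ)) =
      Gamma ((a + 3) / 2 + i) / (Gamma ((a + 3) / 2 + p) / ((a + N) / 2)) := by
    rw [show (a + 3) / 2 + (p : ℝ) = (a + N) / 2 + 1 by linarith only [hN'], Gamma_add_one e2,
      mul_div_cancel_left₀ _ e2]
    exact poch_eq (by push_cast; linarith only [hN', hj', hab]) (by linarith only [hab])
  have hmu1 := mu_zero_eq (r := r) ha k
  have hmu2 := mu_zero_eq (r := r) ha (2 * k)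
  push_cast at hmu2
  rw [show a - 2 * k + 1 + (k : ℝ) = a - k + 1 by ring] at hmu1
  rw [show a - 2 * k + 1 + 2 * (k : ℝ) = a + 1 by ring] at hmu2
  have h5 : r ^ (l + N) = r ^ (2 * q) * r ^ c * r ^ (c + 2 * j) := by
    rw [← pow_add, ← pow_add]; congr 1; omega
  have hrk : r ^ (2 * k) = r ^ k * r ^ k := by rw [two_mul, pow_add]
  have hr0 := hr.ne'
  have hr1 : r ^ (2 * q) ≠ 0 := pow_ne_zero _ hr0
  have hr2 : r ^ c ≠ 0 := pow_ne_zero _ hr0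
  have hr3 : r ^ (c + 2 * j) ≠ 0 := pow_ne_zero _ hr0
  have hr4 : r ^ k ≠ 0 := pow_ne_zero _ hr0
  rw [oddVal_div_hn_zero_eq ha' hr hl hN hj, hmu1, hmu2, h1, h2, hn_zero_eq (by linarith) hr, p1, p2,
    p3, p4, h5, hrk]
  have h6 : ∀ x y z u : ℝ, r ^ k * ((2 : ℝ) ^ (1 - (k : ℤ)) * (x * (y /
      (2 ^ (-(k : ℤ) - 2 * (j : ℤ) + 2) * z * u)))) = r ^ k * (4 ^ j / 2 * (x * (y / (z * u)))) := by
    intro x y z u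
    rw [← h3]; ring
  rw [h6]
  clear h1 h2 h3 h5 h6 p1 p2 p3 p4 hmu1 hmu2 hrk e2
  generalize r ^ (2 * q) = y1 at hr1 ⊢
  generalize r ^ c = y2 at hr2 ⊢
  generalize r ^ (c + 2 * j) = y3 at hr3 ⊢
  generalize r ^ k = y4 at hr4 ⊢
  generalize Gamma (a - k + 1) = x1 at g1 ⊢
  generalize Gamma (a - 2 * k + 1) = x2 at g2 ⊢
  generalize Gamma (a + 1) = x3 at g3 ⊢
  generalize Gamma (a + 1 + N) = x4 at g4 ⊢
  generalize Gamma ((a + 3) / 2 + i) = x5 at g5 ⊢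
  generalize Gamma (3 / 2 + (i : ℝ)) = x6 at g6 ⊢
  generalize Gamma ((a + 3) / 2 + p) = x7 at g7 ⊢
  generalize Gamma (3 / 2 + (p : ℝ)) = x8 at g8 ⊢
  generalize a + (N : ℝ) = u at e1 ⊢
  field_simp

/-- No sign appears because `2j` is even. The case `k = j = 0`, where the natural subtraction
truncates, is separate. -/
lemma choose_neg_two_mul (k j : ℕ) : ((Ring.choose (-(2 * k : ℤ)) (2 * j) : ℤ) : ℝ) =
    ((2 * k + 2 * j - 1).choose (2 * j) : ℝ) := by
  rcases Nat.eq_zero_or_pos (k + j) with h | h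
  · obtain ⟨rfl, rfl⟩ : k = 0 ∧ j = 0 := by omega
    simp
  · rw [Ring.choose_neg', Ring.multichoose_eq, show (2 * (k : ℤ) + (2 * j : ℕ) - 1) = ((2 * k + 2 * j - 1 : ℕ) : ℤ) by
      rw [Nat.cast_sub (by omega)]; push_cast; ring, Ring.choose_natCast]
    simp

set_option maxHeartbeats 1000000 in
lemma laguerre_single_term (ha : -1 < a - 2 * k) (hk : 1 ≤ k) (hr : 0 < r) (hl : l = 2 * i + 1)
    (hN : N = 2 * p + 1) (hj : l + 2 * j = N) (han : a = n + 1) (hn : n = N + 1) :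
    conn 0 N l a r (-(2 * k)) * oddVal 0 (a - 2 * k) r i /
      (rho 0 (a - 2 * k) r k * mu 0 (a - 2 * k) r (2 * k)) / oddVal 0 a r p =
    r ^ k * ((1 / 2) ^ (k - 1) * (((2 * k + 2 * j - 1).choose (2 * j) : ℝ) *
      (poch ((n : ℝ) + 1 / 2) (-(j : ℤ) - k) / (2 * poch ((1 + (n : ℝ)) / 2) (-(j : ℤ)))))) := by
  have hΓ : ∀ {y : ℝ}, 0 < y → Gamma y ≠ 0 := fun hy => (Gamma_pos_of_pos hy).ne'
  have hi0 : (0 : ℝ) ≤ i := Nat.cast_nonneg i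
  have hp0 : (0 : ℝ) ≤ p := Nat.cast_nonneg p
  have hk0 : (0 : ℝ) ≤ k := Nat.cast_nonneg k
  have hN' : (N : ℝ) = 2 * p + 1 := by rw [hN]; push_cast; ring
  have hp' : (p : ℝ) = i + j := by rw [show p = i + j by omega]; push_cast; ring
  have hn' : (n : ℝ) = N + 1 := by rw [hn]; push_cast; ring
  have ha' : -1 < a := by linarith
  have hf : (i.factorial : ℝ) ≠ 0 := by positivity
  have hf' : (p.factorial : ℝ) ≠ 0 := by positivity
  have g1 := hΓ (by linarith : 0 < (a - 2 * k + 1) / 2)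
  have g2 := hΓ (by linarith : 0 < a - 2 * k + 1)
  have g3 := hΓ (by linarith : 0 < a + 1)
  have g4 := hΓ (by linarith : 0 < (a + 1) / 2)
  have g5 := hΓ (by linarith : 0 < a / 2 + 1)
  have g6 := hΓ (by linarith : 0 < (a - 2 * k) / 2 + 1)
  have g7 := hΓ (by linarith : 0 < 3 / 2 + (i : ℝ))
  have g8 := hΓ (by linarith : 0 < 3 / 2 + (p : ℝ))
  have g9 := hΓ (by linarith : 0 < a / 2 + 1 + p)
  have h1 := conn_zero_eq hr a (-(2 * k : ℤ)) (by omega : l ≤ N)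
  push_cast at h1
  rw [show N - l = 2 * j by omega, choose_neg_two_mul, factorial_div_factorial_eq hl hN hj] at h1
  have hmu := mu_zero_eq (r := r) ha (2 * k)
  push_cast at hmu
  have hdup := Gamma_add_two_mul_nat_div (by linarith : 0 < a - 2 * k + 1) k
  rw [hdup] at hmu
  rw [show (a - 2 * k + 1) / 2 + (k : ℝ) = (a + 1) / 2 by ring,
    show (a - 2 * k + 1 + 1) / 2 + (k : ℝ) = a / 2 + 1 by ring,
    show (a - 2 * k + 1 + 1) / 2 = (a - 2 * (k : ℝ)) / 2 + 1 by ring] at hmu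
  have hrho := rho_zero_eq (r := r) ha k
  rw [show (a - 2 * k + 1) / 2 + (k : ℝ) = (a + 1) / 2 by ring] at hrho
  have p1 : poch ((n : ℝ) + 1 / 2) (-(j : ℤ) - k) =
      Gamma ((a - 2 * k) / 2 + 1 + i) / Gamma (a / 2 + 1 + p) :=
    poch_eq (by push_cast; linarith only [hn', hN', hp', han])
      (by linarith only [hn', hN', hp', han])
  have p2 : poch ((1 + (n : ℝ)) / 2) (-(j : ℤ)) = Gamma (3 / 2 + i) / Gamma (3 / 2 + p) :=
    poch_eq (by push_cast; linarith only [hn', hN', hp']) (by linarith only [hn', hN'])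
  have h4 : (4 : ℝ) ^ p = 4 ^ i * 4 ^ j := by rw [← pow_add]; congr 1; omega
  have h5 : r ^ (2 * p + 1) = r ^ (2 * i + 1) * r ^ (2 * j) := by rw [← pow_add]; congr 1; omega
  have h6 : r ^ (2 * k) = r ^ k * r ^ k := by rw [two_mul, pow_add]
  -- This isolates the factor `2 ^ (k - 1)` of the prefactor; it needs `1 ≤ k`.
  have h7 : (4 : ℝ) ^ k = 2 ^ k * (2 * 2 ^ (k - 1)) := by
    rw [← pow_succ', Nat.sub_add_cancel hk, ← mul_pow]; norm_num
  have hr0 := hr.ne'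
  have hr1 : r ^ (2 * i + 1) ≠ 0 := pow_ne_zero _ hr0
  have hr2 : r ^ (2 * j) ≠ 0 := pow_ne_zero _ hr0
  have hr3 : r ^ k ≠ 0 := pow_ne_zero _ hr0
  rw [h1, oddVal_zero_eq ha hr, oddVal_zero_eq ha' hr, hrho, hmu, p1, p2, h4, h5, h6, h7,
    one_div, inv_pow]
  clear h1 hmu hdup hrho p1 p2 h4 h5 h6 h7
  have h8 : (2 : ℝ) ^ (k - 1) ≠ 0 := by positivity
  generalize (2 : ℝ) ^ (k - 1) = y0 at h8 ⊢
  generalize r ^ (2 * i + 1) = y1 at hr1 ⊢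
  generalize r ^ (2 * j) = y2 at hr2 ⊢
  generalize r ^ k = y3 at hr3 ⊢
  generalize Gamma ((a - 2 * k + 1) / 2) = x1 at g1 ⊢
  generalize Gamma (a - 2 * k + 1) = x2 at g2 ⊢
  generalize Gamma (a + 1) = x3 at g3 ⊢
  generalize Gamma ((a + 1) / 2) = x4 at g4 ⊢
  generalize Gamma (a / 2 + 1) = x5 at g5 ⊢
  generalize Gamma ((a - 2 * k) / 2 + 1) = x6 at g6 ⊢
  generalize Gamma (3 / 2 + (i : ℝ)) = x7 at g7 ⊢
  generalize Gamma (3 / 2 + (p : ℝ)) = x8 at g8 ⊢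
  generalize Gamma (a / 2 + 1 + p) = x9 at g9 ⊢
  field_simp

end LaguerreMatching

end ClassicalEnsemble

/-! ### Laguerre correction term and assembly of the delay time moments. -/

namespace ClassicalEnsemble

section DelayMoments

open Finset Real BallisticCavity

variable {a b r : ℝ} {i p j k l N q c n : ℕ}

/-- The sign from the odd number of factors cancels the minus sign in front of the boundary sum. -/
lemma prod_neg_sub {x : ℝ} (hx : 0 < x) (hN : Odd N) :
    ∏ t ∈ range N, (-x - (t : ℝ)) = -(Gamma (x + N) / Gamma x) := by
  rw [← prod_add_nat hx, prod_congr rfl fun (t : ℕ) _ => show -x - (t : ℝ) = -1 * (x + t) by ring,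
    prod_mul_distrib, prod_const, card_range, hN.neg_one_pow]
  ring

-- The summation index is reversed, `i = k - 1 - j`. The bound `2k ≤ n` keeps the parameter `a - 2k`
-- of the shifted weight above `-1`.
set_option maxHeartbeats 1000000 in
lemma laguerre_boundary_term (hk : i + j + 1 = k) (hkn : 2 * k ≤ n) (hr : 0 < r)
    (hN : N = 2 * p + 1) (han : a = n + 1) (hn : n = N + 1) :
    -(2 * rho 0 (a - 2 * k) r i / (a - 2 * k + 1 + 2 * i) *
      (2 * (mu 0 (a - 2 * k) r i * d0 0 N a r (-(2 * k) + i)))) /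
        (rho 0 (a - 2 * k) r k * mu 0 (a - 2 * k) r (2 * k)) / oddVal 0 a r p =
    r ^ k * (Gamma n / (Gamma ((n : ℝ) / 2) * Gamma (2 * (n : ℝ))) *
      (Gamma ((k : ℝ) + j + n) * Gamma (1 + (n : ℝ) - k - j) /
        (Gamma ((n : ℝ) / 2 + 1 - j) * Gamma ((k : ℝ) + j + 1)) * (2 : ℝ) ^ j)) := by
  have hΓ : ∀ {y : ℝ}, 0 < y → Gamma y ≠ 0 := fun hy => (Gamma_pos_of_pos hy).ne'
  have hi0 : (0 : ℝ) ≤ i := Nat.cast_nonneg i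
  have hj0 : (0 : ℝ) ≤ j := Nat.cast_nonneg j
  have hp0 : (0 : ℝ) ≤ p := Nat.cast_nonneg p
  have hN' : (N : ℝ) = 2 * p + 1 := by rw [hN]; push_cast; ring
  have hk' : (k : ℝ) = i + j + 1 := by rw [← hk]; push_cast; ring
  have hn' : (n : ℝ) = 2 * p + 2 := by rw [hn]; push_cast; rw [hN']; ring
  have hkn' : 2 * (k : ℝ) ≤ n := by exact_mod_cast hkn
  have ha : -1 < a - 2 * k := by linarith
  have ha' : -1 < a := by linarith
  have hf : (p.factorial : ℝ) ≠ 0 := by positivity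
  have e1 : (a - 2 * k + 1) / 2 + i ≠ 0 := by linarith
  have g1 := hΓ (by linarith : 0 < (a - 2 * k + 1) / 2)
  have g2 := hΓ (by linarith : 0 < (a - 2 * k + 1) / 2 + i)
  have g3 := hΓ (by linarith : 0 < (n : ℝ) / 2 + 1)
  have g4 := hΓ (by linarith : 0 < a - 2 * k + 1)
  have g5 := hΓ (by linarith : 0 < (n : ℝ))
  have g6 := hΓ (by linarith : 0 < (n : ℝ) + 1 / 2)
  have g7 := hΓ (by linarith : 0 < ((n : ℝ) + 3) / 2)
  have g8 := hΓ (by linarith : 0 < (k : ℝ) + j + 1)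
  have g9 : √π ≠ 0 := (sqrt_pos.2 pi_pos).ne'
  have hrho := rho_zero_eq (r := r) ha
  have hrhok := hrho k
  rw [show (a - 2 * k + 1) / 2 + (k : ℝ) = n / 2 + 1 by rw [han]; ring] at hrhok
  have hmu1 := mu_zero_eq (r := r) ha i
  have hmu2 := mu_zero_eq (r := r) ha (2 * k)
  push_cast at hmu2
  rw [show a - 2 * k + 1 + (i : ℝ) = 1 + n - k - j by rw [han, hk']; ring] at hmu1
  have r1 := Gamma_eq_half_mul_half ((n : ℝ) + 2)
  rw [show ((n : ℝ) + 2) / 2 = n / 2 + 1 by ring,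
    show ((n : ℝ) + 2 + 1) / 2 = (n + 3) / 2 by ring,
    show (n : ℝ) + 2 - 1 = ((2 * p + 3 : ℕ) : ℝ) by rw [hn']; push_cast; ring, rpow_natCast,
    pow_add, pow_mul] at r1
  rw [show a - 2 * k + 1 + 2 * (k : ℝ) = n + 2 by rw [han]; ring, r1] at hmu2
  have r2 := Gamma_eq_half_mul_half (2 * (n : ℝ))
  rw [show 2 * (n : ℝ) / 2 = n by ring, show (2 * (n : ℝ) + 1) / 2 = n + 1 / 2 by ring,
    show 2 * (n : ℝ) - 1 = ((2 * p + 2 * p + 3 : ℕ) : ℝ) by rw [hn']; push_cast; ring, rpow_natCast,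
    pow_add, pow_add, pow_mul] at r2
  have hd := d0_zero_eq hr N a (-(2 * k) + i)
  rw [show -(2 * (k : ℝ)) + i = -(k + j + 1) by linarith only [hk'],
    prod_neg_sub (by linarith) ⟨p, hN⟩,
    show (k : ℝ) + j + 1 + N = k + j + n by rw [hN', hn']; ring] at hd
  have hβ := oddVal_zero_eq ha' hr p
  rw [show a / 2 + 1 + (p : ℝ) = n + 1 / 2 by rw [han, hn']; ring,
    show a / 2 + 1 = ((n : ℝ) + 3) / 2 by rw [han]; ring] at hβ
  have h1 : a - 2 * k + 1 + 2 * (i : ℝ) = 2 * ((a - 2 * k + 1) / 2 + i) := by ring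
  have h2 : Gamma ((n : ℝ) / 2 + 1 - j) =
      ((a - 2 * k + 1) / 2 + i) * Gamma ((a - 2 * k + 1) / 2 + i) := by
    rw [← Gamma_add_one e1]; congr 1; rw [han, hk']; ring
  have h3 : Gamma ((n : ℝ) / 2) = p.factorial := by
    rw [← Gamma_nat_eq_factorial]; congr 1; rw [hn']; ring
  have h4 : (2 : ℝ) ^ k = 2 ^ i * 2 ^ j * 2 := by rw [← hk, pow_succ, pow_add]
  have h5 : r ^ (2 * k) = r ^ k * r ^ k := by rw [two_mul, pow_add]
  rw [hrho i, hrhok, hmu1, hmu2, r2, show -(2 * (k : ℝ)) + i = -(k + j + 1) by linarith only [hk'],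
    hd, hβ, h1, h2, h3, h4, h5, hN, show (4 : ℝ) = 2 ^ 2 by norm_num]
  clear hrho hrhok hmu1 hmu2 r1 r2 hd hβ h1 h2 h3 h4 h5
  have hr0 := hr.ne'
  have hr1 : r ^ (2 * p + 1) ≠ 0 := pow_ne_zero _ hr0
  have hr2 : r ^ i ≠ 0 := pow_ne_zero _ hr0
  have hr3 : r ^ k ≠ 0 := pow_ne_zero _ hr0
  generalize r ^ (2 * p + 1) = y1 at hr1 ⊢
  generalize r ^ i = y2 at hr2 ⊢
  generalize r ^ k = y3 at hr3 ⊢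
  generalize √π = y4 at g9 ⊢
  generalize Gamma ((a - 2 * k + 1) / 2) = x1 at g1 ⊢
  generalize Gamma ((a - 2 * k + 1) / 2 + i) = x2 at g2 ⊢
  generalize Gamma ((n : ℝ) / 2 + 1) = x3 at g3 ⊢
  generalize Gamma (a - 2 * k + 1) = x4 at g4 ⊢
  generalize Gamma ((n : ℝ)) = x5 at g5 ⊢
  generalize Gamma ((n : ℝ) + 1 / 2) = x6 at g6 ⊢
  generalize Gamma (((n : ℝ) + 3) / 2) = x7 at g7 ⊢
  generalize Gamma ((k : ℝ) + j + 1) = x8 at g8 ⊢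
  generalize (a - 2 * k + 1) / 2 + (i : ℝ) = u at e1 ⊢
  field_simp

/-- This is the scaling of the weight: the orthogonal ensemble has rate `n`, whereas the unitary
moments in `halfSymplecticLaguerre` have rate `1`. -/
lemma negDiag_eq (ha : -1 < a - 2 * k) (hr : 0 < r) (l : ℕ) :
    negDiag a r k l = r ^ k * negDiag a 1 k l := by
  have hk0 : (0 : ℝ) ≤ k := Nat.cast_nonneg k
  have hr0 := hr.ne'
  have hconn : ∀ q ∈ range (l + 1), conn 0 l q a r (-k) * conn 0 l q a r (-k) * hn 0 q (a - k) r =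
      conn 0 l q a 1 (-k) * conn 0 l q a 1 (-k) * hn 0 q (a - k) 1 / r ^ (2 * l) := by
    intro q hq
    have hql : q ≤ l := by have := mem_range.1 hq; omega
    have h1 := conn_zero_eq hr a (-(k : ℤ)) hql
    have h2 := conn_zero_eq one_pos a (-(k : ℤ)) hql
    push_cast at h1 h2
    rw [h1, h2, hn_zero_eq (by linarith) hr, hn_zero_eq (by linarith) one_pos]
    simp only [one_pow, div_one]
    rw [show r ^ (2 * l) = r ^ (l - q) * r ^ (l - q) * r ^ (2 * q) by
      rw [← pow_add, ← pow_add]; congr 1; omega]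
    field_simp
  have hr1 : r ^ l ≠ 0 := pow_ne_zero _ hr0
  rw [negDiag, negDiag, sum_congr rfl hconn, ← sum_div, mu_zero_eq ha, mu_zero_eq ha, mu_zero_eq ha,
    mu_zero_eq ha, hn_zero_eq (by linarith) hr, hn_zero_eq (by linarith) one_pos]
  simp only [one_pow, div_one]
  have h3 : r ^ (2 * k) = r ^ k * r ^ k := by rw [two_mul, pow_add]
  have hrk : r ^ k ≠ 0 := pow_ne_zero _ hr0
  have hrl : r ^ (2 * l) ≠ 0 := pow_ne_zero _ hr0
  have g1 := (Gamma_pos_of_pos (by linarith : 0 < a - 2 * k + 1)).ne'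
  rw [h3]
  generalize r ^ (2 * l) = y1 at hrl ⊢
  generalize r ^ k = y2 at hrk ⊢
  field_simp

lemma laguerre_double_sum (hab : a = 2 * b) (ha : -1 < a - 2 * k) (hr : 0 < r) (p : ℕ) :
    (∑ i ∈ range p, oddVal 0 a r i / hn 0 (2 * i + 1) a r *
      (mu 0 (a - 2 * k) r k / mu 0 (a - 2 * k) r (2 * k) *
        ∑ q ∈ range (2 * i + 2), conn 0 (2 * i + 1) q a r (-k) * conn 0 (2 * p + 1) q a r (-k) *
          hn 0 q (a - k) r)) / oddVal 0 a r p =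
    r ^ k * ((2 : ℝ) ^ (1 - (k : ℤ)) * ∑ j ∈ Icc 1 p, ∑ c ∈ Icc 0 (2 * p + 1 - 2 * j),
      ((Ring.choose (-(k : ℤ)) c : ℤ) : ℝ) * ((Ring.choose (-(k : ℤ)) (c + 2 * j) : ℤ) : ℝ) *
        (poch (2 * b + (2 * p + 1 : ℕ)) (-(k : ℤ) - c - 2 * j + 1) *
          poch (((2 * p + 1 : ℕ) : ℝ) - c - 2 * j + 1) c /
          ((2 : ℝ) ^ (-(k : ℤ) - 2 * (j : ℤ) + 2) * poch (((2 * p + 1 : ℕ) : ℝ) / 2 + 1) (-(j : ℤ)) *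
            poch (b + ((2 * p + 1 : ℕ) : ℝ) / 2) (1 - (j : ℤ))))) := by
  rw [sum_div, sum_range_eq_sum_Icc_one, mul_sum, mul_sum]
  refine sum_congr rfl fun j hj => ?_
  rw [mem_Icc] at hj
  rw [mul_sum, mul_sum, mul_sum, mul_sum, sum_div, sum_range_eq_sum_Icc_zero,
    show 2 * (p - j) + 1 = 2 * p + 1 - 2 * j by omega]
  refine sum_congr rfl fun c hc => ?_
  rw [mem_Icc] at hc
  rw [← laguerre_double_term (i := p - j) (q := 2 * p + 1 - 2 * j - c) (l := 2 * p + 1 - 2 * j)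
    hab ha hr (by omega) rfl (by omega) (by omega)]
  ring

lemma laguerre_single_sum (ha : -1 < a - 2 * k) (hk : 1 ≤ k) (hr : 0 < r)
    (han : a = n + 1) (hn : n = 2 * p + 1 + 1) :
    (∑ i ∈ range (p + 1), conn 0 (2 * p + 1) (2 * i + 1) a r (-(2 * k)) *
      oddVal 0 (a - 2 * k) r i) / (rho 0 (a - 2 * k) r k * mu 0 (a - 2 * k) r (2 * k)) /
        oddVal 0 a r p =
    r ^ k * ((1 / 2) ^ (k - 1) * ∑ j ∈ Icc 0 p, ((2 * k + 2 * j - 1).choose (2 * j) : ℝ) *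
      (poch ((n : ℝ) + 1 / 2) (-(j : ℤ) - k) / (2 * poch ((1 + (n : ℝ)) / 2) (-(j : ℤ))))) := by
  rw [sum_div, sum_div, sum_range_eq_sum_Icc_zero, mul_sum, mul_sum]
  refine sum_congr rfl fun j hj => ?_
  rw [mem_Icc] at hj
  exact laguerre_single_term ha hk hr rfl rfl (by omega) han hn

lemma laguerre_boundary_sum (hkn : 2 * k ≤ n) (hr : 0 < r)
    (han : a = n + 1) (hn : n = 2 * p + 1 + 1) :
    -(∑ i ∈ range k, 2 * rho 0 (a - 2 * k) r i / (a - 2 * k + 1 + 2 * i) *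
      (2 * (mu 0 (a - 2 * k) r i * d0 0 (2 * p + 1) a r (-(2 * k) + i)))) /
        (rho 0 (a - 2 * k) r k * mu 0 (a - 2 * k) r (2 * k)) / oddVal 0 a r p =
    r ^ k * phiL k n := by
  rw [phiL, ← sum_neg_distrib, sum_div, sum_div, mul_sum, mul_sum, ← sum_range_reflect]
  refine sum_congr rfl fun j hj => ?_
  rw [mem_range] at hj
  exact laguerre_boundary_term (by omega) hkn hr rfl han hn

/-- Moments of the proper delay times in the orthogonal symmetry class. -/
theorem delayMoment_one (hn : Even n) (hn0 : 0 < n) (hk : 1 ≤ k) (hkn : (k : ℝ) < n / 2 + 1) :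
    AverageExists 1 (delayWeight 1 n) (Set.Ici 0) n (fun γ => (γ⁻¹) ^ k) ∧
      delayMoment 1 k n =
        (n : ℝ) ^ (k - 1) * (2 : ℝ) ^ (1 - (k : ℤ)) *
            halfSymplecticLaguerre (((n : ℝ) + 1) / 2) (-(k : ℤ)) (n - 1) +
          ((n : ℝ) / 2) ^ (k - 1) *
            ∑ j ∈ Icc 0 (n / 2 - 1),
              ((2 * k + 2 * j - 1).choose (2 * j) : ℝ) *
                (poch ((n : ℝ) + 1 / 2) (-(j : ℤ) - k) /
                  (2 * poch ((1 + (n : ℝ)) / 2) (-(j : ℤ)))) +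
          (n : ℝ) ^ (k - 1) * phiL k n := by
  obtain ⟨p, hp⟩ : ∃ p, n = 2 * (p + 1) := by
    obtain ⟨s, hs⟩ := hn
    exact ⟨s - 1, by omega⟩
  have hr : (0 : ℝ) < n := by exact_mod_cast hn0
  -- As `n` is even, `k < n / 2 + 1` amounts to `2k ≤ n`, which makes the shifted parameter `n + 1 -
  -- 2k` admissible.
  have hkn' : 2 * k ≤ n := by
    have h1 : 2 * (k : ℝ) < n + 2 := by linarith
    have h2 : 2 * k < n + 2 := by exact_mod_cast h1
    omega
  have hkn'' : 2 * (k : ℝ) ≤ n := by exact_mod_cast hkn'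
  have ha : -1 < (n : ℝ) + 1 - 2 * k := by linarith
  have hw : delayWeight 1 n = expWeight ((n : ℝ) / 2) n := by
    funext x
    rw [delayWeight, expWeight]
    congr 2 <;> push_cast <;> ring
  have hw2 : laguerreWeight 2 (2 * (((n : ℝ) + 1) / 2)) =
      fun x => x ^ ((n : ℝ) + 1) * Real.exp (-1 * x) := by
    funext x
    rw [laguerreWeight]
    congr 2 <;> push_cast <;> ring
  have hM : laguerreMoment 2 (2 * (((n : ℝ) + 1) / 2)) (-(k : ℤ)) (2 * p + 1) =
      ∑ l ∈ range (2 * p + 1), negDiag ((n : ℝ) + 1) 1 k l := by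
    rw [laguerreMoment, hw2, ← average_two_exp one_pos ha]
    congr 1
    funext x
    rw [zpow_neg, zpow_natCast, inv_pow]
  obtain ⟨h1, h2⟩ := average_one_exp (c := (n : ℝ) / 2) (k := k) hr ha (by ring) p
  rw [← hp] at h1 h2
  rw [delayMoment, hw]
  refine ⟨h1, ?_⟩
  have h3 : (n : ℝ) ^ k = n ^ (k - 1) * n := by rw [← pow_succ, Nat.sub_add_cancel hk]
  -- The prefactor `2 ^ (1 - k)` exactly undoes the power of two in front of the unitary moment.
  have h4 : (2 : ℝ) ^ (1 - (k : ℤ)) * 2 ^ (- -(k : ℤ) - 1) = 1 := by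
    rw [← zpow_add₀ two_ne_zero]; simp
  have h5 : ((n : ℝ) / 2) ^ (k - 1) = n ^ (k - 1) * (1 / 2) ^ (k - 1) := by rw [← mul_pow]; ring
  have h6 : 1 / (n : ℝ) * n = 1 := by field_simp
  have hsplit : ∀ A B C D E : ℝ,
      (-A + (B - C) / D) / E = -(A / E) + (B / D / E + -C / D / E) := by
    intros; ring
  have key : ∀ S D T P : ℝ,
      1 / (n : ℝ) * (n ^ k * S + (-(n ^ k * ((2 : ℝ) ^ (1 - (k : ℤ)) * D)) +
        (n ^ k * ((1 / 2) ^ (k - 1) * T) + n ^ k * P))) =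
      (n : ℝ) ^ (k - 1) * (2 : ℝ) ^ (1 - (k : ℤ)) * ((2 : ℝ) ^ (- -(k : ℤ) - 1) * S - D) +
        (n / 2) ^ (k - 1) * T + n ^ (k - 1) * P := by
    intro S D T P
    rw [h3, h5]
    linear_combination (n : ℝ) ^ (k - 1) *
      (S - 2 ^ (1 - (k : ℤ)) * D + (1 / 2) ^ (k - 1) * T + P) * h6 - n ^ (k - 1) * S * h4
  rw [h2, halfSymplecticLaguerre, show n - 1 = 2 * p + 1 by omega,
    show n / 2 - 1 = p by omega, show (2 * p + 1) / 2 = p by omega, hM,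
    sum_congr rfl fun l _ => negDiag_eq ha hr l, ← mul_sum, hsplit,
    laguerre_double_sum (b := ((n : ℝ) + 1) / 2) (by ring) ha hr,
    laguerre_single_sum ha hk hr rfl (by omega), laguerre_boundary_sum hkn' hr rfl (by omega)]
  exact key _ _ _ _

end DelayMoments

end ClassicalEnsemble
theorem theorem2p3 (n k : ℕ) (hn : Even n) (hn0 : 0 < n) (hk : 1 ≤ k) :
    (∀ (m : ℕ) (δ : ℝ), n ≤ m → -2 < δ →
      BallisticCavity.AverageExists 1 (BallisticCavity.transmissionWeight 1 δ n m)
          (Set.Icc 0 1) n (fun T => T ^ k) ∧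
        BallisticCavity.transmissionMoment 1 δ k n m =
          2 * BallisticCavity.halfSymplecticTransmission (2 * δ + 4) k (n - 1) (m - 1) +
            ∑ j ∈ Finset.Icc 0 (min (n / 2 - 1) k),
              ((2 * k).choose (2 * j) : ℝ) * BallisticCavity.orthogonalCoeff δ j k m n +
            BallisticCavity.phiJ δ k n m ∧
        (2 * k < n → BallisticCavity.phiJ δ k n m = 0)) ∧
    ((k : ℝ) < (n : ℝ) / 2 + 1 →
      BallisticCavity.AverageExists 1 (BallisticCavity.delayWeight 1 n)
          (Set.Ici 0) n (fun γ => (γ⁻¹) ^ k) ∧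
        BallisticCavity.delayMoment 1 k n =
          (n : ℝ) ^ (k - 1) * (2 : ℝ) ^ (1 - (k : ℤ)) *
              BallisticCavity.halfSymplecticLaguerre (((n : ℝ) + 1) / 2) (-(k : ℤ)) (n - 1) +
            ((n : ℝ) / 2) ^ (k - 1) *
              ∑ j ∈ Finset.Icc 0 (n / 2 - 1),
                ((2 * k + 2 * j - 1).choose (2 * j) : ℝ) *
                  (BallisticCavity.poch ((n : ℝ) + 1 / 2) (-(j : ℤ) - k) /
                    (2 * BallisticCavity.poch ((1 + (n : ℝ)) / 2) (-(j : ℤ)))) +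
            (n : ℝ) ^ (k - 1) * BallisticCavity.phiL k n) := by
  exact ⟨fun m δ hm hδ =>
      have h := ClassicalEnsemble.transmissionMoment_one k hn hn0 hm hδ
      ⟨h.1, h.2, ClassicalEnsemble.phiJ_eq_zero⟩,
    fun hkn => ClassicalEnsemble.delayMoment_one hn hn0 hk hkn⟩
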